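/- Let $(\mathcal C,\omega)$ be a $6$-dimensional complex symplectic vector space, let $X=\mathrm{LG}(3,\mathcal C)$ be the variety of its Lagrangian subspaces in its Plücker embedding, and let $\Lambda^3_0(\mathcal C^*)$ be the space of effective $3$-forms, i.e. of those $\eta\in\Lambda^3(\mathcal C^*)$ with $\omega^{ij}\eta_{ijk}=0$; thus $\mathbb P(\Lambda^3_0(\mathcal C^*))$ is the space of hyperplane sections of $X$. For $0\ne\eta\in\Lambda^3_0(\mathcal C^*)$ let $$\mathcal E_\eta=\{L\in X\mid \eta|_L=0\}$$ be the associated Monge–Ampère equation. For $L\in\mathcal E_\eta$ use the identifications $\mathcal C/L=L^*$, $a\mapsto\omega(a,\cdot)|_L$, and $T_LX=S^2(L^*)$, and let $$\widetilde\eta_L:S^2(L^*)\to\Lambda^3(L^*),\qquad h\mapsto \eta(h\,\cdot,\cdot,\cdot)+\eta(\cdot,h\,\cdot,\cdot)+\eta(\cdot,\cdot,h\,\cdot).$$ The smooth points of $\mathcal E_\eta$ are those where $\widetilde\eta_L\neq0$. Up to the choice of a generator of $\Lambda^3(L^*)$, $\widetilde\eta_L$ is a quadratic form on $L^*$; it cuts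 out the characteristic variety $\sigma_L\subset\mathbb P(L^*)$. The dual $\sigma_L^\vee\subset\mathbb P(L)\subset\mathbb P(\mathcal C)$ of $\sigma_L$ is the zero set of the quadratic form $\Lambda^2(\widetilde\eta_L)$ on $L$ whose matrix is the cofactor matrix of $\widetilde\eta_L$ (the dual conic, if $\sigma_L$ is nonsingular). The cocharacteristic variety of $\mathcal E_\eta$ is the Zariski closure $$\sigma^\vee=\overline{\bigcup_{L\in(\mathcal E_\eta)_{\rm sm}}\sigma_L^\vee}\subset\mathbb P(\mathcal C).$$ Identify $\Lambda^6(\mathcal C^*)$ with $\mathbb C$ by means of a basis of $\mathcal C$, let $\Omega(\alpha,\beta)=\alpha\wedge\beta$ on $\Lambda^3(\mathcal C^*)$, and let $\varpi(\eta)\in S^2(\mathcal C^*)$ be the quadratic form that corresponds to the moment map $X\mapsto\tfrac12\Omega(X\cdot\eta,\eta)$ in $\mathfrak{sp}(\mathcal C)^*$, where $\mathfrak{sp}(\mathcal C)^*=S^2(\mathcal C^*)$ is dual to the isomorphism $S^2(\mathcal C)=\mathfrak{sp}(\mathcal C)$, $a^2\mapsto\omega(a,\cdot)\,a$; that is, $\varpi(\eta)(a)$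 is the value of the moment map at $\omega(a,\cdot)\,a$. Let $X^\vee\subset\mathbb P(\Lambda^3_0(\mathcal C^*))$ be the projective dual of $X$ (the hypersurface of hyperplanes tangent to $X$), $\mathrm{Sing}(X^\vee)$ its singular locus, and $X^*\subset\mathbb P(\Lambda^3_0(\mathcal C^*))$ the copy of $X$ consisting of the classes $[\omega(l_1,\cdot)\wedge\omega(l_2,\cdot)\wedge\omega(l_3,\cdot)]$, where $l_1,l_2,l_3$ is a basis of a Lagrangian subspace. For a $3$-dimensional subspace $D\subset\mathcal C$ put $\mathcal E_D=\{L\in X\mid L\cap D\neq0\}$ and $\ell_D=D\cap D^\perp$, where $\perp$ is the orthogonal with respect to $\omega$. Then, for every $0\ne\eta\in\Lambda^3_0(\mathcal C^*)$, the cocharacteristic variety of $\mathcal E_\eta$ is cut out by the quadratic form $\varpi(\eta)$: $$\sigma^\vee=\{[v]\in\mathbb P(\mathcal C)\mid \varpi(\eta)(v)=0\}.$$ In particular: * (O) if $[\eta]\notin X^\vee$, then the quadratic form $\varpi(\eta)$ is irreducible (as a polynomial) of rank $6$, and the variety $\sigma^\vee$ is nonsingular; * (L) if $[\eta]\in X^\vee\smallsetminus\mathrm{Sing}(X^\vee)$,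 then $\varpi(\eta)$ is irreducible of rank $3$, and the singular locus of the variety $\sigma^\vee$ is exactly the vertex $\mathbb P(\mathrm{rad}\,\varpi(\eta))$; * (G) if $[\eta]\in\mathrm{Sing}(X^\vee)\smallsetminus X^*$, then $\varpi(\eta)$ is reducible of rank $1$, and the (reduced) variety $\sigma^\vee$ is nonsingular; there are $3$-dimensional subspaces $D\subset\mathcal C$ with $\mathcal E_D=\mathcal E_\eta$, and for each of them $\dim\ell_D=1$ and $\sigma^\vee$ is the hyperplane $\mathbb P(\ell_D^\perp)$; * (P) if $[\eta]\in X^*$, then $\varpi(\eta)$ has rank $0$ and $\sigma^\vee=\mathbb P(\mathcal C)$. -/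

import Mathlib

open scoped LinearAlgebra.Projectivization

noncomputable section

namespace MongeAmpere

/-! ### Projective geometry over the complex numbers -/

section Projective

variable {E : Type*} [AddCommGroup E] [Module ℂ E]

/-- The algebra of polynomial functions on a complex vector space: it is generated by the linear
functionals. -/
def polyFun (E : Type*) [AddCommGroup E] [Module ℂ E] : Subalgebra ℂ (E → ℂ) :=
  Algebra.adjoin ℂ (Set.range fun l : Module.Dual ℂ E => (l : E → ℂ))

/-- `f` is a homogeneous polynomial function on `E`. -/
def IsHomogPoly (f : E → ℂ) : Prop :=
  f ∈ polyFun E ∧ ∃ d : ℕ, ∀ (t : ℂ) (v : E), f (t • v) = t ^ d * f v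

/-- The homogeneous polynomial function `f` vanishes on the set `Z` of points of `ℙ(E)`. -/
def VanishesOn (f : E → ℂ) (Z : Set (ℙ ℂ E)) : Prop :=
  ∀ p ∈ Z, f p.rep = 0

/-- Zariski closure of a subset of `ℙ(E)`. -/
def zariskiClosure (Z : Set (ℙ ℂ E)) : Set (ℙ ℂ E) :=
  {p | ∀ f : E → ℂ, IsHomogPoly f → VanishesOn f Z → f p.rep = 0}

/-- The singular locus of a (reduced) hypersurface `Z ⊂ ℙ(E)`: the points of `Z` at which the
differentials of all elements of the homogeneous vanishing ideal of `Z` are zero. -/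
def singularLocus (Z : Set (ℙ ℂ E)) : Set (ℙ ℂ E) :=
  {p | p ∈ Z ∧ ∀ f : E → ℂ, IsHomogPoly f → VanishesOn f Z →
    ∀ w : E, deriv (fun t : ℂ => f (p.rep + t • w)) 0 = 0}

/-- The linear subspace `ℙ(W) ⊂ ℙ(E)` of a vector subspace `W ⊂ E`. -/
def projSubspace (W : Submodule ℂ E) : Set (ℙ ℂ E) :=
  {p | p.rep ∈ W}

/-- The subset of `ℙ(E)` cut out by a quadratic form. -/
def quadric (Q : QuadraticForm ℂ E) : Set (ℙ ℂ E) :=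
  {p | Q p.rep = 0}

/-- The radical of a quadratic form. -/
def radical (Q : QuadraticForm ℂ E) : Submodule ℂ E :=
  LinearMap.ker Q.polarBilin

/-- The rank of a quadratic form. -/
def quadRank (Q : QuadraticForm ℂ E) : ℕ :=
  Module.finrank ℂ (LinearMap.range Q.polarBilin)

/-- The homogeneous polynomial of degree two representing a quadratic form in the linear
coordinates of a basis `e`. -/
def quadPoly {ι : Type*} [Fintype ι] (e : Module.Basis ι ℂ E) (Q : QuadraticForm ℂ E) :
    MvPolynomial ι ℂ :=
  ∑ i, ∑ j, MvPolynomial.C (QuadraticMap.associated Q (e i) (e j)) *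
    MvPolynomial.X i * MvPolynomial.X j

end Projective

/-! ### Symplectic linear algebra -/

/-- A symplectic form on a complex vector space. -/
structure SymplecticForm (C : Type*) [AddCommGroup C] [Module ℂ C] where
  /-- the underlying bilinear form -/
  form : LinearMap.BilinForm ℂ C
  alt : form.IsAlt
  nondeg : form.Nondegenerate

/-- Three-forms on `C`, i.e. the elements of `Λ³(C*)`. -/
abbrev ThreeForm (C : Type*) [AddCommGroup C] [Module ℂ C] := C [⋀^Fin 3]→ₗ[ℂ] ℂ

theorem update_zero {C : Type*} (u : Fin 3 → C) (x : C) : Function.update u 0 x = ![x, u 1, u 2] := by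
  ext i; fin_cases i <;> rfl

theorem update_one {C : Type*} (u : Fin 3 → C) (x : C) : Function.update u 1 x = ![u 0, x, u 2] := by
  ext i; fin_cases i <;> rfl

theorem update_two {C : Type*} (u : Fin 3 → C) (x : C) : Function.update u 2 x = ![u 0, u 1, x] := by
  ext i; fin_cases i <;> rfl

variable {C : Type*} [AddCommGroup C] [Module ℂ C]

theorem threeForm_add_zero (η : ThreeForm C) (x y v w : C) :
    η ![x + y, v, w] = η ![x, v, w] + η ![y, v, w] := by
  have h := η.map_update_add ![0, v, w] 0 x y
  rw [update_zero, update_zero, update_zero] at h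
  exact h

theorem threeForm_add_one (η : ThreeForm C) (u x y w : C) :
    η ![u, x + y, w] = η ![u, x, w] + η ![u, y, w] := by
  have h := η.map_update_add ![u, 0, w] 1 x y
  rw [update_one, update_one, update_one] at h
  exact h

theorem threeForm_add_two (η : ThreeForm C) (u v x y : C) :
    η ![u, v, x + y] = η ![u, v, x] + η ![u, v, y] := by
  have h := η.map_update_add ![u, v, 0] 2 x y
  rw [update_two, update_two, update_two] at h
  exact h

theorem threeForm_smul_zero (η : ThreeForm C) (c : ℂ) (x v w : C) :
    η ![c • x, v, w] = c * η ![x, v, w] := by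
  have h := η.map_update_smul ![0, v, w] 0 c x
  rw [update_zero, update_zero] at h
  exact h

theorem threeForm_smul_one (η : ThreeForm C) (c : ℂ) (u x w : C) :
    η ![u, c • x, w] = c * η ![u, x, w] := by
  have h := η.map_update_smul ![u, 0, w] 1 c x
  rw [update_one, update_one] at h
  exact h

theorem threeForm_smul_two (η : ThreeForm C) (c : ℂ) (u v x : C) :
    η ![u, v, c • x] = c * η ![u, v, x] := by
  have h := η.map_update_smul ![u, v, 0] 2 c x
  rw [update_two, update_two] at h
  exact h

theorem threeForm_swap_zero_one (η : ThreeForm C) (u v w : C) :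
    η ![v, u, w] = -η ![u, v, w] := by
  have h := η.map_swap ![u, v, w] (i := 0) (j := 1) (by decide)
  rw [← h]; congr 1; ext i; fin_cases i <;> rfl

theorem threeForm_swap_one_two (η : ThreeForm C) (u v w : C) :
    η ![u, w, v] = -η ![u, v, w] := by
  have h := η.map_swap ![u, v, w] (i := 1) (j := 2) (by decide)
  rw [← h]; congr 1; ext i; fin_cases i <;> rfl

theorem threeForm_swap_zero_two (η : ThreeForm C) (u v w : C) :
    η ![w, v, u] = -η ![u, v, w] := by
  have h := η.map_swap ![u, v, w] (i := 0) (j := 2) (by decide)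
  rw [← h]; congr 1; ext i; fin_cases i <;> rfl

/-- The bilinear form `(u, v) ↦ η(w, u, v)`. -/
def insertVec (η : ThreeForm C) (w : C) : LinearMap.BilinForm ℂ C :=
  LinearMap.mk₂ ℂ (fun u v => η ![w, u, v])
    (fun x y v => threeForm_add_one η w x y v)
    (fun c x v => threeForm_smul_one η c w x v)
    (fun u x y => threeForm_add_two η w u x y)
    (fun c u x => threeForm_smul_two η c w u x)

/-- The contraction of a three-form with the inverse of `ω`: its value at `w` is the trace of
`ω⁻¹ ∘ η(w, ·, ·)`, that is `± ω^{ij} η_{kij} w^k` in coordinates. -/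
def contract [FiniteDimensional ℂ C] (ω : SymplecticForm C) (η : ThreeForm C) (w : C) : ℂ :=
  LinearMap.trace ℂ C ((ω.form.toDual ω.nondeg).symm.toLinearMap ∘ₗ insertVec η w)

/-- The space `Λ³₀(C*)` of effective three-forms: the kernel of the contraction with the
inverse of `ω`. -/
def effectiveForms [FiniteDimensional ℂ C] (ω : SymplecticForm C) : Submodule ℂ (ThreeForm C) where
  carrier := {η | ∀ w, contract ω η w = 0}
  zero_mem' := by
    intro w
    have h : insertVec (0 : ThreeForm C) w = 0 := by ext u v; rfl
    simp [contract, h]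
  add_mem' := by
    intro α β hα hβ w
    have h : insertVec (α + β) w = insertVec α w + insertVec β w := by ext u v; rfl
    have h1 := hα w
    have h2 := hβ w
    simp only [contract] at h1 h2 ⊢
    rw [h, LinearMap.comp_add, map_add, h1, h2, add_zero]
  smul_mem' := by
    intro c α hα w
    have h : insertVec (c • α) w = c • insertVec α w := by ext u v; rfl
    have h1 := hα w
    simp only [contract] at h1 ⊢
    rw [h, LinearMap.comp_smul, map_smul, h1, smul_zero]

/-- Lagrangian subspaces of the six-dimensional symplectic space `C`, i.e. the points of the
Lagrangian Grassmannian `X = LG(3, C)`. -/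
def IsLagrangian (ω : SymplecticForm C) (L : Submodule ℂ C) : Prop :=
  Module.finrank ℂ L = 3 ∧ ∀ u ∈ L, ∀ v ∈ L, ω.form u v = 0

/-! ### Monge-Ampère equations -/

/-- The Monge-Ampère equation `E_η`: the hyperplane section of the Lagrangian Grassmannian (in its
Plücker embedding) determined by `η`. -/
def mongeAmpere (ω : SymplecticForm C) (η : ThreeForm C) : Set (Submodule ℂ C) :=
  {L | IsLagrangian ω L ∧ ∀ u : Fin 3 → C, (∀ i, u i ∈ L) → η u = 0}

/-- The Goursat type Monge-Ampère equation `E_D` of a subspace `D`. -/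
def goursat (ω : SymplecticForm C) (D : Submodule ℂ C) : Set (Submodule ℂ C) :=
  {L | IsLagrangian ω L ∧ L ⊓ D ≠ ⊥}

/-- A linear map `h : L → C` represents a tangent vector at `L` to the Lagrangian Grassmannian,
i.e. an element of `S²(L*)`: the identification `C/L = L*` is `a ↦ ω(a, ·)|_L`. -/
def IsTangent (ω : SymplecticForm C) (L : Submodule ℂ C) (h : L →ₗ[ℂ] C) : Prop :=
  ∀ u v : L, ω.form (h u) v = ω.form (h v) u

/-- The value `η(h ⌟ (u₁ ∧ u₂ ∧ u₃)) = η(h u₁, u₂, u₃) + η(u₁, h u₂, u₃) + η(u₁, u₂, h u₃)`, for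
`u₁, u₂, u₃` in `L`. For tangent vectors `h` at a point `L` of `E_η`, this is the linear map
`η̃_L : S²(L*) → Λ³(L*)`, whose kernel is the tangent space of `E_η` at `L`. -/
def symbol (η : ThreeForm C) (L : Submodule ℂ C) (h : L →ₗ[ℂ] C) (u : Fin 3 → L) : ℂ :=
  ∑ i, η (Function.update (fun j => (u j : C)) i (h (u i)))

/-- The hyperplane `η = 0` is tangent to the Lagrangian Grassmannian at its point `L`. -/
def IsTangentHyperplane (ω : SymplecticForm C) (η : ThreeForm C) (L : Submodule ℂ C) : Prop :=
  L ∈ mongeAmpere ω η ∧ ∀ h : L →ₗ[ℂ] C, IsTangent ω L h → ∀ u : Fin 3 → L, symbol η L h u = 0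

/-- The smooth points of `E_η`: the points `L` of `E_η` where `η̃_L` is not zero. -/
def smoothPoints (ω : SymplecticForm C) (η : ThreeForm C) : Set (Submodule ℂ C) :=
  {L | L ∈ mongeAmpere ω η ∧ ¬ IsTangentHyperplane ω η L}

/-! ### The cocharacteristic variety -/

/-- `l` is a basis of the three-dimensional subspace `L` and the classes of the `m i` in
`C/L = L*` form the dual basis. -/
def IsAdaptedFrame (ω : SymplecticForm C) (L : Submodule ℂ C) (l m : Fin 3 → C) : Prop :=
  LinearIndependent ℂ l ∧ Submodule.span ℂ (Set.range l) = L ∧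
    ∀ i j, ω.form (m i) (l j) = if i = j then 1 else 0

/-- The symmetric matrix of `η̃_L`, regarded as a quadratic form on `L*`, in an adapted frame: its
entry `(i, j)` is the value of `η̃_L` on the element `(lⁱ ⊗ lʲ + lʲ ⊗ lⁱ) / 2` of `S²(L*)`, where
`lⁱ` is the basis of `L*` dual to `l`. This element is represented by the map
`l k ↦ (δ_{ik} m j + δ_{jk} m i) / 2`. -/
def symbolMatrix (η : ThreeForm C) (l m : Fin 3 → C) : Matrix (Fin 3) (Fin 3) ℂ :=
  fun i j => (η (Function.update l i (m j)) + η (Function.update l j (m i))) / 2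

/-- The dual `σ_L^∨ ⊂ ℙ(L) ⊂ ℙ(C)` of the characteristic variety `σ_L = {η̃_L = 0} ⊂ ℙ(L*)`: it is
cut out by the quadratic form `Λ²(η̃_L)` on `L`, whose matrix is the cofactor matrix of `η̃_L`. -/
def cocharacteristicAt (ω : SymplecticForm C) (η : ThreeForm C) (L : Submodule ℂ C) :
    Set (ℙ ℂ C) :=
  {p | ∃ (l m : Fin 3 → C) (c : Fin 3 → ℂ), IsAdaptedFrame ω L l m ∧ p.rep = ∑ i, c i • l i ∧
    dotProduct c (Matrix.mulVec (symbolMatrix η l m).adjugate c) = 0}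

/-- The cocharacteristic variety `σ^∨ ⊂ ℙ(C)` of `E_η`. -/
def cocharacteristic (ω : SymplecticForm C) (η : ThreeForm C) : Set (ℙ ℂ C) :=
  zariskiClosure (⋃ L ∈ smoothPoints ω η, cocharacteristicAt ω η L)

/-! ### The strata of the space of Monge-Ampère equations -/

/-- The projective dual `X^∨ ⊂ ℙ(Λ³₀(C*))` of the (smooth) Lagrangian Grassmannian: the set of the
hyperplanes that are tangent to it at some point. -/
def dualVariety [FiniteDimensional ℂ C] (ω : SymplecticForm C) : Set (ℙ ℂ (effectiveForms ω)) :=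
  {p | ∃ L : Submodule ℂ C, IsTangentHyperplane ω (p.rep : ThreeForm C) L}

/-- The copy `X* ⊂ ℙ(Λ³₀(C*))` of the Lagrangian Grassmannian, obtained by means of the isomorphism
`C = C*`, `v ↦ ω(v, ·)`: the classes of the forms `ω(l₁, ·) ∧ ω(l₂, ·) ∧ ω(l₃, ·)`, where
`l₁, l₂, l₃` is a basis of a Lagrangian subspace. -/
def lagrangianForms [FiniteDimensional ℂ C] (ω : SymplecticForm C) :
    Set (ℙ ℂ (effectiveForms ω)) :=
  {p | ∃ (L : Submodule ℂ C) (l : Fin 3 → C), IsLagrangian ω L ∧ LinearIndependent ℂ l ∧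
    Submodule.span ℂ (Set.range l) = L ∧
    ∀ u : Fin 3 → C, (p.rep : ThreeForm C) u = Matrix.det fun i j => ω.form (l i) (u j)}

/-! ### The moment map -/

/-- The symplectic Lie algebra `sp(C)`: the endomorphisms `X` such that `Q_X = ω(X ·, ·)` is
symmetric. -/
def sp (ω : SymplecticForm C) : Submodule ℂ (Module.End ℂ C) where
  carrier := {X | ∀ u v, ω.form (X u) v = ω.form (X v) u}
  zero_mem' := by intro u v; simp
  add_mem' := by
    intro X Y hX hY u v
    simp [hX u v, hY u v]
  smul_mem' := by
    intro c X hX u v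
    simp [hX u v]

/-- The natural action of an endomorphism `X` of `C` on three-forms:
`(X · η)(u₁, u₂, u₃) = - η(X u₁, u₂, u₃) - η(u₁, X u₂, u₃) - η(u₁, u₂, X u₃)`. -/
def lieAct (X : Module.End ℂ C) (η : ThreeForm C) : ThreeForm C where
  toFun u := -(η ![X (u 0), u 1, u 2] + η ![u 0, X (u 1), u 2] + η ![u 0, u 1, X (u 2)])
  map_update_add' := by
    intro inst u i x y
    obtain rfl : inst = instDecidableEqFin 3 := Subsingleton.elim _ _
    have hi : i = 0 ∨ i = 1 ∨ i = 2 := by omega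
    rcases hi with rfl | rfl | rfl
    · simp only [update_zero, Matrix.cons_val, map_add, threeForm_add_zero]; ring
    · simp only [update_one, Matrix.cons_val, map_add, threeForm_add_one]; ring
    · simp only [update_two, Matrix.cons_val, map_add, threeForm_add_two]; ring
  map_update_smul' := by
    intro inst u i c x
    obtain rfl : inst = instDecidableEqFin 3 := Subsingleton.elim _ _
    have hi : i = 0 ∨ i = 1 ∨ i = 2 := by omega
    rcases hi with rfl | rfl | rfl
    · simp only [update_zero, Matrix.cons_val, map_smul, threeForm_smul_zero, smul_eq_mul]; ring
    · simp only [update_one, Matrix.cons_val, map_smul, threeForm_smul_one, smul_eq_mul]; ring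
    · simp only [update_two, Matrix.cons_val, map_smul, threeForm_smul_two, smul_eq_mul]; ring
  map_eq_zero_of_eq' := by
    intro u i j h hij
    have h01 : ∀ a b : C, η ![a, a, b] = 0 := fun a b =>
      η.map_eq_zero_of_eq ![a, a, b] (i := 0) (j := 1) rfl (by decide)
    have h12 : ∀ a b : C, η ![b, a, a] = 0 := fun a b =>
      η.map_eq_zero_of_eq ![b, a, a] (i := 1) (j := 2) rfl (by decide)
    have h02 : ∀ a b : C, η ![a, b, a] = 0 := fun a b =>
      η.map_eq_zero_of_eq ![a, b, a] (i := 0) (j := 2) rfl (by decide)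
    have k01 : u 0 = u 1 → -(η ![X (u 0), u 1, u 2] + η ![u 0, X (u 1), u 2] +
        η ![u 0, u 1, X (u 2)]) = 0 := fun h => by
      rw [h, h01, threeForm_swap_zero_one η (u 1) (X (u 1))]; ring
    have k02 : u 0 = u 2 → -(η ![X (u 0), u 1, u 2] + η ![u 0, X (u 1), u 2] +
        η ![u 0, u 1, X (u 2)]) = 0 := fun h => by
      rw [h, h02, threeForm_swap_zero_two η (u 2) (u 1) (X (u 2))]; ring
    have k12 : u 1 = u 2 → -(η ![X (u 0), u 1, u 2] + η ![u 0, X (u 1), u 2] +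
        η ![u 0, u 1, X (u 2)]) = 0 := fun h => by
      rw [h, h12, threeForm_swap_one_two η (u 0) (u 2) (X (u 2))]; ring
    fin_cases i <;> fin_cases j
    · exact absurd rfl hij
    · exact k01 h
    · exact k02 h
    · exact k01 h.symm
    · exact absurd rfl hij
    · exact k12 h
    · exact k02 h.symm
    · exact k12 h.symm
    · exact absurd rfl hij

/-- The symplectic form `Ω(α, β) = α ∧ β` on three-forms; its values are in the line `Λ⁶(C*)`,
which is identified with `ℂ` by evaluating on a basis `e` of `C`. -/
def wedgePairing (e : Module.Basis (Fin 3 ⊕ Fin 3) ℂ C) (α β : ThreeForm C) : ℂ :=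
  LinearMap.mul' ℂ ℂ (α.domCoprod β e)

theorem wedgePairing_add_left (e : Module.Basis (Fin 3 ⊕ Fin 3) ℂ C) (α α' β : ThreeForm C) :
    wedgePairing e (α + α') β = wedgePairing e α β + wedgePairing e α' β := by
  simp only [wedgePairing, ← AlternatingMap.domCoprod'_apply, TensorProduct.add_tmul, map_add,
    AlternatingMap.add_apply]

theorem wedgePairing_smul_left (e : Module.Basis (Fin 3 ⊕ Fin 3) ℂ C) (c : ℂ) (α β : ThreeForm C) :
    wedgePairing e (c • α) β = c * wedgePairing e α β := by
  simp only [wedgePairing, ← AlternatingMap.domCoprod'_apply, ← TensorProduct.smul_tmul', map_smul,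
    AlternatingMap.smul_apply, smul_eq_mul]

/-- The moment map of the `Sp(C)`-action on the symplectic space of three-forms: it sends `η` to
the functional `X ↦ Ω(X · η, η) / 2` on `sp(C)`. -/
def momentMap (ω : SymplecticForm C) (e : Module.Basis (Fin 3 ⊕ Fin 3) ℂ C) (η : ThreeForm C) :
    Module.Dual ℂ (sp ω) where
  toFun X := wedgePairing e (lieAct (X : Module.End ℂ C) η) η / 2
  map_add' := by
    intro X Y
    have h : lieAct ((X + Y : sp ω) : Module.End ℂ C) η
        = lieAct (X : Module.End ℂ C) η + lieAct (Y : Module.End ℂ C) η := by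
      ext u
      simp [lieAct, threeForm_add_zero, threeForm_add_one, threeForm_add_two]
      ring
    rw [h, wedgePairing_add_left]
    ring
  map_smul' := by
    intro c X
    have h : lieAct ((c • X : sp ω) : Module.End ℂ C) η = c • lieAct (X : Module.End ℂ C) η := by
      ext u
      simp [lieAct, threeForm_smul_zero, threeForm_smul_one, threeForm_smul_two]
      ring
    rw [h, wedgePairing_smul_left]
    simp
    ring

/-- The isomorphism `S²(C) = sp(C)`, as a symmetric bilinear map: it sends `a²` to the
endomorphism `X = ω(a, ·) a`, for which `Q_X = ω(X ·, ·)` is the square of `ω(a, ·)`. -/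
def sqToSp (ω : SymplecticForm C) : C →ₗ[ℂ] C →ₗ[ℂ] sp ω :=
  LinearMap.mk₂ ℂ
    (fun a b => ⟨(2⁻¹ : ℂ) • ((ω.form a).smulRight b + (ω.form b).smulRight a), by
      intro u v
      simp only [LinearMap.smul_apply, LinearMap.add_apply, LinearMap.smulRight_apply, map_smul,
        map_add, smul_eq_mul]
      ring⟩)
    (fun a a' b => by
      ext u
      simp [add_smul]
      module)
    (fun c a b => by
      ext u
      simp [mul_smul]
      module)
    (fun a b b' => by
      ext u
      simp [add_smul]
      module)
    (fun c a b => by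
      ext u
      simp [mul_smul]
      module)

/-- A representative of `ϖ([η])`: the moment map, with values in `sp(C)*`, which is identified with
`S²(C*)` by means of the isomorphism dual to `S²(C) = sp(C)`. Thus `ϖ(η)` is the quadratic form on
`C` whose value at `a` is the value of the functional `momentMap ω e η` at `ω(a, ·) a`. -/
def momentForm (ω : SymplecticForm C) (e : Module.Basis (Fin 3 ⊕ Fin 3) ℂ C) (η : ThreeForm C) :
    QuadraticForm ℂ C :=
  LinearMap.BilinMap.toQuadraticMap ((sqToSp ω).compr₂ (momentMap ω e η))

end MongeAmpere

end

/-! In a symplectic frame l, m a three-form has components (a, A, B, d): two scalars and two 3 × 3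
matrices, and it is effective exactly when A and B are symmetric. The span L of l lies in E_η iff a
= 0; A is then the matrix of the symbol, and the hyperplane is tangent at L iff also A = 0.
Everything rests on the expression of the moment form in these components
(`IsFrame.framePairing_lieAct`, `IsFrame.momentForm_eq`): up to a nonzero constant, its block on L
is cof A - aB. Hence on a plane of the equation it is the cofactor form, and every σ_L^∨ is the
trace of the quadric on ℙ(L).

For the equality of σ^∨ with the quadric, call v exceptional if η(v, ·, ·) vanishes on the
orthogonal of v. A non-exceptional v lies on a smooth point of E_η. If an exceptional v ≠ 0 exists,
then η is tangent, and the radical of the moment form contains a non-exceptional w. The line v + tw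
stays in the quadric and has finitely many exceptional points, since being exceptional is governed
by the vanishing of ω(v, ·) ∧ η(v, ·, ·), which is quadratic in v. So the Zariski closure contains
[v] (`cocharacteristic_eq`).

Rank: a degenerate moment form forces tangency (`exists_isTangentHyperplane_of_polar_eq_zero`),
which gives (O). At a point of tangency a = 0 and A = 0, and the moment form reduces to cof B in the
coordinates along m. The rank of B yields three normal forms (`IsTangentHyperplane.cases`): rank 3,
rank 2 (Goursat) and rank at most 1 (the cone over X*), with moment forms of rank 3, 1 and 0.

These normal forms match the strata of X^∨. Through a Goursat form there are lines inside the cone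
over X^∨ whose directions span all effective forms, so it is singular; a form in the cone over X* is
a limit of Goursat forms. If det B ≠ 0, a quartic that vanishes on X^∨ has a nonzero derivative
there (`IsFrame.notMem_singularLocus`). Finally, the exceptional vectors of a Goursat form lie in
the union of two mutually orthogonal 3-planes, which determines every D with E_D = E_η up to these
two choices. -/

noncomputable section

namespace MongeAmpere

/-! ### The wedge product of two three-forms as a sum over shuffles -/

section Shuffles

/-- Representatives of the `(3, 3)`-shuffles modulo permutations inside the two blocks. -/
def shuffle : Bool × Option (Fin 3 × Fin 3) → Equiv.Perm (Fin 3 ⊕ Fin 3)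
  | (false, none) => 1
  | (false, some p) => Equiv.swap (Sum.inl p.1) (Sum.inr p.2)
  | (true, none) => Equiv.sumComm (Fin 3) (Fin 3)
  | (true, some p) => Equiv.sumComm (Fin 3) (Fin 3) * Equiv.swap (Sum.inl p.1) (Sum.inr p.2)

/-- A coset modulo block permutations is determined by the image of the left block; this finite
check says that the images are pairwise distinct. -/
theorem shuffle_separated : ∀ s t : Bool × Option (Fin 3 × Fin 3), s ≠ t →
    ∃ i : Fin 3, ∀ j : Fin 3, shuffle s (Sum.inl i) ≠ shuffle t (Sum.inl j) := by
  decide +kernel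

theorem shuffle_injective : Function.Injective fun s =>
    (Quotient.mk'' (shuffle s) : Equiv.Perm.ModSumCongr (Fin 3) (Fin 3)) := by
  intro s t h
  by_contra hst
  obtain ⟨i, hi⟩ := shuffle_separated s t hst
  obtain ⟨⟨sl, sr⟩, h'⟩ := QuotientGroup.leftRel_apply.mp (Quotient.exact' h)
  have h2 : shuffle t = shuffle s * Equiv.Perm.sumCongrHom _ _ (sl, sr) :=
    inv_mul_eq_iff_eq_mul.mp h'.symm
  apply hi (sl⁻¹ i)
  rw [h2]
  simp

/-- Injectivity suffices by counting: 6! / (3! · 3!) = 720 / 36 = 20 = 2 · (1 + 9). -/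
theorem shuffle_bijective : Function.Bijective fun s =>
    (Quotient.mk'' (shuffle s) : Equiv.Perm.ModSumCongr (Fin 3) (Fin 3)) := by
  refine (Fintype.bijective_iff_injective_and_card _).2 ⟨shuffle_injective, ?_⟩
  have h := Subgroup.card_eq_card_quotient_mul_card_subgroup
    (Equiv.Perm.sumCongrHom (Fin 3) (Fin 3)).range
  have h1 : Nat.card (Equiv.Perm.sumCongrHom (Fin 3) (Fin 3)).range = 36 := by
    rw [Nat.card_congr (MonoidHom.ofInjective Equiv.Perm.sumCongrHom_injective).toEquiv.symm]
    simp [Nat.card_eq_fintype_card, Fintype.card_perm, Nat.factorial]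
  have h2 : Nat.card (Equiv.Perm (Fin 3 ⊕ Fin 3)) = 720 := by
    simp [Nat.card_eq_fintype_card, Fintype.card_perm, Nat.factorial]
  rw [h1, h2] at h
  rw [← Nat.card_eq_fintype_card, ← Nat.card_eq_fintype_card]
  have h3 : Nat.card (Bool × Option (Fin 3 × Fin 3)) = 20 := by
    simp [Nat.card_eq_fintype_card]
  rw [h3]
  refine Nat.eq_of_mul_eq_mul_right (show 0 < 36 by norm_num) ?_
  exact h

theorem comp_swap_inl {C : Type*} (l m : Fin 3 → C) (i j : Fin 3) :
    (fun k => Sum.elim l m (Equiv.swap (Sum.inl i) (Sum.inr j) (Sum.inl k)))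
      = Function.update l i (m j) := by
  ext k
  by_cases h : k = i
  · subst h; simp
  · rw [Equiv.swap_apply_of_ne_of_ne (by simpa using h) (by simp), Function.update_of_ne h]
    rfl

theorem comp_swap_inr {C : Type*} (l m : Fin 3 → C) (i j : Fin 3) :
    (fun k => Sum.elim l m (Equiv.swap (Sum.inl i) (Sum.inr j) (Sum.inr k)))
      = Function.update m j (l i) := by
  ext k
  by_cases h : k = j
  · subst h; simp
  · rw [Equiv.swap_apply_of_ne_of_ne (by simp) (by simpa using h), Function.update_of_ne h]
    rfl

variable {C : Type*} [AddCommGroup C] [Module ℂ C]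

/-- The pairing of two three-forms in a pair of triples of vectors. -/
def framePairing (l m : Fin 3 → C) (α β : ThreeForm C) : ℂ :=
  α l * β m - α m * β l
    - ∑ i, ∑ j, α (Function.update l i (m j)) * β (Function.update m j (l i))
    + ∑ i, ∑ j, α (Function.update m j (l i)) * β (Function.update l i (m j))

theorem sign_sumComm : Equiv.Perm.sign (Equiv.sumComm (Fin 3) (Fin 3)) = -1 := by
  decide +kernel

theorem mul_domCoprod (α β : ThreeForm C) (l m : Fin 3 → C) :
    LinearMap.mul' ℂ ℂ (α.domCoprod β (Sum.elim l m)) = framePairing l m α β := by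
  have h0 : α.domCoprod β (Sum.elim l m) = ∑ s, AlternatingMap.domCoprod.summand α β
      (Quotient.mk'' (shuffle s)) (Sum.elim l m) := by
    rw [AlternatingMap.domCoprod_apply, sum_apply]
    exact (Function.Bijective.sum_comp shuffle_bijective (fun σ =>
      AlternatingMap.domCoprod.summand α β σ (Sum.elim l m))).symm
  have hs : ∀ σ : Equiv.Perm (Fin 3 ⊕ Fin 3),
      LinearMap.mul' ℂ ℂ (AlternatingMap.domCoprod.summand α β (Quotient.mk'' σ) (Sum.elim l m))
      = ((Equiv.Perm.sign σ : ℤ) : ℂ) * (α (fun k => Sum.elim l m (σ (Sum.inl k))) *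
        β (fun k => Sum.elim l m (σ (Sum.inr k)))) := by
    intro σ
    rw [AlternatingMap.domCoprod.summand_mk'', _root_.smul_apply,
      MultilinearMap.domDomCongr_apply, MultilinearMap.domCoprod_apply, Units.smul_def,
      map_zsmul, LinearMap.mul'_apply, zsmul_eq_mul]
    rfl
  rw [h0, map_sum]
  simp_rw [hs]
  have hsw : ∀ i j : Fin 3, ∀ k, (shuffle (true, some (i, j))) k
      = Equiv.sumComm (Fin 3) (Fin 3) (Equiv.swap (Sum.inl i) (Sum.inr j) k) := fun _ _ _ => rfl
  have hel : ∀ k, Sum.elim l m (Equiv.sumComm (Fin 3) (Fin 3) k) = Sum.elim m l k := by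
    rintro (k | k) <;> rfl
  have e1 : ∀ i j : Fin 3, (fun k => Sum.elim l m (shuffle (false, some (i, j)) (Sum.inl k)))
      = Function.update l i (m j) := comp_swap_inl l m
  have e2 : ∀ i j : Fin 3, (fun k => Sum.elim l m (shuffle (false, some (i, j)) (Sum.inr k)))
      = Function.update m j (l i) := comp_swap_inr l m
  have e3 : ∀ i j : Fin 3, (fun k => Sum.elim l m (shuffle (true, some (i, j)) (Sum.inl k)))
      = Function.update m i (l j) := by
    intro i j
    simp_rw [hsw, hel]
    exact comp_swap_inl m l i j
  have e4 : ∀ i j : Fin 3, (fun k => Sum.elim l m (shuffle (true, some (i, j)) (Sum.inr k)))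
      = Function.update l j (m i) := by
    intro i j
    simp_rw [hsw, hel]
    exact comp_swap_inr m l i j
  have s1 : ∀ i j : Fin 3, Equiv.Perm.sign (shuffle (false, some (i, j))) = -1 := fun i j =>
    Equiv.Perm.sign_swap (by simp)
  have s2 : ∀ i j : Fin 3, Equiv.Perm.sign (shuffle (true, some (i, j))) = 1 := fun i j => by
    have : shuffle (true, some (i, j)) = Equiv.sumComm (Fin 3) (Fin 3) *
      Equiv.swap (Sum.inl i) (Sum.inr j) := rfl
    rw [this, Equiv.Perm.sign_mul, Equiv.Perm.sign_swap (by simp), sign_sumComm]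
    rfl
  have s3 : Equiv.Perm.sign (shuffle (true, none)) = -1 := sign_sumComm
  have s4 : Equiv.Perm.sign (shuffle (false, none)) = 1 := Equiv.Perm.sign_one
  rw [Fintype.sum_prod_type]
  simp only [Fintype.sum_bool, Fintype.sum_option, Fintype.sum_prod_type, e1, e2, e3, e4, s1, s2,
    s3, s4]
  have t1 : (fun k => Sum.elim l m (shuffle (true, none) (Sum.inl k))) = m := rfl
  have t2 : (fun k => Sum.elim l m (shuffle (true, none) (Sum.inr k))) = l := rfl
  have t3 : (fun k => Sum.elim l m (shuffle (false, none) (Sum.inl k))) = l := rfl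
  have t4 : (fun k => Sum.elim l m (shuffle (false, none) (Sum.inr k))) = m := rfl
  rw [t1, t2, t3, t4, framePairing]
  rw [Finset.sum_comm (f := fun i j => α (Function.update m j (l i)) *
    β (Function.update l i (m j)))]
  simp only [Units.val_neg, Units.val_one, Int.cast_neg, Int.cast_one, one_mul, neg_mul,
    Finset.sum_neg_distrib]
  ring

/-- Up to a non-zero factor, the wedge pairing can be computed in any basis. -/
theorem wedgePairing_eq (e b : Module.Basis (Fin 3 ⊕ Fin 3) ℂ C) :
    ∃ κ : ℂ, κ ≠ 0 ∧ ∀ α β : ThreeForm C, wedgePairing e α β = κ *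
      framePairing (fun i => b (Sum.inl i)) (fun i => b (Sum.inr i)) α β := by
  -- A form of top degree is a multiple of the determinant, so the constant is the determinant of
  -- `e` in the basis `b`.
  refine ⟨b.det e, ?_, fun α β => ?_⟩
  · exact (b.isUnit_det e).ne_zero
  · have h := congrArg (fun f => f e)
      (((LinearMap.mul' ℂ ℂ).compAlternatingMap (α.domCoprod β)).eq_smul_basis_det b)
    simp only [LinearMap.compAlternatingMap_apply, AlternatingMap.smul_apply, smul_eq_mul] at h
    have hb : Sum.elim (fun i => b (Sum.inl i)) (fun i => b (Sum.inr i)) = ⇑b := by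
      ext (i | i) <;> rfl
    rw [wedgePairing, h, ← mul_domCoprod, hb, mul_comm]

end Shuffles

/-! ### Symplectic frames -/

section Frames

variable {C : Type*} [AddCommGroup C] [Module ℂ C]

theorem threeForm_eq_zero_zero_one (η : ThreeForm C) (u v : C) : η ![u, u, v] = 0 :=
  η.map_eq_zero_of_eq ![u, u, v] (i := 0) (j := 1) rfl (by decide)

theorem threeForm_eq_zero_one_two (η : ThreeForm C) (u v : C) : η ![v, u, u] = 0 :=
  η.map_eq_zero_of_eq ![v, u, u] (i := 1) (j := 2) rfl (by decide)

theorem threeForm_eq_zero_zero_two (η : ThreeForm C) (u v : C) : η ![u, v, u] = 0 :=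
  η.map_eq_zero_of_eq ![u, v, u] (i := 0) (j := 2) rfl (by decide)

theorem threeForm_rotate (η : ThreeForm C) (u v w : C) : η ![v, w, u] = η ![u, v, w] := by
  rw [threeForm_swap_one_two, threeForm_swap_zero_one, neg_neg]

/-- The insertion of two vectors in a three-form. -/
def insertTwo (η : ThreeForm C) (u v : C) : C →ₗ[ℂ] ℂ where
  toFun w := η ![u, v, w]
  map_add' := threeForm_add_two η u v
  map_smul' c w := threeForm_smul_two η c u v w

theorem insertTwo_apply (η : ThreeForm C) (u v w : C) : insertTwo η u v w = η ![u, v, w] := rfl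

theorem SymplecticForm.neg_swap (ω : SymplecticForm C) (u v : C) :
    ω.form u v = -ω.form v u := (ω.alt.neg_eq v u).symm

theorem SymplecticForm.self (ω : SymplecticForm C) (u : C) : ω.form u u = 0 := ω.alt.self_eq_zero u

/-- A symplectic frame: `l` and `m` are bases of complementary Lagrangian subspaces and they are
dual to each other. -/
structure IsFrame (ω : SymplecticForm C) (l m : Fin 3 → C) : Prop where
  ll : ∀ i j, ω.form (l i) (l j) = 0
  mm : ∀ i j, ω.form (m i) (m j) = 0
  ml : ∀ i j, ω.form (m i) (l j) = if i = j then 1 else 0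

namespace IsFrame

variable {ω : SymplecticForm C} {l m : Fin 3 → C}

theorem lm (F : IsFrame ω l m) (i j : Fin 3) :
    ω.form (l i) (m j) = if i = j then -1 else 0 := by
  rw [ω.neg_swap, F.ml]
  by_cases h : i = j
  · simp [h]
  · simp [h, Ne.symm h]

/-- The sign restores the normalization, since ω(l i, m i) = -1. This transfers results on `l` and
the matrix A to `m` and the matrix B. -/
theorem symm (F : IsFrame ω l m) : IsFrame ω m (-l) where
  ll := F.mm
  mm i j := by simp [F.ll]
  ml i j := by simp [F.lm, apply_ite]

theorem linearIndependent (F : IsFrame ω l m) : LinearIndependent ℂ (Sum.elim l m) := by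
  rw [Fintype.linearIndependent_iff]
  intro g hg
  rw [Fintype.sum_sum_type] at hg
  simp only [Sum.elim_inl, Sum.elim_inr] at hg
  rintro (i | i)
  · have h := congrArg (ω.form (m i)) hg
    simpa [F.ml, F.mm] using h
  · have h := congrArg (ω.form (l i)) hg
    simpa [F.ll, F.lm] using h

theorem linearIndependent_left (F : IsFrame ω l m) : LinearIndependent ℂ l :=
  F.linearIndependent.comp Sum.inl Sum.inl_injective

/-- The basis given by a symplectic frame. -/
def basis (F : IsFrame ω l m) (h6 : Module.finrank ℂ C = 6) :
    Module.Basis (Fin 3 ⊕ Fin 3) ℂ C :=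
  basisOfLinearIndependentOfCardEqFinrank F.linearIndependent (by simp [h6])

theorem coe_basis (F : IsFrame ω l m) (h6 : Module.finrank ℂ C = 6) :
    ⇑(F.basis h6) = Sum.elim l m :=
  coe_basisOfLinearIndependentOfCardEqFinrank _ _

theorem expand (F : IsFrame ω l m) (h6 : Module.finrank ℂ C = 6) (v : C) :
    v = ∑ i, ω.form (m i) v • l i + ∑ i, ω.form v (l i) • m i := by
  have h := (F.basis h6).sum_repr v
  rw [Fintype.sum_sum_type] at h
  simp only [F.coe_basis, Sum.elim_inl, Sum.elim_inr] at h
  generalize (F.basis h6).repr v = r at h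
  subst h
  simp [F.ml, F.mm, F.ll]

theorem expand' (F : IsFrame ω l m) (h6 : Module.finrank ℂ C = 6) (v : C) :
    v = ω.form (m 0) v • l 0 + ω.form (m 1) v • l 1 + ω.form (m 2) v • l 2
      + (ω.form v (l 0) • m 0 + ω.form v (l 1) • m 1 + ω.form v (l 2) • m 2) := by
  have h := F.expand h6 v
  rwa [Fin.sum_univ_three, Fin.sum_univ_three] at h

theorem linearMap_eq_zero (F : IsFrame ω l m) (h6 : Module.finrank ℂ C = 6) {f : C →ₗ[ℂ] ℂ}
    (hl : ∀ i, f (l i) = 0) (hm : ∀ i, f (m i) = 0) (v : C) : f v = 0 := by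
  rw [F.expand' h6 v]
  simp [hl, hm]

/-- The 20 components of a three-form in dimension six are listed by type as 1 + 9 + 9 + 1;
skew-symmetry recovers all values on basis vectors. -/
theorem threeForm_eq_zero (F : IsFrame ω l m) (h6 : Module.finrank ℂ C = 6) (η : ThreeForm C)
    (h0 : η ![l 0, l 1, l 2] = 0)
    (hA : ∀ j, η ![m j, l 1, l 2] = 0 ∧ η ![l 0, m j, l 2] = 0 ∧ η ![l 0, l 1, m j] = 0)
    (hB : ∀ j, η ![l j, m 1, m 2] = 0 ∧ η ![m 0, l j, m 2] = 0 ∧ η ![m 0, m 1, l j] = 0)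
    (hd : η ![m 0, m 1, m 2] = 0) : η = 0 := by
  have rot : ∀ u v w : C, η ![u, v, w] = 0 → η ![v, w, u] = 0 := fun u v w h => by
    rw [threeForm_rotate, h]
  have sw : ∀ u v w : C, η ![u, v, w] = 0 → η ![v, u, w] = 0 := fun u v w h => by
    rw [threeForm_swap_zero_one, h, neg_zero]
  have pair : ∀ (n : Fin 3 → C) (w : C), η ![n 0, n 1, w] = 0 → η ![n 1, n 2, w] = 0 →
      η ![n 0, n 2, w] = 0 → ∀ i j, η ![n i, n j, w] = 0 := by
    intro n w h1 h2 h3 i j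
    have hi : i = 0 ∨ i = 1 ∨ i = 2 := by omega
    have hj : j = 0 ∨ j = 1 ∨ j = 2 := by omega
    rcases hi with rfl | rfl | rfl <;> rcases hj with rfl | rfl | rfl <;>
      first
        | exact threeForm_eq_zero_zero_one η _ _
        | assumption
        | exact sw _ _ _ (by assumption)
  have lll : ∀ i j k, η ![l i, l j, l k] = 0 := by
    intro i j k
    refine pair l (l k) ?_ ?_ ?_ i j <;>
    · have hk : k = 0 ∨ k = 1 ∨ k = 2 := by omega
      rcases hk with rfl | rfl | rfl <;>
        simp [threeForm_eq_zero_one_two, threeForm_eq_zero_zero_two, h0,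
          rot _ _ _ h0, sw _ _ _ (rot _ _ _ (rot _ _ _ h0))]
  have mmm : ∀ i j k, η ![m i, m j, m k] = 0 := by
    intro i j k
    refine pair m (m k) ?_ ?_ ?_ i j <;>
    · have hk : k = 0 ∨ k = 1 ∨ k = 2 := by omega
      rcases hk with rfl | rfl | rfl <;>
        simp [threeForm_eq_zero_one_two, threeForm_eq_zero_zero_two, hd,
          rot _ _ _ hd, sw _ _ _ (rot _ _ _ (rot _ _ _ hd))]
  have llm : ∀ i j k, η ![l i, l j, m k] = 0 := fun i j k =>
    pair l (m k) (hA k).2.2 (rot _ _ _ (hA k).1)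
      (sw _ _ _ (rot _ _ _ (rot _ _ _ (hA k).2.1))) i j
  have mml : ∀ i j k, η ![m i, m j, l k] = 0 := fun i j k =>
    pair m (l k) (hB k).2.2 (rot _ _ _ (hB k).1)
      (sw _ _ _ (rot _ _ _ (rot _ _ _ (hB k).2.1))) i j
  refine (F.basis h6).ext_alternating fun v _ => ?_
  have hv : (fun i => F.basis h6 (v i)) = ![F.basis h6 (v 0), F.basis h6 (v 1),
      F.basis h6 (v 2)] := by
    ext i; fin_cases i <;> rfl
  rw [hv, F.coe_basis, AlternatingMap.zero_apply]
  rcases v 0 with i | i <;> rcases v 1 with j | j <;> rcases v 2 with k | k <;>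
    simp only [Sum.elim_inl, Sum.elim_inr]
  · exact lll _ _ _
  · exact llm _ _ _
  · exact rot _ _ _ (llm _ _ _)
  · exact rot _ _ _ (rot _ _ _ (mml _ _ _))
  · exact rot _ _ _ (rot _ _ _ (llm _ _ _))
  · exact rot _ _ _ (mml _ _ _)
  · exact mml _ _ _
  · exact mmm _ _ _

end IsFrame

/-- The three-form `f ∧ g ∧ h`. -/
def tri (f g h : C →ₗ[ℂ] ℂ) : ThreeForm C :=
  Matrix.detRowAlternating.compLinearMap (LinearMap.pi ![f, g, h])

theorem tri_apply (f g h : C →ₗ[ℂ] ℂ) (u : Fin 3 → C) :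
    tri f g h u = f (u 0) * g (u 1) * h (u 2) - f (u 0) * h (u 1) * g (u 2)
      - g (u 0) * f (u 1) * h (u 2) + g (u 0) * h (u 1) * f (u 2)
      + h (u 0) * f (u 1) * g (u 2) - h (u 0) * g (u 1) * f (u 2) := by
  change Matrix.det (Matrix.of fun i => LinearMap.pi ![f, g, h] (u i)) = _
  rw [Matrix.det_fin_three]
  simp

/-- The three-form with given components in a frame. -/
def ofCoords (ω : SymplecticForm C) (l m : Fin 3 → C) (a : ℂ) (A B : Fin 3 → Fin 3 → ℂ) (d : ℂ) :
    ThreeForm C :=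
  a • tri (ω.form (m 0)) (ω.form (m 1)) (ω.form (m 2))
  + ∑ j, (A 0 j • tri (ω.form.flip (l j)) (ω.form (m 1)) (ω.form (m 2))
    + A 1 j • tri (ω.form (m 0)) (ω.form.flip (l j)) (ω.form (m 2))
    + A 2 j • tri (ω.form (m 0)) (ω.form (m 1)) (ω.form.flip (l j)))
  + ∑ j, (B 0 j • tri (ω.form (m j)) (ω.form.flip (l 1)) (ω.form.flip (l 2))
    + B 1 j • tri (ω.form.flip (l 0)) (ω.form (m j)) (ω.form.flip (l 2))
    + B 2 j • tri (ω.form.flip (l 0)) (ω.form.flip (l 1)) (ω.form (m j)))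
  + d • tri (ω.form.flip (l 0)) (ω.form.flip (l 1)) (ω.form.flip (l 2))

theorem IsFrame.eq_ofCoords {ω : SymplecticForm C} {l m : Fin 3 → C} (F : IsFrame ω l m)
    (h6 : Module.finrank ℂ C = 6) (η : ThreeForm C) :
    η = ofCoords ω l m (η l) (fun i j => η (Function.update l i (m j)))
      (fun i j => η (Function.update m i (l j))) (η m) := by
  have e : ∀ n : Fin 3 → C, n = ![n 0, n 1, n 2] := fun n => by ext i; fin_cases i <;> rfl
  rw [← sub_eq_zero]
  have hl : η l = η ![l 0, l 1, l 2] := congrArg η (e l)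
  have hm : η m = η ![m 0, m 1, m 2] := congrArg η (e m)
  apply F.threeForm_eq_zero h6
  · simp [ofCoords, tri_apply, Fin.sum_univ_three, F.ll, F.ml, hl]
  · intro j
    have hj : j = 0 ∨ j = 1 ∨ j = 2 := by omega
    rcases hj with rfl | rfl | rfl <;>
    simp [ofCoords, tri_apply, Fin.sum_univ_three, F.ll, F.mm, F.ml, update_zero,
      update_one, update_two]
  · intro j
    have hj : j = 0 ∨ j = 1 ∨ j = 2 := by omega
    rcases hj with rfl | rfl | rfl <;>
    simp [ofCoords, tri_apply, Fin.sum_univ_three, F.ll, F.mm, F.ml, update_zero,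
      update_one, update_two]
  · simp [ofCoords, tri_apply, Fin.sum_univ_three, F.mm, F.ml, hm]

end Frames

/-! ### Existence of symplectic frames -/

section FrameExistence

variable {C : Type*} [AddCommGroup C] [Module ℂ C]

theorem vec_three_eta {α : Type*} (u : Fin 3 → α) : u = ![u 0, u 1, u 2] := by
  ext i; fin_cases i <;> rfl

theorem exists_mem_notMem_span [FiniteDimensional ℂ C] (S : Submodule ℂ C) {k : ℕ} (v : Fin k → C)
    (hk : k < Module.finrank ℂ S) : ∃ x ∈ S, x ∉ Submodule.span ℂ (Set.range v) := by
  by_contra! h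
  have h1 : Module.finrank ℂ S ≤ Module.finrank ℂ (Submodule.span ℂ (Set.range v)) :=
    Submodule.finrank_mono h
  have h2 := finrank_range_le_card (R := ℂ) v
  rw [Set.finrank, Fintype.card_fin] at h2
  omega

/-- The common kernel of r functionals has codimension at most r, so it is too large for a span of k
vectors. This supplies every general choice of a vector below. -/
theorem exists_forall_eq_zero_notMem_span [FiniteDimensional ℂ C] {k r : ℕ} (f : Fin r → C →ₗ[ℂ] ℂ)
    (v : Fin k → C) (hk : k + r < Module.finrank ℂ C) :
    ∃ x, (∀ i, f i x = 0) ∧ x ∉ Submodule.span ℂ (Set.range v) := by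
  obtain ⟨x, hx, hxv⟩ := exists_mem_notMem_span (LinearMap.ker (LinearMap.pi f)) v (by
    have h1 := (LinearMap.pi f).finrank_range_add_finrank_ker
    have h2 := (LinearMap.range (LinearMap.pi f)).finrank_le
    rw [Module.finrank_fin_fun] at h2
    omega)
  refine ⟨x, fun i => ?_, hxv⟩
  exact congrFun (LinearMap.mem_ker.1 hx) i

theorem linearIndependent_three {v x y : C} (hv : v ≠ 0)
    (hx : x ∉ Submodule.span ℂ (Set.range ![v]))
    (hy : y ∉ Submodule.span ℂ (Set.range ![v, x])) : LinearIndependent ℂ ![v, x, y] := by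
  have h1 : LinearIndependent ℂ ![v] := LinearIndependent.of_subsingleton (ι := Fin 1) 0 hv
  have h2 : LinearIndependent ℂ ![x, v] := linearIndependent_finCons.2 ⟨h1, hx⟩
  have h3 : LinearIndependent ℂ ![v, x] := by
    convert h2.comp ![1, 0] (by decide) using 1
    ext i; fin_cases i <;> rfl
  have h4 : LinearIndependent ℂ ![y, v, x] := linearIndependent_finCons.2 ⟨h3, hy⟩
  convert h4.comp ![1, 2, 0] (by decide) using 1
  ext i; fin_cases i <;> rfl

/-- Adding vectors of the Lagrangian plane does not affect the duality with `l`. Each of the two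
cross terms of ω on the corrected vectors contributes -ω(n i, n j) / 2, which makes the second half
isotropic. -/
theorem isFrame_of_dual (ω : SymplecticForm C) {l n : Fin 3 → C}
    (hll : ∀ i j, ω.form (l i) (l j) = 0)
    (hn : ∀ i j, ω.form (n i) (l j) = if i = j then 1 else 0) :
    IsFrame ω l (fun i => n i + (2⁻¹ : ℂ) • ∑ k, ω.form (n i) (n k) • l k) := by
  have hn' : ∀ i j, ω.form (l i) (n j) = if j = i then -1 else 0 := fun i j => by
    rw [ω.neg_swap, hn]
    by_cases h : j = i <;> simp [h]
  refine ⟨hll, fun i j => ?_, fun i j => ?_⟩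
  · simp only [map_add, LinearMap.add_apply, map_smul, LinearMap.smul_apply, map_sum,
      LinearMap.sum_apply, hn, hn', hll, smul_eq_mul]
    simp [ω.neg_swap (n j) (n i)]
    ring
  · simp [hn, hll]

theorem exists_isFrame [FiniteDimensional ℂ C] (ω : SymplecticForm C) {l : Fin 3 → C}
    (hl : LinearIndependent ℂ l) (hll : ∀ i j, ω.form (l i) (l j) = 0) :
    ∃ m, IsFrame ω l m := by
  have h1 : ∀ i, ∃ n : C, ∀ j, ω.form n (l j) = if i = j then 1 else 0 := by
    intro i
    -- The dual basis functional is extended from the span of `l` to the whole space and then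
    -- represented by a vector through ω.
    obtain ⟨g, hg⟩ := LinearMap.exists_extend ((Finsupp.lapply i : (Fin 3 →₀ ℂ) →ₗ[ℂ] ℂ) ∘ₗ
      (hl.repr : Submodule.span ℂ (Set.range l) →ₗ[ℂ] (Fin 3 →₀ ℂ)))
    refine ⟨(ω.form.toDual ω.nondeg).symm g, fun j => ?_⟩
    rw [LinearMap.BilinForm.apply_toDual_symm_apply]
    have hj := congrArg (fun f => f ⟨l j, Submodule.subset_span ⟨j, rfl⟩⟩) hg
    simp only [LinearMap.comp_apply, Submodule.subtype_apply,
      Finsupp.lapply_apply] at hj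
    rw [hj, hl.repr_eq_single j _ rfl, Finsupp.single_apply]
    by_cases h : i = j
    · simp [h]
    · simp [h, Ne.symm h]
  choose n hn using h1
  exact ⟨_, isFrame_of_dual ω hll hn⟩

theorem exists_isFrame_triple [FiniteDimensional ℂ C] (ω : SymplecticForm C) {v x y : C}
    (hv : v ≠ 0) (hx : x ∉ Submodule.span ℂ (Set.range ![v]))
    (hy : y ∉ Submodule.span ℂ (Set.range ![v, x]))
    (hvx : ω.form v x = 0) (hvy : ω.form v y = 0) (hxy : ω.form x y = 0) :
    ∃ m, IsFrame ω ![v, x, y] m := by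
  refine exists_isFrame ω (linearIndependent_three hv hx hy) fun i j => ?_
  have hvx' := ω.neg_swap x v
  have hvy' := ω.neg_swap y v
  have hxy' := ω.neg_swap y x
  rw [hvx, neg_zero] at hvx'
  rw [hvy, neg_zero] at hvy'
  rw [hxy, neg_zero] at hxy'
  fin_cases i <;> fin_cases j <;> simp [ω.self, *]

theorem exists_isFrame_of_ne_zero [FiniteDimensional ℂ C] (ω : SymplecticForm C)
    (h6 : Module.finrank ℂ C = 6) {v : C} (hv : v ≠ 0) :
    ∃ l m, IsFrame ω l m ∧ l 0 = v := by
  obtain ⟨x, hx, hx'⟩ := exists_forall_eq_zero_notMem_span ![ω.form v] ![v] (by omega)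
  obtain ⟨y, hy, hy'⟩ := exists_forall_eq_zero_notMem_span ![ω.form v, ω.form x] ![v, x] (by omega)
  obtain ⟨m, F⟩ := exists_isFrame_triple ω hv hx' hy' (hx 0) (hy 0) (hy 1)
  exact ⟨_, m, F, rfl⟩

theorem exists_isFrame_of_isLagrangian [FiniteDimensional ℂ C] {ω : SymplecticForm C}
    {L : Submodule ℂ C} (hL : IsLagrangian ω L) {v : C} (hv : v ≠ 0) (hvL : v ∈ L) :
    ∃ l m, IsFrame ω l m ∧ l 0 = v ∧ Submodule.span ℂ (Set.range l) = L := by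
  obtain ⟨x, hx, hx'⟩ := exists_mem_notMem_span L ![v] (by rw [hL.1]; norm_num)
  obtain ⟨y, hy, hy'⟩ := exists_mem_notMem_span L ![v, x] (by rw [hL.1]; norm_num)
  obtain ⟨m, F⟩ := exists_isFrame_triple ω hv hx' hy' (hL.2 _ hvL _ hx) (hL.2 _ hvL _ hy)
    (hL.2 _ hx _ hy)
  refine ⟨_, m, F, rfl, ?_⟩
  apply Submodule.eq_of_le_of_finrank_eq
  · rw [Submodule.span_le]
    rintro _ ⟨i, rfl⟩
    fin_cases i <;> assumption
  · rw [hL.1, finrank_span_eq_card F.linearIndependent_left, Fintype.card_fin]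

theorem IsLagrangian.exists_mem_ne_zero {ω : SymplecticForm C} {L : Submodule ℂ C}
    (hL : IsLagrangian ω L) : ∃ v ∈ L, v ≠ 0 := by
  apply Submodule.exists_mem_ne_zero_of_ne_bot
  rintro rfl
  simpa using hL.1

theorem isLagrangian_span {ω : SymplecticForm C} {l : Fin 3 → C} (hl : LinearIndependent ℂ l)
    (hll : ∀ i j, ω.form (l i) (l j) = 0) :
    IsLagrangian ω (Submodule.span ℂ (Set.range l)) := by
  refine ⟨by rw [finrank_span_eq_card hl, Fintype.card_fin], fun u hu v hv => ?_⟩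
  rw [Submodule.mem_span_range_iff_exists_fun] at hu hv
  obtain ⟨c, rfl⟩ := hu
  obtain ⟨d, rfl⟩ := hv
  simp [hll]

theorem IsFrame.isLagrangian {ω : SymplecticForm C} {l m : Fin 3 → C} (F : IsFrame ω l m) :
    IsLagrangian ω (Submodule.span ℂ (Set.range l)) :=
  isLagrangian_span F.linearIndependent_left F.ll

/-! ### Effective forms in a frame -/

variable [FiniteDimensional ℂ C] {ω : SymplecticForm C} {l m : Fin 3 → C}

/-- In the trace, the diagonal entries at `l i` and at `m i` both equal -η(w, l i, m i), hence the
factor -2. -/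
theorem IsFrame.contract_eq (F : IsFrame ω l m) (h6 : Module.finrank ℂ C = 6) (η : ThreeForm C)
    (w : C) : contract ω η w = -2 * ∑ i, η ![w, l i, m i] := by
  have key : ∀ z : C, ∀ k, (F.basis h6).repr z k
      = Sum.elim (fun i => ω.form (m i) z) (fun i => ω.form z (l i)) k := by
    intro z k
    have h := (F.basis h6).sum_repr z
    rw [Fintype.sum_sum_type] at h
    simp only [F.coe_basis, Sum.elim_inl, Sum.elim_inr] at h
    generalize (F.basis h6).repr z = r at h ⊢
    subst h
    rcases k with i | i <;> simp [F.ml, F.mm, F.ll]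
  rw [contract, LinearMap.trace_eq_matrix_trace ℂ (F.basis h6), Matrix.trace, Fintype.sum_sum_type]
  simp only [Matrix.diag_apply, LinearMap.toMatrix_apply, key, F.coe_basis, Sum.elim_inl,
    Sum.elim_inr, LinearMap.comp_apply, LinearEquiv.coe_coe]
  have h2 : ∀ i, ω.form (m i) ((ω.form.toDual ω.nondeg).symm (insertVec η w (l i)))
      = - η ![w, l i, m i] := fun i => by
    rw [ω.neg_swap, LinearMap.BilinForm.apply_toDual_symm_apply]; rfl
  have h3 : ∀ i, ω.form ((ω.form.toDual ω.nondeg).symm (insertVec η w (m i))) (l i)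
      = - η ![w, l i, m i] := fun i => by
    rw [LinearMap.BilinForm.apply_toDual_symm_apply, ← threeForm_swap_one_two]; rfl
  simp only [h2, h3, Finset.sum_neg_distrib]
  ring

theorem IsFrame.mem_effectiveForms (F : IsFrame ω l m) (h6 : Module.finrank ℂ C = 6)
    (η : ThreeForm C) : η ∈ effectiveForms ω ↔ ∀ w, ∑ i, η ![w, l i, m i] = 0 := by
  refine forall_congr' fun w => ?_
  rw [F.contract_eq h6]
  simp

/-- The trace condition at w = `l k` has only two surviving terms, and they compare the two entries
of A whose indices are the ones other than k. -/
theorem IsFrame.A_symm (F : IsFrame ω l m) (h6 : Module.finrank ℂ C = 6) {η : ThreeForm C}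
    (hη : η ∈ effectiveForms ω) (i j : Fin 3) :
    η (Function.update l i (m j)) = η (Function.update l j (m i)) := by
  have h := (F.mem_effectiveForms h6 η).1 hη
  have h0 := h (l 0)
  have h1 := h (l 1)
  have h2 := h (l 2)
  rw [Fin.sum_univ_three] at h0 h1 h2
  simp only [threeForm_eq_zero_zero_one, zero_add, add_zero] at h0 h1 h2
  rw [threeForm_swap_one_two η (l 0) (m 2) (l 2)] at h0
  rw [threeForm_swap_zero_one η (l 0) (l 1), threeForm_rotate η (m 2) (l 1) (l 2)] at h1
  rw [← threeForm_rotate η (l 2), ← threeForm_rotate η (l 2),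
    threeForm_swap_zero_one η (m 1) (l 1)] at h2
  have hi : i = 0 ∨ i = 1 ∨ i = 2 := by omega
  have hj : j = 0 ∨ j = 1 ∨ j = 2 := by omega
  rcases hi with rfl | rfl | rfl <;> rcases hj with rfl | rfl | rfl <;>
    simp only [update_zero, update_one, update_two] <;>
    first
      | linear_combination h0
      | linear_combination -h0
      | linear_combination h1
      | linear_combination -h1
      | linear_combination h2
      | linear_combination -h2


theorem IsFrame.B_symm (F : IsFrame ω l m) (h6 : Module.finrank ℂ C = 6) {η : ThreeForm C}
    (hη : η ∈ effectiveForms ω) (i j : Fin 3) :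
    η (Function.update m i (l j)) = η (Function.update m j (l i)) := by
  have h := F.symm.A_symm h6 hη i j
  simp only [Pi.neg_apply] at h
  rw [← neg_one_smul ℂ (l j), ← neg_one_smul ℂ (l i), η.map_update_smul, η.map_update_smul] at h
  simpa using h

theorem IsFrame.ofCoords_mem (F : IsFrame ω l m) (h6 : Module.finrank ℂ C = 6) (a d : ℂ)
    {A B : Fin 3 → Fin 3 → ℂ} (hA : ∀ i j, A i j = A j i) (hB : ∀ i j, B i j = B j i) :
    ofCoords ω l m a A B d ∈ effectiveForms ω := by
  rw [F.mem_effectiveForms h6]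
  intro w
  have h : ∀ η : ThreeForm C, ∑ i, η ![w, l i, m i] = (∑ i, insertTwo η (l i) (m i)) w := by
    intro η
    rw [LinearMap.sum_apply]
    refine Finset.sum_congr rfl fun i _ => ?_
    rw [insertTwo_apply, threeForm_rotate η w]
  rw [h]
  refine F.linearMap_eq_zero h6 (fun j => ?_) (fun j => ?_) w <;>
  · have hj : j = 0 ∨ j = 1 ∨ j = 2 := by omega
    rcases hj with rfl | rfl | rfl <;>
      simp [insertTwo_apply, ofCoords, tri_apply, Fin.sum_univ_three, F.ll, F.mm, F.ml,
        hA 1 0, hA 2 0, hA 2 1, hB 1 0, hB 2 0, hB 2 1]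

/-! ### Tangent hyperplanes in a frame -/

omit [FiniteDimensional ℂ C] in
-- Each term of the symbol moves only one of the three arguments out of L, so two arguments in L are
-- left to annihilate η.
theorem isTangentHyperplane_of_insertTwo {η : ThreeForm C} {l : Fin 3 → C}
    (hl : LinearIndependent ℂ l) (hll : ∀ i j, ω.form (l i) (l j) = 0)
    (h : ∀ i j z, η ![l i, l j, z] = 0) :
    IsTangentHyperplane ω η (Submodule.span ℂ (Set.range l)) := by
  have key : ∀ x ∈ Submodule.span ℂ (Set.range l), ∀ y ∈ Submodule.span ℂ (Set.range l), ∀ z,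
      η ![x, y, z] = 0 := by
    intro x hx y hy z
    rw [Submodule.mem_span_range_iff_exists_fun] at hx hy
    obtain ⟨c, rfl⟩ := hx
    obtain ⟨d, rfl⟩ := hy
    simp [Fin.sum_univ_three, threeForm_add_zero, threeForm_add_one, threeForm_smul_zero,
      threeForm_smul_one, h]
  refine ⟨⟨isLagrangian_span hl hll, fun u hu => ?_⟩, fun t ht u => ?_⟩
  · rw [vec_three_eta u]
    exact key _ (hu 0) _ (hu 1) _
  · rw [symbol, Fin.sum_univ_three, update_zero, update_one, update_two, key _ (u 0).2 _ (u 1).2,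
      threeForm_swap_one_two η (u 0) (u 2) (t (u 1)), key _ (u 0).2 _ (u 2).2,
      ← threeForm_rotate η (t (u 0)), key _ (u 1).2 _ (u 2).2]
    simp

/-- A Lagrangian plane spanned by three vectors which annihilate `η` in pairs is a point of
tangency. -/
theorem isTangentHyperplane_triple {η : ThreeForm C} {u v w : C}
    (h : LinearIndependent ℂ ![u, v, w]) (huv : ω.form u v = 0) (huw : ω.form u w = 0)
    (hvw : ω.form v w = 0) (h1 : ∀ z, η ![u, v, z] = 0) (h2 : ∀ z, η ![u, w, z] = 0)
    (h3 : ∀ z, η ![v, w, z] = 0) :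
    IsTangentHyperplane ω η (Submodule.span ℂ (Set.range ![u, v, w])) := by
  have huv' := ω.neg_swap v u
  have huw' := ω.neg_swap w u
  have hvw' := ω.neg_swap w v
  rw [huv, neg_zero] at huv'
  rw [huw, neg_zero] at huw'
  rw [hvw, neg_zero] at hvw'
  refine isTangentHyperplane_of_insertTwo h (fun i j => ?_) (fun i j z => ?_)
  · fin_cases i <;> fin_cases j <;> simp [ω.self, *]
  · have h1' := h1 z
    have h2' := h2 z
    have h3' := h3 z
    fin_cases i <;> fin_cases j <;>
      simp [threeForm_eq_zero_zero_one, threeForm_swap_zero_one η u v,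
        threeForm_swap_zero_one η u w, threeForm_swap_zero_one η v w, *]

theorem IsFrame.isTangentHyperplane (F : IsFrame ω l m) (h6 : Module.finrank ℂ C = 6)
    {η : ThreeForm C} (h0 : η l = 0) (hA : ∀ i j, η (Function.update l i (m j)) = 0) :
    IsTangentHyperplane ω η (Submodule.span ℂ (Set.range l)) := by
  have e := F.eq_ofCoords h6 η
  simp only [h0, hA] at e
  refine isTangentHyperplane_of_insertTwo F.linearIndependent_left F.ll (fun i j z => ?_)
  rw [e]
  simp [ofCoords, tri_apply, Fin.sum_univ_three, F.ll]

theorem IsFrame.of_isTangentHyperplane (F : IsFrame ω l m) (h6 : Module.finrank ℂ C = 6)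
    {η : ThreeForm C} (hη : η ∈ effectiveForms ω)
    (h : IsTangentHyperplane ω η (Submodule.span ℂ (Set.range l))) :
    η l = 0 ∧ ∀ i j, η (Function.update l i (m j)) = 0 := by
  refine ⟨h.1.2 l fun i => Submodule.subset_span ⟨i, rfl⟩, fun i j => ?_⟩
  -- Test tangent vector: it sends `l i` to `m j` and `l j` to `m i`, so the symbol takes the value
  -- A i j + A j i, which is twice A i j by symmetry.
  set X : C →ₗ[ℂ] C := (ω.form (m i)).smulRight (m j) + (ω.form (m j)).smulRight (m i) with hX
  have h1 := h.2 (X ∘ₗ Submodule.subtype _) (by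
    intro u v
    simp [hX]
    ring) (fun k => ⟨l k, Submodule.subset_span ⟨k, rfl⟩⟩)
  have h2 : ∀ k, η (Function.update l k (X (l k))) = (if i = k then
      η (Function.update l k (m j)) else 0) + if j = k then η (Function.update l k (m i)) else 0 := by
    intro k
    simp only [hX, LinearMap.add_apply, LinearMap.smulRight_apply, F.ml, η.map_update_add,
      η.map_update_smul]
    simp
  simp only [symbol, LinearMap.comp_apply, Submodule.subtype_apply] at h1
  simp_rw [h2] at h1
  rw [Finset.sum_add_distrib, Finset.sum_ite_eq, Finset.sum_ite_eq, F.A_symm h6 hη j i] at h1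
  simpa using h1

end FrameExistence

/-! ### The moment form in a frame -/

section MomentForm

variable {C : Type*} [AddCommGroup C] [Module ℂ C]

/-- The cofactor of a symmetric `3 × 3` matrix, given by an explicit formula. -/
def cof (A : Fin 3 → Fin 3 → ℂ) : Matrix (Fin 3) (Fin 3) ℂ :=
  !![A 1 1 * A 2 2 - A 1 2 * A 1 2, A 0 2 * A 1 2 - A 0 1 * A 2 2, A 0 1 * A 1 2 - A 0 2 * A 1 1;
    A 0 2 * A 1 2 - A 0 1 * A 2 2, A 0 0 * A 2 2 - A 0 2 * A 0 2, A 0 1 * A 0 2 - A 0 0 * A 1 2;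
    A 0 1 * A 1 2 - A 0 2 * A 1 1, A 0 1 * A 0 2 - A 0 0 * A 1 2, A 0 0 * A 1 1 - A 0 1 * A 0 1]

theorem cof_eq_adjugate {A : Fin 3 → Fin 3 → ℂ} (hA : ∀ i j, A i j = A j i) :
    cof A = (Matrix.of A).adjugate := by
  rw [Matrix.adjugate_fin_three, cof]
  ext i j
  fin_cases i <;> fin_cases j <;> simp [hA 1 0, hA 2 0, hA 2 1] <;> ring

/-- The quadratic form `2 ϖ / κ` in frame coordinates, polarized: the part on `l`, the part on `m`
and the mixed part. -/
def momentLL (a : ℂ) (A B : Fin 3 → Fin 3 → ℂ) (i j : Fin 3) : ℂ := cof A i j - a * B i j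

/-- The mixed part of the moment form in frame coordinates. -/
def momentLM (a : ℂ) (A B : Fin 3 → Fin 3 → ℂ) (d : ℂ) (i j : Fin 3) : ℂ :=
  (if i = j then (∑ p, ∑ q, A p q * B p q) - a * d else 0) / 2 - ∑ k, A j k * B k i

theorem threeForm_lieAct (X : Module.End ℂ C) (η : ThreeForm C) (u v w : C) :
    lieAct X η ![u, v, w] = -(η ![X u, v, w] + η ![u, X v, w] + η ![u, v, X w]) := rfl

variable {ω : SymplecticForm C} {l m : Fin 3 → C}

theorem sqToSp_self (a : C) : ((sqToSp ω a a : sp ω) : Module.End ℂ C)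
    = (ω.form a).smulRight a := by
  change (2⁻¹ : ℂ) • ((ω.form a).smulRight a + (ω.form a).smulRight a) = _
  rw [← two_smul ℂ, smul_smul]
  norm_num

theorem framePairing_eq (l m : Fin 3 → C) (α β : ThreeForm C) :
    framePairing l m α β = α ![l 0, l 1, l 2] * β ![m 0, m 1, m 2]
      - α ![m 0, m 1, m 2] * β ![l 0, l 1, l 2]
      - ∑ j, (α ![m j, l 1, l 2] * β (Function.update m j (l 0))
        + α ![l 0, m j, l 2] * β (Function.update m j (l 1))
        + α ![l 0, l 1, m j] * β (Function.update m j (l 2)))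
      + ∑ j, (α ![l j, m 1, m 2] * β (Function.update l j (m 0))
        + α ![m 0, l j, m 2] * β (Function.update l j (m 1))
        + α ![m 0, m 1, l j] * β (Function.update l j (m 2))) := by
  rw [framePairing, ← vec_three_eta l, ← vec_three_eta m]
  simp only [Fin.sum_univ_three, update_zero, update_one, update_two]
  ring

/-- Table of the two-form η(v, ·, ·) in the frame. Here ω(m i, v) and ω(v, l i) are the coordinates
of v along `l i` and `m i`. -/
theorem IsFrame.insert_ofCoords (F : IsFrame ω l m) (a d : ℂ) {A B : Fin 3 → Fin 3 → ℂ}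
    (hA : ∀ i j, A i j = A j i) (hB : ∀ i j, B i j = B j i) (v : C) {η : ThreeForm C}
    (hη : η = ofCoords ω l m a A B d) :
    η ![v, l 1, l 2] =
      (ω.form (m 0) v * a + (ω.form v (l 0) * A 0 0 + ω.form v (l 1) * A 0 1 + ω.form v (l 2) * A 0 2)) ∧
    η ![v, m 1, m 2] =
      (ω.form v (l 0) * d + (ω.form (m 0) v * B 0 0 + ω.form (m 1) v * B 0 1 + ω.form (m 2) v * B 0 2)) ∧
    η ![v, l 0, l 2] =
      -(ω.form (m 1) v * a + (ω.form v (l 0) * A 0 1 + ω.form v (l 1) * A 1 1 + ω.form v (l 2) * A 1 2)) ∧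
    η ![v, m 0, m 2] =
      -(ω.form v (l 1) * d + (ω.form (m 0) v * B 0 1 + ω.form (m 1) v * B 1 1 + ω.form (m 2) v * B 1 2)) ∧
    η ![v, l 0, l 1] =
      (ω.form (m 2) v * a + (ω.form v (l 0) * A 0 2 + ω.form v (l 1) * A 1 2 + ω.form v (l 2) * A 2 2)) ∧
    η ![v, m 0, m 1] =
      (ω.form v (l 2) * d + (ω.form (m 0) v * B 0 2 + ω.form (m 1) v * B 1 2 + ω.form (m 2) v * B 2 2)) ∧
    η ![v, l 0, m 0] =
      ω.form (m 2) v * A 0 1 - ω.form (m 1) v * A 0 2 + (ω.form v (l 1) * B 0 2 - ω.form v (l 2) * B 0 1) ∧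
    η ![v, l 0, m 1] =
      ω.form (m 2) v * A 1 1 - ω.form (m 1) v * A 1 2 + (ω.form v (l 2) * B 0 0 - ω.form v (l 0) * B 0 2) ∧
    η ![v, l 0, m 2] =
      ω.form (m 2) v * A 1 2 - ω.form (m 1) v * A 2 2 + (ω.form v (l 0) * B 0 1 - ω.form v (l 1) * B 0 0) ∧
    η ![v, l 1, m 0] =
      ω.form (m 0) v * A 0 2 - ω.form (m 2) v * A 0 0 + (ω.form v (l 1) * B 1 2 - ω.form v (l 2) * B 1 1) ∧
    η ![v, l 1, m 1] =
      ω.form (m 0) v * A 1 2 - ω.form (m 2) v * A 0 1 + (ω.form v (l 2) * B 0 1 - ω.form v (l 0) * B 1 2) ∧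
    η ![v, l 1, m 2] =
      ω.form (m 0) v * A 2 2 - ω.form (m 2) v * A 0 2 + (ω.form v (l 0) * B 1 1 - ω.form v (l 1) * B 0 1) ∧
    η ![v, l 2, m 0] =
      ω.form (m 1) v * A 0 0 - ω.form (m 0) v * A 0 1 + (ω.form v (l 1) * B 2 2 - ω.form v (l 2) * B 1 2) ∧
    η ![v, l 2, m 1] =
      ω.form (m 1) v * A 0 1 - ω.form (m 0) v * A 1 1 + (ω.form v (l 2) * B 0 2 - ω.form v (l 0) * B 2 2) ∧
    η ![v, l 2, m 2] =
      ω.form (m 1) v * A 0 2 - ω.form (m 0) v * A 1 2 + (ω.form v (l 0) * B 1 2 - ω.form v (l 1) * B 0 2) := by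
  subst hη
  refine ⟨?_, ?_, ?_, ?_, ?_, ?_, ?_, ?_, ?_, ?_, ?_, ?_, ?_, ?_, ?_⟩ <;>
  · simp [ofCoords, tri_apply, Fin.sum_univ_three, F.ll, F.mm, F.ml,
      hA 1 0, hA 2 0, hA 2 1, hB 1 0, hB 2 0, hB 2 1]
    try ring

/-- For X = ω(v, ·) v one has X · η = -ω(v, ·) ∧ η(v, ·, ·). This makes the moment form depend only
on the table of η(v, ·, ·). -/
theorem lieAct_rankOne (η : ThreeForm C) (v x y z : C) :
    lieAct ((ω.form v).smulRight v) η ![x, y, z] =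
      -(ω.form v x * η ![v, y, z] - ω.form v y * η ![v, x, z] + ω.form v z * η ![v, x, y]) := by
  rw [threeForm_lieAct]
  simp only [LinearMap.smulRight_apply, threeForm_smul_zero, threeForm_smul_one,
    threeForm_smul_two]
  rw [threeForm_swap_zero_one η v x, ← threeForm_rotate η x y v, ← threeForm_rotate η y v x]
  ring

/-- The central computation: once the table is substituted in the shuffle expansion, both sides are
polynomials in the components of η and the coordinates of v, and they agree identically. -/
theorem IsFrame.framePairing_lieAct (F : IsFrame ω l m) (a d : ℂ) {A B : Fin 3 → Fin 3 → ℂ}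
    (hA : ∀ i j, A i j = A j i) (hB : ∀ i j, B i j = B j i) (v : C) {η : ThreeForm C}
    (hη : η = ofCoords ω l m a A B d) :
    framePairing l m (lieAct ((ω.form v).smulRight v) η) η = 2 * (
      ∑ i, ∑ j, (ω.form (m i) v * ω.form (m j) v * momentLL a A B i j
        + 2 * ω.form (m i) v * ω.form v (l j) * momentLM a A B d i j
        + ω.form v (l i) * ω.form v (l j) * momentLL d B A i j)) := by
  have h1 : ∀ i, ω.form v (m i) = - ω.form (m i) v := fun i => ω.neg_swap _ _
  obtain ⟨e0, e1, e2, e3, e4, e5, e6, e7, e8, e9, e10, e11, e12, e13, e14⟩ := F.insert_ofCoords a d hA hB v hη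
  have s : ∀ i j, η ![v, m i, l j] = - η ![v, l j, m i] := fun i j => threeForm_swap_one_two η _ _ _
  have f0 : η ![l 0, l 1, l 2] = a := by
    simp [hη, ofCoords, tri_apply, Fin.sum_univ_three, F.ll, F.ml]
  have f1 : η ![m 0, m 1, m 2] = d := by
    simp [hη, ofCoords, tri_apply, Fin.sum_univ_three, F.mm, F.ml]
  have fA : ∀ i j, η (Function.update l i (m j)) = A i j := by
    intro i j
    have hi : i = 0 ∨ i = 1 ∨ i = 2 := by omega
    have hj : j = 0 ∨ j = 1 ∨ j = 2 := by omega
    rcases hi with rfl | rfl | rfl <;> rcases hj with rfl | rfl | rfl <;>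
      simp [hη, ofCoords, tri_apply, Fin.sum_univ_three, F.ll, F.mm, F.ml, update_zero,
        update_one, update_two]
  have fB : ∀ i j, η (Function.update m i (l j)) = B i j := by
    intro i j
    have hi : i = 0 ∨ i = 1 ∨ i = 2 := by omega
    have hj : j = 0 ∨ j = 1 ∨ j = 2 := by omega
    rcases hi with rfl | rfl | rfl <;> rcases hj with rfl | rfl | rfl <;>
      simp [hη, ofCoords, tri_apply, Fin.sum_univ_three, F.ll, F.mm, F.ml, update_zero,
        update_one, update_two]
  rw [framePairing_eq]
  simp only [Fin.sum_univ_three, lieAct_rankOne, fA, fB, f0, f1, s, h1, e0, e1, e2, e3, e4, e5, e6, e7, e8, e9, e10, e11, e12, e13, e14,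
    hA 1 0, hA 2 0, hA 2 1, hB 1 0, hB 2 0, hB 2 1]
  simp [momentLL, momentLM, cof, Fin.sum_univ_three, hA 1 0, hA 2 0, hA 2 1, hB 1 0, hB 2 0, hB 2 1]
  ring

end MomentForm

/-! ### Moment form and cocharacteristic variety -/

section Cocharacteristic

variable {C : Type*} [AddCommGroup C] [Module ℂ C] {ω : SymplecticForm C} {l m : Fin 3 → C}

/-- The components of type `(2, 1)` of a three-form with respect to two triples of vectors. -/
def comp (η : ThreeForm C) (l m : Fin 3 → C) (i j : Fin 3) : ℂ := η (Function.update l i (m j))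

theorem momentForm_apply (e : Module.Basis (Fin 3 ⊕ Fin 3) ℂ C) (η : ThreeForm C) (v : C) :
    momentForm ω e η v = wedgePairing e (lieAct ((ω.form v).smulRight v) η) η / 2 := by
  rw [← sqToSp_self]
  rfl

theorem momentLL_symm {a : ℂ} {A B : Fin 3 → Fin 3 → ℂ} (hB : ∀ i j, B i j = B j i) (i j : Fin 3) :
    momentLL a A B i j = momentLL a A B j i := by
  rw [momentLL, momentLL, hB i j]
  congr 1
  fin_cases i <;> fin_cases j <;> rfl

variable [FiniteDimensional ℂ C]

theorem IsFrame.momentForm_eq (F : IsFrame ω l m) (h6 : Module.finrank ℂ C = 6)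
    (e : Module.Basis (Fin 3 ⊕ Fin 3) ℂ C) : ∃ κ : ℂ, κ ≠ 0 ∧ ∀ η ∈ effectiveForms ω, ∀ v,
      momentForm ω e η v = κ *
      ∑ i, ∑ j, (ω.form (m i) v * ω.form (m j) v * momentLL (η l) (comp η l m) (comp η m l) i j
        + 2 * ω.form (m i) v * ω.form v (l j) *
          momentLM (η l) (comp η l m) (comp η m l) (η m) i j
        + ω.form v (l i) * ω.form v (l j) * momentLL (η m) (comp η m l) (comp η l m) i j) := by
  obtain ⟨κ, hκ, h⟩ := wedgePairing_eq e (F.basis h6)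
  refine ⟨κ, hκ, fun η hη v => ?_⟩
  have hb1 : (fun i => F.basis h6 (Sum.inl i)) = l := by
    ext i; rw [F.coe_basis, Sum.elim_inl]
  have hb2 : (fun i => F.basis h6 (Sum.inr i)) = m := by
    ext i; rw [F.coe_basis, Sum.elim_inr]
  have h2 := F.framePairing_lieAct (A := comp η l m) (B := comp η m l) (η l) (η m) (F.A_symm h6 hη) (F.B_symm h6 hη) v
    (F.eq_ofCoords h6 η)
  rw [momentForm_apply, h, hb1, hb2, h2]
  ring

/-- Polarization doubles the diagonal values, so the constant is twice the one of the quadratic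
form. -/
theorem IsFrame.momentForm_polar (F : IsFrame ω l m) (h6 : Module.finrank ℂ C = 6)
    (e : Module.Basis (Fin 3 ⊕ Fin 3) ℂ C) : ∃ κ : ℂ, κ ≠ 0 ∧ ∀ η ∈ effectiveForms ω, ∀ v w,
      (momentForm ω e η).polarBilin v w = κ *
      ∑ i, ∑ j, (ω.form (m i) v * ω.form (m j) w * momentLL (η l) (comp η l m) (comp η m l) i j
        + (ω.form (m i) v * ω.form w (l j) + ω.form (m i) w * ω.form v (l j)) *
          momentLM (η l) (comp η l m) (comp η m l) (η m) i j
        + ω.form v (l i) * ω.form w (l j) * momentLL (η m) (comp η m l) (comp η l m) i j) := by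
  obtain ⟨κ, hκ, h⟩ := F.momentForm_eq h6 e
  refine ⟨2 * κ, by simpa using hκ, fun η hη v w => ?_⟩
  have hA : ∀ i j, comp η l m i j = comp η l m j i := F.A_symm h6 hη
  have hB : ∀ i j, comp η m l i j = comp η m l j i := F.B_symm h6 hη
  have s1 := momentLL_symm (a := η l) (A := comp η l m) hB
  have s2 := momentLL_symm (a := η m) (A := comp η m l) hA
  rw [QuadraticMap.polarBilin_apply_apply, QuadraticMap.polar, h η hη, h η hη, h η hη]
  generalize momentLL (η l) (comp η l m) (comp η m l) = P at *
  generalize momentLL (η m) (comp η m l) (comp η l m) = T at *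
  simp only [Fin.sum_univ_three, map_add, LinearMap.add_apply, s1 1 0, s1 2 0, s1 2 1, s2 1 0,
    s2 2 0, s2 2 1]
  ring

/-- On a Lagrangian plane of the equation, the moment form is given by the cofactor matrix of the
symbol. -/
theorem IsFrame.momentForm_sum (F : IsFrame ω l m) (h6 : Module.finrank ℂ C = 6)
    (e : Module.Basis (Fin 3 ⊕ Fin 3) ℂ C) {η : ThreeForm C} (hη : η ∈ effectiveForms ω)
    (h0 : η l = 0) : ∃ κ : ℂ, κ ≠ 0 ∧ ∀ c : Fin 3 → ℂ, momentForm ω e η (∑ i, c i • l i) =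
      κ * dotProduct c (Matrix.mulVec (Matrix.of (comp η l m)).adjugate c) := by
  obtain ⟨κ, hκ, h⟩ := F.momentForm_eq h6 e
  refine ⟨κ, hκ, fun c => ?_⟩
  have hx : ∀ i, ω.form (m i) (∑ k, c k • l k) = c i := fun i => by simp [F.ml]
  have hy : ∀ i, ω.form (∑ k, c k • l k) (l i) = 0 := fun i => by simp [F.ll]
  rw [h η hη, ← cof_eq_adjugate (A := comp η l m) (F.A_symm h6 hη)]
  simp only [hx, hy, h0, momentLL, dotProduct, Matrix.mulVec]
  simp only [Fin.sum_univ_three]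
  ring

omit [FiniteDimensional ℂ C] in
theorem symbolMatrix_eq (hη : ∀ i j, comp η l m i j = comp η l m j i) :
    symbolMatrix η l m = Matrix.of (comp η l m) := by
  ext i j
  rw [symbolMatrix, Matrix.of_apply, ← comp, ← comp, hη j i]
  ring

/-- An adapted frame need not be symplectic, but its correction to a symplectic one leaves the
symbol unchanged on a plane of the equation; then `IsFrame.momentForm_sum` applies. -/
theorem cocharacteristicAt_subset (h6 : Module.finrank ℂ C = 6)
    (e : Module.Basis (Fin 3 ⊕ Fin 3) ℂ C) {η : ThreeForm C} (hη : η ∈ effectiveForms ω)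
    {L : Submodule ℂ C} (hL : L ∈ mongeAmpere ω η) :
    cocharacteristicAt ω η L ⊆ quadric (momentForm ω e η) := by
  rintro p ⟨l, n, c, ⟨hl, rfl, hn⟩, hp, hc⟩
  have mem : ∀ i, l i ∈ Submodule.span ℂ (Set.range l) := fun i => Submodule.subset_span ⟨i, rfl⟩
  have F := isFrame_of_dual ω (fun i j => hL.1.2 _ (mem i) _ (mem j)) hn
  have h0 : ∀ i k, η (Function.update l i (l k)) = 0 := by
    intro i k
    refine hL.2 _ fun j => ?_
    rcases eq_or_ne j i with rfl | h
    · rw [Function.update_self]; exact mem k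
    · rw [Function.update_of_ne h]; exact mem j
  -- The correction adds vectors of L to `n`, and η vanishes on triples of L.
  have h1 : comp η l (fun i => n i + (2⁻¹ : ℂ) • ∑ k, ω.form (n i) (n k) • l k) = comp η l n := by
    ext i j
    simp only [comp, η.map_update_add, η.map_update_smul, Fin.sum_univ_three, h0]
    simp
  have h2 : ∀ i j, comp η l n i j = comp η l n j i := by
    rw [← h1]; exact F.A_symm h6 hη
  obtain ⟨κ, hκ, h⟩ := F.momentForm_sum h6 e hη (hL.2 l mem)
  change momentForm ω e η p.rep = 0
  rw [hp, h, h1, ← symbolMatrix_eq h2, hc, mul_zero]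

theorem IsFrame.mem_cocharacteristicAt (F : IsFrame ω l m) (h6 : Module.finrank ℂ C = 6)
    (e : Module.Basis (Fin 3 ⊕ Fin 3) ℂ C) {η : ThreeForm C} (hη : η ∈ effectiveForms ω)
    (h0 : η l = 0) {p : ℙ ℂ C} (hp : p.rep = l 0) (hq : momentForm ω e η p.rep = 0) :
    p ∈ cocharacteristicAt ω η (Submodule.span ℂ (Set.range l)) := by
  obtain ⟨κ, hκ, h⟩ := F.momentForm_sum h6 e hη h0
  refine ⟨l, m, ![1, 0, 0], ⟨F.linearIndependent_left, rfl, F.ml⟩, ?_, ?_⟩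
  · simp [Fin.sum_univ_three, hp]
  · have h1 := h ![1, 0, 0]
    have h2 : ∑ i, (![1, 0, 0] : Fin 3 → ℂ) i • l i = l 0 := by simp [Fin.sum_univ_three]
    rw [h2, ← hp, hq, zero_eq_mul] at h1
    rw [symbolMatrix_eq (F.A_symm h6 hη)]
    exact h1.resolve_left hκ

omit [FiniteDimensional ℂ C] in
theorem IsFrame.mem_mongeAmpere (F : IsFrame ω l m) (h6 : Module.finrank ℂ C = 6) {η : ThreeForm C}
    (h0 : η l = 0) : Submodule.span ℂ (Set.range l) ∈ mongeAmpere ω η := by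
  refine ⟨F.isLagrangian, fun u hu => ?_⟩
  have hy : ∀ i k, ω.form (u i) (l k) = 0 := fun i k =>
    F.isLagrangian.2 _ (hu i) _ (Submodule.subset_span ⟨k, rfl⟩)
  rw [F.eq_ofCoords h6 η, h0]
  simp [ofCoords, tri_apply, hy, Fin.sum_univ_three]

/-- A vector `v` such that `η(v, ·, ·)` does not vanish on the orthogonal of `v` belongs to a smooth
point of the equation. -/
theorem exists_frame_mem_smoothPoints (h6 : Module.finrank ℂ C = 6) {η : ThreeForm C}
    (hη : η ∈ effectiveForms ω) {v x y : C} (hx : ω.form v x = 0) (h : η ![v, x, y] ≠ 0) :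
    ∃ l m, IsFrame ω l m ∧ l 0 = v ∧ η l = 0 ∧
      Submodule.span ℂ (Set.range l) ∈ smoothPoints ω η := by
  have hv : v ≠ 0 := by
    rintro rfl
    apply h
    have := threeForm_smul_zero η 0 (0 : C) x y
    simpa using this
  have hx' : x ∉ Submodule.span ℂ (Set.range ![v]) := by
    intro hxv
    rw [Matrix.range_cons, Matrix.range_empty, Set.union_empty, Submodule.mem_span_singleton] at hxv
    obtain ⟨c, rfl⟩ := hxv
    rw [threeForm_smul_one, threeForm_eq_zero_zero_one, mul_zero] at h
    exact h rfl
  -- The first two conditions make ⟨v, x, z⟩ Lagrangian, the third puts it in the equation. Tangency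
  -- there would force η(v, x, ·) = 0, against the choice of y.
  obtain ⟨z, hz, hz'⟩ := exists_forall_eq_zero_notMem_span
    ![ω.form v, ω.form x, insertTwo η v x] ![v, x] (by omega)
  obtain ⟨m, F⟩ := exists_isFrame_triple ω hv hx' hz' hx (hz 0) (hz 1)
  have h0 : η ![v, x, z] = 0 := hz 2
  refine ⟨_, m, F, rfl, h0, F.mem_mongeAmpere h6 h0, fun ht => ?_⟩
  obtain ⟨-, hA⟩ := F.of_isTangentHyperplane h6 hη ht
  apply h
  rw [← insertTwo_apply]
  refine F.linearMap_eq_zero h6 (fun i => ?_) (fun i => ?_) y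
  · fin_cases i
    · exact threeForm_eq_zero_zero_two η v x
    · exact threeForm_eq_zero_one_two η x v
    · exact h0
  · have := hA 2 i
    rwa [update_two] at this

end Cocharacteristic

/-! ### Degenerate moment forms and tangent hyperplanes -/

section Degenerate

variable {C : Type*} [AddCommGroup C] [Module ℂ C] [FiniteDimensional ℂ C]
  {ω : SymplecticForm C} {l m : Fin 3 → C}

omit [FiniteDimensional ℂ C] in
theorem notMem_span_singleton_of_form {v x m : C} (hv : ω.form m v = 1) (hx : ω.form m x = 0)
    (hx0 : x ≠ 0) : x ∉ Submodule.span ℂ (Set.range ![v]) := by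
  intro h
  rw [Matrix.range_cons, Matrix.range_empty, Set.union_empty, Submodule.mem_span_singleton] at h
  obtain ⟨c, rfl⟩ := h
  apply hx0
  rw [map_smul, hv, smul_eq_mul, mul_one] at hx
  rw [hx, zero_smul]

/-- If `η(v, ·, ·)` vanishes on the orthogonal of `v`, then the hyperplane `η` is tangent. -/
theorem exists_isTangentHyperplane_of_insert_eq_zero (h6 : Module.finrank ℂ C = 6) {η : ThreeForm C}
    (hη : η ∈ effectiveForms ω) {v : C} (hv : v ≠ 0)
    (hZ : ∀ x y, ω.form v x = 0 → ω.form v y = 0 → η ![v, x, y] = 0) :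
    ∃ L, IsTangentHyperplane ω η L := by
  obtain ⟨l, m, F, rfl⟩ := exists_isFrame_of_ne_zero ω h6 hv
  -- Since η(v, ·, ·) vanishes on the orthogonal of v, it is determined by its contraction with `m
  -- 0`, which t represents.
  obtain ⟨t, ht⟩ : ∃ t, ∀ z, ω.form t z = η ![l 0, m 0, z] :=
    ⟨(ω.form.toDual ω.nondeg).symm (insertTwo η (l 0) (m 0)), fun z => by
      rw [LinearMap.BilinForm.apply_toDual_symm_apply]; rfl⟩
  -- The choice x = t makes orthogonality to x the same as orthogonality to t; if t = 0, any
  -- suitable vector such as `l 1` works.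
  obtain ⟨x, hx0, hvx, htx, hmx, hxt⟩ : ∃ x, x ≠ 0 ∧ ω.form (l 0) x = 0 ∧ ω.form t x = 0 ∧
      ω.form (m 0) x = 0 ∧ ∀ y, ω.form x y = 0 → ω.form t y = 0 := by
    by_cases h : t = 0
    · refine ⟨l 1, F.linearIndependent_left.ne_zero 1, F.ll _ _, by simp [h], by simp [F.ml],
        by simp [h]⟩
    · refine ⟨t, h, ?_, ω.self t, ?_, fun y hy => hy⟩
      · rw [ω.neg_swap, ht, threeForm_eq_zero_zero_two, neg_zero]
      · rw [ω.neg_swap, ht, threeForm_eq_zero_one_two, neg_zero]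
  have hx : x ∉ Submodule.span ℂ (Set.range ![l 0]) :=
    notMem_span_singleton_of_form (by simp [F.ml]) hmx hx0
  -- The third condition is the part of η(x, y, ·) = 0 in the direction `m 0`, which lies outside
  -- the orthogonal of v.
  obtain ⟨y, hy, hy'⟩ := exists_forall_eq_zero_notMem_span
    ![ω.form (l 0), ω.form x, insertTwo η x (m 0)] ![l 0, x] (by omega)
  have hvy : ω.form (l 0) y = 0 := hy 0
  have hxy : ω.form x y = 0 := hy 1
  have hxmy : η ![x, m 0, y] = 0 := hy 2
  obtain ⟨n, G⟩ := exists_isFrame_triple ω hv hx hy' hvx hvy hxy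
  have red : ∀ f : C →ₗ[ℂ] ℂ, f (m 0) = 0 → (∀ z, ω.form (l 0) z = 0 → f z = 0) →
      ∀ z, f z = 0 := by
    intro f h1 h2 z
    have h3 := h2 (z + ω.form (l 0) z • m 0) (by simp [F.lm])
    rwa [map_add, map_smul, h1, smul_zero, add_zero] at h3
  have h1 : ∀ z, η ![l 0, x, z] = 0 := by
    refine red (insertTwo η (l 0) x) ?_ fun z hz => hZ _ _ hvx hz
    rw [insertTwo_apply, threeForm_swap_one_two, ← ht, htx, neg_zero]
  have h2 : ∀ z, η ![l 0, y, z] = 0 := by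
    refine red (insertTwo η (l 0) y) ?_ fun z hz => hZ _ _ hvy hz
    rw [insertTwo_apply, threeForm_swap_one_two, ← ht, hxt y hxy, neg_zero]
  refine ⟨_, isTangentHyperplane_triple G.linearIndependent_left hvx hvy hxy h1 h2 ?_⟩
  refine red (insertTwo η x y) ?_ fun z hz => ?_
  · rw [insertTwo_apply, threeForm_swap_one_two, hxmy, neg_zero]
  -- Effectiveness trades the remaining components of η(x, y, ·) for components of η(v, x, ·) and
  -- η(v, y, ·), which are already zero.
  · have e1 := G.A_symm h6 hη 0 1
    have e2 := G.A_symm h6 hη 0 2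
    rw [update_zero, update_one] at e1
    rw [update_zero, update_two] at e2
    have e1' : η ![n 1, x, y] = η ![l 0, n 0, y] := e1
    have e2' : η ![n 2, x, y] = η ![l 0, x, n 0] := e2
    rw [threeForm_swap_one_two η (l 0) y (n 0), h2, neg_zero] at e1'
    rw [h1] at e2'
    have hz0 : ω.form z (l 0) = 0 := by rw [ω.neg_swap, hz, neg_zero]
    rw [G.expand' h6 z]
    simp only [map_add, map_smul]
    simp [insertTwo_apply, hz0, threeForm_rotate η (l 0) x y, threeForm_eq_zero_zero_two,
      threeForm_rotate η (n 1) x y, threeForm_rotate η (n 2) x y, e1', e2', h1,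
      threeForm_eq_zero_one_two]

omit [FiniteDimensional ℂ C] in
theorem linearIndependent_shear (F : IsFrame ω l m) (r s : ℂ) (hr : r ≠ 0) :
    LinearIndependent ℂ ![l 0, l 1, r • m 2 + s • l 2] := by
  rw [Fintype.linearIndependent_iff]
  intro g hg
  have h2 := congrArg (ω.form (l 2)) hg
  have h0 := congrArg (ω.form (m 0)) hg
  have h1 := congrArg (ω.form (m 1)) hg
  simp [Fin.sum_univ_three, F.ll, F.lm, F.ml, F.mm] at h0 h1 h2
  intro i
  fin_cases i
  · exact h0
  · exact h1
  · exact h2.resolve_right hr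

/-- If the moment form is degenerate, then the hyperplane `η` is tangent. -/
theorem exists_isTangentHyperplane_of_polar_eq_zero (h6 : Module.finrank ℂ C = 6)
    (e : Module.Basis (Fin 3 ⊕ Fin 3) ℂ C) {η : ThreeForm C} (hη : η ∈ effectiveForms ω)
    {v : C} (hv : v ≠ 0) (hrad : ∀ w, (momentForm ω e η).polarBilin v w = 0) :
    ∃ L, IsTangentHyperplane ω η L := by
  by_cases hZ : ∀ x y, ω.form v x = 0 → ω.form v y = 0 → η ![v, x, y] = 0
  · exact exists_isTangentHyperplane_of_insert_eq_zero h6 hη hv hZ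
  push Not at hZ
  obtain ⟨p, q, hp, hq, hpq⟩ := hZ
  -- The two-form η(v, ·, ·) on the four-dimensional quotient of the orthogonal of v by v is
  -- degenerate, because its Pfaffian is, up to a nonzero factor, the moment form at v.
  obtain ⟨x, hvx, hx, hker⟩ : ∃ x, ω.form v x = 0 ∧ x ∉ Submodule.span ℂ (Set.range ![v]) ∧
      ∀ z, ω.form v z = 0 → η ![v, x, z] = 0 := by
    obtain ⟨l, m, F, rfl⟩ := exists_isFrame_of_ne_zero ω h6 hv
    obtain ⟨κ, hκ, h⟩ := F.momentForm_polar h6 e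
    have h00 := (h η hη (l 0) (l 0)).symm
    rw [hrad] at h00
    simp [Fin.sum_univ_three, F.ll, F.ml, hκ, momentLL, cof] at h00
    have hA : ∀ i j, comp η l m i j = comp η l m j i := F.A_symm h6 hη
    -- This is the Gram matrix of η(v, ·, ·) on `l 1`, `l 2`, `m 1`, `m 2`. Its determinant is the
    -- square of the Pfaffian that vanishes by `h00`.
    have hG : Matrix.det !![0, η l, comp η l m 1 2, comp η l m 2 2;
        -η l, 0, -comp η l m 1 1, -comp η l m 1 2;
        -comp η l m 1 2, comp η l m 1 1, 0, comp η m l 0 0;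
        -comp η l m 2 2, comp η l m 1 2, -comp η m l 0 0, 0] = 0 := by
      rw [Matrix.det_succ_row_zero]
      simp [Fin.sum_univ_succ, Matrix.det_fin_three, Fin.succAbove]
      linear_combination (comp η l m 1 1 * comp η l m 2 2 - comp η l m 1 2 * comp η l m 1 2 -
        η l * comp η m l 0 0) * h00
    obtain ⟨c, hc, hGc⟩ := Matrix.exists_mulVec_eq_zero_iff.2 hG
    have g0 := congrFun hGc 0
    have g1 := congrFun hGc 1
    have g2 := congrFun hGc 2
    have g3 := congrFun hGc 3
    simp [Matrix.mulVec, dotProduct, Fin.sum_univ_four] at g0 g1 g2 g3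
    have e0 := F.eq_ofCoords h6 η
    change η = ofCoords ω l m (η l) (comp η l m) (comp η m l) (η m) at e0
    refine ⟨c 0 • l 1 + c 1 • l 2 + c 2 • m 1 + c 3 • m 2, by simp [F.ll, F.lm],
      notMem_span_singleton_of_form (ω := ω) (m := m 0) (by simp [F.ml]) (by simp [F.ml, F.mm]) ?_, ?_⟩
    · intro hx
      apply hc
      have k0 := congrArg (ω.form (m 1)) hx
      have k1 := congrArg (ω.form (m 2)) hx
      have k2 := congrArg (ω.form (l 1)) hx
      have k3 := congrArg (ω.form (l 2)) hx
      simp [F.ll, F.lm, F.ml, F.mm] at k0 k1 k2 k3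
      ext i
      fin_cases i <;> assumption
    · intro z hz
      have hz0 : ω.form z (l 0) = 0 := by rw [ω.neg_swap, hz, neg_zero]
      rw [e0]
      generalize comp η l m = A at *
      generalize comp η m l = B at *
      simp [ofCoords, tri_apply, Fin.sum_univ_three, F.ll, F.ml, F.mm, hz0, hA 2 1]
      linear_combination -(ω.form (m 1) z) * g0 - (ω.form (m 2) z) * g1
        - (ω.form z (l 1)) * g2 - (ω.form z (l 2)) * g3
  obtain ⟨y, w, hvy, hxy, hw, hyw⟩ : ∃ y w, ω.form v y = 0 ∧ ω.form x y = 0 ∧ ω.form v w = 0 ∧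
      η ![v, y, w] ≠ 0 := by
    by_contra! H
    apply hpq
    by_cases hxp : ω.form x p = 0
    · exact H p q hp hxp hq
    -- This combination of p and q is orthogonal to x, and inserting v and then pairing it with p
    -- recovers η(v, p, q) up to the factor -ω(x, p).
    · have h1 := H (ω.form x p • q - ω.form x q • p) p (by simp [hp, hq]) (by simp; ring) hp
      rw [sub_eq_add_neg, ← neg_smul, threeForm_add_one, threeForm_smul_one, threeForm_smul_one,
        threeForm_eq_zero_one_two, mul_zero, add_zero, threeForm_swap_one_two, mul_neg,
        neg_eq_zero] at h1
      exact (mul_eq_zero.1 h1).resolve_left hxp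
  have hy : y ∉ Submodule.span ℂ (Set.range ![v, x]) := by
    intro h
    rw [Submodule.mem_span_range_iff_exists_fun] at h
    obtain ⟨c, rfl⟩ := h
    apply hyw
    simp [Fin.sum_univ_two, threeForm_add_one, threeForm_smul_one, threeForm_eq_zero_zero_one,
      hker w hw]
  obtain ⟨m, F⟩ := exists_isFrame_triple ω hv hx hy hvx hvy hxy
  obtain ⟨l, hl⟩ : ∃ l, l = ![v, x, y] := ⟨_, rfl⟩
  rw [← hl] at F
  obtain rfl : l 0 = v := by rw [hl]; rfl
  obtain rfl : l 1 = x := by rw [hl]; rfl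
  obtain rfl : l 2 = y := by rw [hl]; rfl
  have h0 : η l = 0 := by rw [hl]; exact hker _ hvy
  have hm : ∀ j, j ≠ 0 → ω.form (l 0) (m j) = 0 := fun j hj => by rw [F.lm, if_neg hj.symm]
  have e0 := F.eq_ofCoords h6 η
  change η = ofCoords ω l m (η l) (comp η l m) (comp η m l) (η m) at e0
  have hA : ∀ i j, comp η l m i j = comp η l m j i := F.A_symm h6 hη
  have hB : ∀ i j, comp η m l i j = comp η m l j i := F.B_symm h6 hη
  have h21 : comp η l m 2 1 = 0 := by
    rw [comp, update_two]; exact hker _ (hm 1 (by decide))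
  have h22 : comp η l m 2 2 = 0 := by
    rw [comp, update_two]; exact hker _ (hm 2 (by decide))
  have h12 : comp η l m 1 2 = 0 := by rw [hA, h21]
  have h11 : comp η l m 1 1 ≠ 0 := by
    intro h11
    apply hyw
    have hw0 : ω.form w (l 0) = 0 := by rw [ω.neg_swap, hw, neg_zero]
    rw [e0]
    simp [ofCoords, tri_apply, Fin.sum_univ_three, F.ll, F.ml, hw0, h0, h11, h12]
  obtain ⟨κ, hκ, h⟩ := F.momentForm_polar h6 e
  have r1 := (h η hη (l 0) (l 2)).symm
  have r2 := (h η hη (l 0) (m 0)).symm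
  have r3 := (h η hη (l 0) (m 1)).symm
  rw [hrad] at r1 r2 r3
  simp [Fin.sum_univ_three, F.ll, F.ml, F.mm, hκ, momentLL, momentLM, cof, h0, h12, h11] at r1 r2 r3
  generalize comp η l m = A at *
  generalize comp η m l = B at *
  -- The scalar s is the slope of the point of tangency ⟨l 0, l 1, m 2 + s l 2⟩. The radical
  -- equations against `l 2`, `m 1` and `m 0` give A 0 2 = 0, B 0 1 and B 1 1 in terms of s and A.
  have b10 : B 0 0 = -(-B 0 0 / A 1 1) * A 1 1 := by field_simp
  generalize hs : -B 0 0 / A 1 1 = s at b10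
  rw [hA 2 0, r1, hA 2 1, h12, h22, hA 1 0] at r2
  have b01 : B 0 1 = s * A 0 1 := by
    apply mul_left_cancel₀ h11
    rw [hA 1 0, b10, hB 1 0] at r3
    linear_combination -r3
  have b11 : B 1 1 = - s * A 0 0 := by
    apply mul_left_cancel₀ h11
    rw [hB 1 0, b10] at r2
    linear_combination 2 * r2
  rw [e0, h0]
  refine ⟨_, isTangentHyperplane_triple (linearIndependent_shear F 1 s one_ne_zero)
    (F.ll _ _) (by simp [F.ll, F.lm]) (by simp [F.ll, F.lm]) ?_ ?_ ?_⟩ <;> intro z <;>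
  · simp [ofCoords, tri_apply, Fin.sum_univ_three, F.ll, F.ml, F.mm, hA 1 0, hA 2 0, hA 2 1, r1,
      h12, h22, hB 1 0, b10, b01, b11]
    try ring

end Degenerate

/-! ### Normal forms of tangent hyperplanes -/

section NormalForms

variable {C : Type*} [AddCommGroup C] [Module ℂ C] {ω : SymplecticForm C} {l m : Fin 3 → C}

/-- The three-form `x₁ ∧ y₁ ∧ y₂ + y₀ ∧ x₀ ∧ y₂` in the coordinates of a frame. -/
def goursatForm (ω : SymplecticForm C) (l m : Fin 3 → C) : ThreeForm C :=
  tri (ω.form (m 1)) (ω.form.flip (l 1)) (ω.form.flip (l 2))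
    + tri (ω.form.flip (l 0)) (ω.form (m 0)) (ω.form.flip (l 2))

theorem IsFrame.perm (F : IsFrame ω l m) (σ : Equiv.Perm (Fin 3)) : IsFrame ω (l ∘ σ) (m ∘ σ) where
  ll _ _ := F.ll _ _
  mm _ _ := F.mm _ _
  ml i j := by simp [F.ml]

omit [AddCommGroup C] [Module ℂ C] in
theorem range_comp_perm (l : Fin 3 → C) (σ : Equiv.Perm (Fin 3)) :
    Set.range (l ∘ σ) = Set.range l := σ.surjective.range_comp l

variable [FiniteDimensional ℂ C]

theorem IsTangentHyperplane.exists_frame (h6 : Module.finrank ℂ C = 6) {η : ThreeForm C}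
    (hη : η ∈ effectiveForms ω) {L : Submodule ℂ C} (hL : IsTangentHyperplane ω η L) {v : C}
    (hv : v ≠ 0) (hvL : v ∈ L) :
    ∃ l m, IsFrame ω l m ∧ l 0 = v ∧ Submodule.span ℂ (Set.range l) = L ∧
      η = ofCoords ω l m 0 0 (comp η m l) (η m) := by
  obtain ⟨l, m, F, h0, rfl⟩ := exists_isFrame_of_isLagrangian hL.1.1 hv hvL
  obtain ⟨ha, hA⟩ := F.of_isTangentHyperplane h6 hη hL
  refine ⟨l, m, F, h0, rfl, ?_⟩
  have e := F.eq_ofCoords h6 η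
  simp only [ha, hA] at e
  exact e

omit [FiniteDimensional ℂ C] in
-- A null vector of B contracts to zero with η: when a = 0 and A = 0, contraction with a vector of L
-- involves only B.
theorem IsFrame.ofCoords_sum (F : IsFrame ω l m) (B : Fin 3 → Fin 3 → ℂ) (d : ℂ) {c : Fin 3 → ℂ}
    (hc : ∀ i, B i 0 * c 0 + B i 1 * c 1 + B i 2 * c 2 = 0) (x y : C) :
    ofCoords ω l m 0 0 B d ![x, y, c 0 • l 0 + c 1 • l 1 + c 2 • l 2] = 0 := by
  simp [ofCoords, tri_apply, Fin.sum_univ_three, F.ll, F.ml]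
  linear_combination (ω.form x (l 1) * ω.form y (l 2) - ω.form x (l 2) * ω.form y (l 1)) * hc 0
    - (ω.form x (l 0) * ω.form y (l 2) - ω.form x (l 2) * ω.form y (l 0)) * hc 1
    + (ω.form x (l 0) * ω.form y (l 1) - ω.form x (l 1) * ω.form y (l 0)) * hc 2

omit [FiniteDimensional ℂ C] in
theorem comp_eq_zero_of_forall {η : ThreeForm C} {j : Fin 3} (h : ∀ x y, η ![x, y, l j] = 0)
    (i : Fin 3) : comp η m l i j = 0 := by
  have hi : i = 0 ∨ i = 1 ∨ i = 2 := by omega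
  rcases hi with rfl | rfl | rfl
  · rw [comp, update_zero, ← threeForm_rotate, h]
  · rw [comp, update_one, threeForm_swap_one_two, h, neg_zero]
  · rw [comp, update_two, h]

/-- A nondegenerate binary quadratic form splits into two linear factors, and the isotropic lines
give a basis, normalized to determinant one. The mixed value is nonzero because its square is q² -
pr. -/
theorem exists_isotropic_pair {p q r : ℂ} (h : q * q - p * r ≠ 0) :
    ∃ α β γ δ : ℂ, α * δ - β * γ = 1 ∧ p * α * α + 2 * q * α * β + r * β * β = 0 ∧
      p * γ * γ + 2 * q * γ * δ + r * δ * δ = 0 ∧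
      p * α * γ + q * (α * δ + β * γ) + r * β * δ ≠ 0 := by
  suffices H : ∃ α β γ δ : ℂ, α * δ - β * γ = 1 ∧ p * α * α + 2 * q * α * β + r * β * β = 0 ∧
      p * γ * γ + 2 * q * γ * δ + r * δ * δ = 0 by
    obtain ⟨α, β, γ, δ, h1, h2, h3⟩ := H
    refine ⟨α, β, γ, δ, h1, h2, h3, fun h4 => h ?_⟩
    linear_combination (-(q * q - p * r) * (α * δ - β * γ + 1)) * h1
      - (p * γ * γ + 2 * q * γ * δ + r * δ * δ) * h2
      + (p * α * γ + q * (α * δ + β * γ) + r * β * δ) * h4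
  by_cases hp : p = 0
  · have hq : q ≠ 0 := by
      rintro rfl
      simp [hp] at h
    refine ⟨1, 0, -r / (2 * q), 1, by ring, by simp [hp], ?_⟩
    rw [hp]
    field_simp
    ring
  · obtain ⟨s, hs⟩ : ∃ s : ℂ, s ^ 2 = q * q - p * r := IsAlgClosed.exists_pow_nat_eq _ (by norm_num)
    have hs0 : s ≠ 0 := by
      rintro rfl
      apply h
      rw [← hs]
      ring
    -- The vectors (-q + s, p) and (-q - s, p) are the two roots; the second is divided by 2sp, the
    -- determinant of the pair.
    refine ⟨-q + s, p, (-q - s) / (2 * s * p), 1 / (2 * s), by field_simp; ring, ?_, ?_⟩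
    · linear_combination p * hs
    · field_simp
      linear_combination hs

omit [FiniteDimensional ℂ C] in
theorem IsFrame.linearIndependent_lagrangianForm (F : IsFrame ω l m) {b d : ℂ}
    (h : b ≠ 0 ∨ d ≠ 0) : LinearIndependent ℂ ![b • m 0 - d • l 0, l 1, l 2] := by
  rw [Fintype.linearIndependent_iff]
  intro g hg
  have h0 := congrArg (ω.form (l 0)) hg
  have h0' := congrArg (ω.form (m 0)) hg
  have h1 := congrArg (ω.form (m 1)) hg
  have h2 := congrArg (ω.form (m 2)) hg
  simp [Fin.sum_univ_three, F.ll, F.lm, F.ml, F.mm] at h0 h0' h1 h2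
  intro i
  fin_cases i
  · rcases h with h | h
    · exact h0.resolve_right h
    · exact h0'.resolve_right h
  · exact h1
  · exact h2

/-- The form `η` belongs to the cone over `X*`. -/
def IsLagrangianForm (ω : SymplecticForm C) (η : ThreeForm C) : Prop :=
  ∃ (L : Submodule ℂ C) (l : Fin 3 → C), IsLagrangian ω L ∧ LinearIndependent ℂ l ∧
    Submodule.span ℂ (Set.range l) = L ∧
    ∀ u : Fin 3 → C, η u = Matrix.det fun i j => ω.form (l i) (u j)

/-- When only B 0 0 and d survive, the form is decomposable: (B₀₀ x₀ + d y₀) ∧ y₁ ∧ y₂. The three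
factors correspond through ω to B₀₀ m 0 - d l 0, -l 1 and -l 2; the two signs cancel in the
determinant. -/
theorem IsFrame.isLagrangianForm (F : IsFrame ω l m) {B : Fin 3 → Fin 3 → ℂ} {d : ℂ}
    (hB : ∀ i j, i ≠ 0 ∨ j ≠ 0 → B i j = 0) (h : ofCoords ω l m 0 0 B d ≠ 0) :
    IsLagrangianForm ω (ofCoords ω l m 0 0 B d) := by
  have e : ofCoords ω l m 0 0 B d = B 0 0 • tri (ω.form (m 0)) (ω.form.flip (l 1))
      (ω.form.flip (l 2)) + d • tri (ω.form.flip (l 0)) (ω.form.flip (l 1)) (ω.form.flip (l 2)) := by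
    simp [ofCoords, Fin.sum_univ_three, hB]
  have h' : B 0 0 ≠ 0 ∨ d ≠ 0 := by
    by_contra! H
    apply h
    rw [e, H.1, H.2]
    simp
  have hl := F.linearIndependent_lagrangianForm h'
  refine ⟨_, _, isLagrangian_span hl fun i j => ?_, hl, rfl, fun u => ?_⟩
  · fin_cases i <;> fin_cases j <;> simp [F.ll, F.lm, F.ml, F.mm]
    ring
  · change _ = Matrix.det (Matrix.of fun i j => _)
    rw [e, Matrix.det_fin_three]
    simp [tri_apply, ω.neg_swap (l _) (u _)]
    ring

/-- Classification of the tangent hyperplanes of the Lagrangian Grassmannian. -/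
theorem IsTangentHyperplane.cases (h6 : Module.finrank ℂ C = 6) {η : ThreeForm C}
    (hη : η ∈ effectiveForms ω) (hη0 : η ≠ 0) {L : Submodule ℂ C}
    (hL : IsTangentHyperplane ω η L) :
    (∃ l m B d, IsFrame ω l m ∧ (∀ i j, B i j = B j i) ∧ (Matrix.of B).det ≠ 0 ∧
      η = ofCoords ω l m 0 0 B d) ∨
    (∃ (l m : Fin 3 → C) (b : ℂ), IsFrame ω l m ∧ b ≠ 0 ∧ η = b • goursatForm ω l m) ∨
    IsLagrangianForm ω η := by
  obtain ⟨v, hvL, hv⟩ := hL.1.1.exists_mem_ne_zero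
  obtain ⟨l, m, F, -, hl, e⟩ := hL.exists_frame h6 hη hv hvL
  by_cases hdet : (Matrix.of (comp η m l)).det ≠ 0
  · exact Or.inl ⟨l, m, comp η m l, η m, F, F.B_symm h6 hη, hdet, e⟩
  right
  -- A null vector of B gives u in L that annihilates η. It becomes the third vector of a new frame,
  -- so that the last row and column of B vanish.
  obtain ⟨c, hc, hBc⟩ := Matrix.exists_mulVec_eq_zero_iff.2 (not_not.1 hdet)
  have hBc' : ∀ i, comp η m l i 0 * c 0 + comp η m l i 1 * c 1 + comp η m l i 2 * c 2 = 0 := by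
    intro i
    have := congrFun hBc i
    simpa [Matrix.mulVec, dotProduct, Fin.sum_univ_three] using this
  have hu := F.ofCoords_sum (comp η m l) (η m) hBc'
  rw [← e] at hu
  obtain ⟨u, hu'⟩ : ∃ u, u = c 0 • l 0 + c 1 • l 1 + c 2 • l 2 := ⟨_, rfl⟩
  rw [← hu'] at hu
  have hu0 : u ≠ 0 := by
    rintro rfl
    apply hc
    have := Fintype.linearIndependent_iff.1 F.linearIndependent_left c
      (by rw [Fin.sum_univ_three, ← hu'])
    exact funext this
  have huL : u ∈ L := by
    rw [← hl, hu', Submodule.mem_span_range_iff_exists_fun]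
    exact ⟨c, by rw [Fin.sum_univ_three]⟩
  clear hBc hBc' hu' hc c hdet e hl F l m
  obtain ⟨l', m', F', rfl, hl', -⟩ := hL.exists_frame h6 hη hu0 huL
  obtain ⟨l, hl⟩ : ∃ l, l = l' ∘ Equiv.swap 0 2 := ⟨_, rfl⟩
  obtain ⟨m, hm⟩ : ∃ m, m = m' ∘ Equiv.swap 0 2 := ⟨_, rfl⟩
  have F := F'.perm (Equiv.swap 0 2)
  rw [← hl, ← hm] at F
  have h2 : l' 0 = l 2 := by rw [hl]; simp
  rw [h2] at hu
  have hlL : Submodule.span ℂ (Set.range l) = L := by rw [hl, range_comp_perm, hl']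
  clear huL hu0 hl' h2 F' hl hm
  obtain ⟨ha, hA⟩ := F.of_isTangentHyperplane h6 hη (hlL ▸ hL)
  have e := F.eq_ofCoords h6 η
  simp only [ha, hA] at e
  change η = ofCoords ω l m 0 0 (comp η m l) (η m) at e
  have hB : ∀ i j, comp η m l i j = comp η m l j i := F.B_symm h6 hη
  have hB2 : ∀ i, comp η m l i 2 = 0 := comp_eq_zero_of_forall hu
  have hB2' : ∀ i, comp η m l 2 i = 0 := fun i => by rw [hB, hB2]
  by_cases hdet : comp η m l 0 1 * comp η m l 0 1 - comp η m l 0 0 * comp η m l 1 1 = 0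
  · right
    -- The remaining 2 × 2 block also has a null vector. With two independent annihilators as `k 1`
    -- and `k 2`, only one entry of B is left.
    obtain ⟨c, hc, hBc⟩ : ∃ c : Fin 2 → ℂ, c ≠ 0 ∧ Matrix.mulVec !![comp η m l 0 0, comp η m l 0 1;
        comp η m l 1 0, comp η m l 1 1] c = 0 := by
      apply Matrix.exists_mulVec_eq_zero_iff.2
      rw [Matrix.det_fin_two_of, hB 1 0]
      linear_combination -hdet
    have g0 := congrFun hBc 0
    have g1 := congrFun hBc 1
    simp [Matrix.mulVec, dotProduct, Fin.sum_univ_two] at g0 g1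
    obtain ⟨u, hu'⟩ : ∃ u, u = c 0 • l 0 + c 1 • l 1 := ⟨_, rfl⟩
    have hu1 : ∀ x y, η ![x, y, u] = 0 := by
      intro x y
      have := F.ofCoords_sum (comp η m l) (η m) (c := ![c 0, c 1, 0]) (by
        intro i
        have hi : i = 0 ∨ i = 1 ∨ i = 2 := by omega
        rcases hi with rfl | rfl | rfl <;> simp [g0, g1, hB2']) x y
      rw [← e] at this
      simpa [hu'] using this
    have hu0 : u ≠ 0 := by
      rintro rfl
      apply hc
      have k0 := congrArg (ω.form (m 0)) hu'
      have k1 := congrArg (ω.form (m 1)) hu'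
      simp [F.ml] at k0 k1
      ext i
      fin_cases i
      · exact k0.symm
      · exact k1.symm
    have huL : u ∈ L := by
      rw [← hlL, hu', Submodule.mem_span_range_iff_exists_fun]
      exact ⟨![c 0, c 1, 0], by simp [Fin.sum_univ_three]⟩
    have hl2L : l 2 ∈ L := by
      rw [← hlL]; exact Submodule.subset_span ⟨2, rfl⟩
    have hu2 : u ∉ Submodule.span ℂ (Set.range ![l 2]) :=
      notMem_span_singleton_of_form (m := m 2) (ω := ω) (by simp [F.ml]) (by simp [hu', F.ml]) hu0
    obtain ⟨y, hyL, hy⟩ := exists_mem_notMem_span L ![l 2, u] (by rw [hL.1.1.1]; norm_num)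
    obtain ⟨n', G'⟩ := exists_isFrame_triple ω (F.linearIndependent_left.ne_zero 2) hu2 hy
      (hL.1.1.2 _ hl2L _ huL) (hL.1.1.2 _ hl2L _ hyL) (hL.1.1.2 _ huL _ hyL)
    have G := G'.perm (Equiv.swap 0 2)
    obtain ⟨k, hk⟩ : ∃ k, k = ![l 2, u, y] ∘ Equiv.swap 0 2 := ⟨_, rfl⟩
    generalize n' ∘ Equiv.swap 0 2 = n at G
    rw [← hk] at G
    have hk1 : k 1 = u := by rw [hk]; rfl
    have hk2 : k 2 = l 2 := by rw [hk]; simp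
    have hkL : Submodule.span ℂ (Set.range k) = L := by
      apply Submodule.eq_of_le_of_finrank_eq
      · rw [Submodule.span_le, hk, range_comp_perm]
        rintro _ ⟨i, rfl⟩
        fin_cases i <;> assumption
      · rw [G.isLagrangian.1, hL.1.1.1]
    obtain ⟨ha, hA⟩ := G.of_isTangentHyperplane h6 hη (hkL ▸ hL)
    have e := G.eq_ofCoords h6 η
    simp only [ha, hA] at e
    change η = ofCoords ω k n 0 0 (comp η n k) (η n) at e
    suffices H : IsLagrangianForm ω (ofCoords ω k n 0 0 (comp η n k) (η n)) by rwa [← e] at H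
    refine G.isLagrangianForm (fun i j hij => ?_) (e ▸ hη0)
    have z : ∀ i j, j ≠ 0 → comp η n k i j = 0 := by
      intro i j hj
      apply comp_eq_zero_of_forall
      have hj' : j = 1 ∨ j = 2 := by omega
      rcases hj' with rfl | rfl
      · rwa [hk1]
      · rwa [hk2]
    rcases hij with hi | hj
    · rw [show comp η n k i j = comp η n k j i from G.B_symm h6 hη i j, z _ _ hi]
    · exact z _ _ hj
  · left
    -- A basis of isotropic vectors of the nondegenerate 2 × 2 block makes it antidiagonal, with
    -- entry b.
    obtain ⟨α, β, γ, δ, h1, i1, i2, hb⟩ := exists_isotropic_pair hdet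
    generalize comp η m l = B at *
    generalize η m = d at *
    obtain ⟨b, hb'⟩ : ∃ b, b = B 0 0 * α * γ + B 0 1 * (α * δ + β * γ) + B 1 1 * β * δ := ⟨_, rfl⟩
    rw [← hb'] at hb
    -- A shear of `m` by s times the vectors of L changes d into d + 2sb; this s removes it.
    obtain ⟨s, hs⟩ : ∃ s, s = - d / (2 * b) := ⟨_, rfl⟩
    have hs' : d = - s * b * 2 := by rw [hs]; field_simp
    have hll : ∀ i j, ω.form (![α • l 0 + β • l 1, γ • l 0 + δ • l 1, l 2] i)
        (![α • l 0 + β • l 1, γ • l 0 + δ • l 1, l 2] j) = 0 := by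
      intro i j
      fin_cases i <;> fin_cases j <;> simp [F.ll]
    have G : IsFrame ω ![α • l 0 + β • l 1, γ • l 0 + δ • l 1, l 2]
        ![δ • m 0 - γ • m 1 + s • (γ • l 0 + δ • l 1), -β • m 0 + α • m 1 + s • (α • l 0 + β • l 1),
          m 2] := by
      refine ⟨hll, fun i j => ?_, fun i j => ?_⟩
      · fin_cases i <;> fin_cases j <;> simp [F.ll, F.mm, F.ml, F.lm] <;> ring
      · fin_cases i <;> fin_cases j <;> simp [F.ll, F.mm, F.ml, F.lm] <;>
          first | ring1 | linear_combination h1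
    obtain ⟨l', hl'⟩ : ∃ l', l' = ![α • l 0 + β • l 1, γ • l 0 + δ • l 1, l 2] := ⟨_, rfl⟩
    obtain ⟨m', hm'⟩ : ∃ m', m' = ![δ • m 0 - γ • m 1 + s • (γ • l 0 + δ • l 1),
      -β • m 0 + α • m 1 + s • (α • l 0 + β • l 1), m 2] := ⟨_, rfl⟩
    rw [← hl', ← hm'] at G
    refine ⟨l', m', b, G, hb, ?_⟩
    have hlL' : Submodule.span ℂ (Set.range l') = L := by
      apply Submodule.eq_of_le_of_finrank_eq
      · have mem : ∀ i, l i ∈ L := fun i => hlL ▸ Submodule.subset_span ⟨i, rfl⟩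
        rw [Submodule.span_le, hl']
        rintro _ ⟨i, rfl⟩
        fin_cases i
        · exact L.add_mem (L.smul_mem _ (mem 0)) (L.smul_mem _ (mem 1))
        · exact L.add_mem (L.smul_mem _ (mem 0)) (L.smul_mem _ (mem 1))
        · exact mem 2
      · rw [G.isLagrangian.1, hL.1.1.1]
    obtain ⟨ha', hA'⟩ := G.of_isTangentHyperplane h6 hη (hlL' ▸ hL)
    have e' := G.eq_ofCoords h6 η
    simp only [ha', hA'] at e'
    change η = ofCoords ω l' m' 0 0 (comp η m' l') (η m') at e'
    have c2 : ∀ i, comp η m' l' i 2 = 0 := comp_eq_zero_of_forall (by rw [hl']; exact hu)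
    have cs : ∀ i j, comp η m' l' i j = comp η m' l' j i := G.B_symm h6 hη
    have c00 : comp η m' l' 0 0 = 0 := by
      rw [comp, update_zero, e]
      simp [hl', hm', ofCoords, tri_apply, Fin.sum_univ_three, F.ll, F.ml, F.mm, hB2, hB2', hB 1 0]
      linear_combination i1
    have c11 : comp η m' l' 1 1 = 0 := by
      rw [comp, update_one, e]
      simp [hl', hm', ofCoords, tri_apply, Fin.sum_univ_three, F.ll, F.ml, F.mm, hB2, hB2', hB 1 0]
      linear_combination i2
    have c01 : comp η m' l' 0 1 = b := by
      rw [comp, update_zero, e]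
      simp [hl', hm', ofCoords, tri_apply, Fin.sum_univ_three, F.ll, F.ml, F.mm, hB2, hB2', hB 1 0]
      linear_combination -hb'
    have cd : η m' = 0 := by
      rw [e]
      simp [hl', hm', ofCoords, tri_apply, Fin.sum_univ_three, F.ll, F.ml, F.mm, hB2, hB2', hB 1 0]
      linear_combination -2 * s * hb' + hs' + d * h1
    rw [e']
    simp [ofCoords, goursatForm, Fin.sum_univ_three, c2, cs 2, c00, c11, c01, cs 1 0, cd, add_comm]

end NormalForms

/-! ### Polynomial functions -/

section PolyFun

variable {E : Type*} [AddCommGroup E] [Module ℂ E]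

theorem linear_mem_polyFun (f : E →ₗ[ℂ] ℂ) : (f : E → ℂ) ∈ polyFun E :=
  Algebra.subset_adjoin ⟨f, rfl⟩

/-- The polynomial dependence of the differential on the base point is what later allows its
vanishing to pass to a limit. -/
theorem polyFun_hasDerivAt {f : E → ℂ} (hf : f ∈ polyFun E) : ∃ D : E → E →ₗ[ℂ] ℂ,
    (∀ p w, HasDerivAt (fun t : ℂ => f (p + t • w)) (D p w) 0) ∧
      ∀ w, (fun p => D p w) ∈ polyFun E := by
  induction hf using Algebra.adjoin_induction with
  | mem f hf =>
    obtain ⟨f, rfl⟩ := hf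
    refine ⟨fun _ => f, fun p w => ?_, fun w => (polyFun E).algebraMap_mem (f w)⟩
    have h := ((hasDerivAt_id (0 : ℂ)).mul_const (f w)).const_add (f p)
    simpa using h
  | algebraMap c =>
    exact ⟨fun _ => 0, fun p w => hasDerivAt_const 0 c, fun w => (polyFun E).zero_mem⟩
  | add f g hf hg ihf ihg =>
    obtain ⟨Df, h1, h2⟩ := ihf
    obtain ⟨Dg, k1, k2⟩ := ihg
    exact ⟨fun p => Df p + Dg p, fun p w => (h1 p w).add (k1 p w),
      fun w => (polyFun E).add_mem (h2 w) (k2 w)⟩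
  | mul f g hf hg ihf ihg =>
    obtain ⟨Df, h1, h2⟩ := ihf
    obtain ⟨Dg, k1, k2⟩ := ihg
    refine ⟨fun p => g p • Df p + f p • Dg p, fun p w => ?_, fun w => ?_⟩
    · have h := (h1 p w).mul (k1 p w)
      have e : p + (0 : ℂ) • w = p := by simp
      rw [e] at h
      have e' : (g p • Df p + f p • Dg p) w = Df p w * g p + f p * Dg p w := by
        simp [mul_comm]
      rw [e']
      exact h
    · exact (polyFun E).add_mem ((polyFun E).mul_mem hg (h2 w)) ((polyFun E).mul_mem hf (k2 w))

theorem polyFun_continuous {f : E → ℂ} (hf : f ∈ polyFun E) (p w : E) :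
    Continuous fun t : ℂ => f (p + t • w) := by
  induction hf using Algebra.adjoin_induction with
  | mem f hf =>
    obtain ⟨f, rfl⟩ := hf
    change Continuous fun t : ℂ => f (p + t • w)
    simp only [map_add, map_smul, smul_eq_mul]
    fun_prop
  | algebraMap c => exact continuous_const
  | add f g hf hg ihf ihg => exact ihf.add ihg
  | mul f g hf hg ihf ihg => exact ihf.mul ihg

/-- The complement of a finite set is dense in ℂ, and a polynomial restricted to a line is
continuous. This is the limit argument for Zariski closures and singular loci. -/
theorem polyFun_eq_zero_of_ne {f : E → ℂ} (hf : f ∈ polyFun E) {p w : E} {S : Set ℂ}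
    (hS : S.Finite) (h : ∀ t ∉ S, f (p + t • w) = 0) : f p = 0 := by
  have h1 := (polyFun_continuous hf p w).ext_on (Set.Countable.dense_compl ℂ hS.countable)
    continuous_const (g := fun _ => (0 : ℂ)) fun t ht => h t ht
  simpa using congrFun h1 0

theorem quadraticForm_mem_polyFun [FiniteDimensional ℂ E] (Q : QuadraticForm ℂ E) :
    (Q : E → ℂ) ∈ polyFun E := by
  have h : (Q : E → ℂ) = ∑ i, ((Module.finBasis ℂ E).coord i : E → ℂ) *
      (QuadraticMap.associated Q (Module.finBasis ℂ E i) : E → ℂ) := by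
    ext v
    rw [← QuadraticMap.associated_eq_self_apply ℂ Q v]
    conv_lhs => enter [1]; rw [← (Module.finBasis ℂ E).sum_repr v]
    rw [map_sum, LinearMap.sum_apply, Finset.sum_apply]
    simp
  rw [h]
  exact (polyFun E).sum_mem fun i _ =>
    (polyFun E).mul_mem (linear_mem_polyFun _) (linear_mem_polyFun _)

theorem isHomogPoly_linear (f : E →ₗ[ℂ] ℂ) : IsHomogPoly (f : E → ℂ) :=
  ⟨linear_mem_polyFun f, 1, fun t v => by simp⟩

theorem isHomogPoly_quadraticForm [FiniteDimensional ℂ E] (Q : QuadraticForm ℂ E) :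
    IsHomogPoly (Q : E → ℂ) :=
  ⟨quadraticForm_mem_polyFun Q, 2, fun t v => by rw [QuadraticMap.map_smul, smul_eq_mul, sq]⟩

theorem IsHomogPoly.eq_zero_of_smul {f : E → ℂ} (hf : IsHomogPoly f) {v : E} {a : ℂ} (ha : a ≠ 0)
    (h : f (a • v) = 0) : f v = 0 := by
  obtain ⟨-, d, hd⟩ := hf
  rw [hd] at h
  exact (mul_eq_zero.1 h).resolve_left (pow_ne_zero _ ha)

theorem exists_rep_eq_smul (v : E) (hv : v ≠ 0) :
    ∃ a : ℂ, a ≠ 0 ∧ (Projectivization.mk ℂ v hv).rep = a • v := by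
  obtain ⟨a, ha⟩ := Projectivization.exists_smul_eq_mk_rep ℂ v hv
  exact ⟨a, a.ne_zero, ha.symm⟩

theorem VanishesOn.eq_zero {f : E → ℂ} {Z : Set (ℙ ℂ E)} (h : VanishesOn f Z) (hf : IsHomogPoly f)
    {v : E} (hv : v ≠ 0) (hZ : Projectivization.mk ℂ v hv ∈ Z) : f v = 0 := by
  obtain ⟨a, ha, e⟩ := exists_rep_eq_smul v hv
  have := h _ hZ
  rw [e] at this
  exact hf.eq_zero_of_smul ha this

theorem mk_mem_singularLocus {Z : Set (ℙ ℂ E)} {v : E} (hv : v ≠ 0) :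
    Projectivization.mk ℂ v hv ∈ singularLocus Z ↔ Projectivization.mk ℂ v hv ∈ Z ∧
      ∀ f : E → ℂ, IsHomogPoly f → VanishesOn f Z →
        ∀ w : E, deriv (fun t : ℂ => f (v + t • w)) 0 = 0 := by
  obtain ⟨a, ha, e⟩ := exists_rep_eq_smul v hv
  refine and_congr_right fun _ => forall_congr' fun f => forall_congr' fun hf =>
    forall_congr' fun _ => ?_
  rw [e]
  obtain ⟨-, d, hd⟩ := hf
  have key : ∀ w : E, deriv (fun t : ℂ => f (a • v + t • a • w)) 0
      = a ^ d * deriv (fun t : ℂ => f (v + t • w)) 0 := by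
    intro w
    rw [← deriv_const_mul_field]
    congr 1
    ext t
    rw [← hd, smul_add, smul_comm a t w]
  constructor
  · intro h w
    have := h (a • w)
    rw [key] at this
    exact (mul_eq_zero.1 this).resolve_left (pow_ne_zero _ ha)
  · intro h w
    have := key (a⁻¹ • w)
    rw [h, mul_zero, smul_inv_smul₀ ha] at this
    exact this

theorem deriv_quadraticForm (Q : QuadraticForm ℂ E) (v w : E) :
    deriv (fun t : ℂ => Q (v + t • w)) 0 = Q.polarBilin v w := by
  have h : (fun t : ℂ => Q (v + t • w)) = fun t => Q v + t ^ 2 * Q w + t * Q.polarBilin v w := by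
    ext t
    rw [QuadraticMap.map_add Q, QuadraticMap.map_smul, QuadraticMap.polarBilin_apply_apply,
      QuadraticMap.polar_smul_right]
    simp [sq]
  rw [h]
  have h1 := (((hasDerivAt_pow 2 (0 : ℂ)).mul_const (Q w)).const_add (Q v)).add
    ((hasDerivAt_id' (0 : ℂ)).mul_const (Q.polarBilin v w))
  refine HasDerivAt.deriv ?_
  convert h1 using 1
  · rfl
  · simp

end PolyFun

/-! ### Irreducibility of quadratic forms -/

section Irreducible

variable {E : Type*} [AddCommGroup E] [Module ℂ E] {ι : Type*} [Fintype ι]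

theorem eval_quadPoly (e : Module.Basis ι ℂ E) (Q : QuadraticForm ℂ E) (x : ι → ℂ) :
    MvPolynomial.eval x (quadPoly e Q) = Q (∑ i, x i • e i) := by
  rw [← QuadraticMap.associated_eq_self_apply ℂ Q, quadPoly]
  simp [Finset.mul_sum]
  rw [Finset.sum_comm]
  refine Finset.sum_congr rfl fun i _ => Finset.sum_congr rfl fun j _ => ?_
  change _ = x i * (x j * QuadraticMap.associated Q (e j) (e i))
  ring

theorem quadPoly_isHomogeneous (e : Module.Basis ι ℂ E) (Q : QuadraticForm ℂ E) :
    (quadPoly e Q).IsHomogeneous 2 := by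
  refine MvPolynomial.IsHomogeneous.sum _ _ _ fun i _ =>
    MvPolynomial.IsHomogeneous.sum _ _ _ fun j _ => ?_
  exact ((MvPolynomial.isHomogeneous_X _ i).C_mul _).mul (MvPolynomial.isHomogeneous_X _ j)

omit [Fintype ι] in
theorem exists_eval_of_totalDegree_one {f : MvPolynomial ι ℂ} (hf : f.totalDegree = 1) :
    ∃ (c : ℂ) (φ : (ι → ℂ) →ₗ[ℂ] ℂ), ∀ x, MvPolynomial.eval x f = c + φ x := by
  have h1 : ∀ g ∈ MvPolynomial.homogeneousSubmodule ι ℂ 1, ∃ φ : (ι → ℂ) →ₗ[ℂ] ℂ,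
      ∀ x, MvPolynomial.eval x g = φ x := by
    rw [MvPolynomial.homogeneousSubmodule_one_eq_span_X]
    intro g hg
    induction hg using Submodule.span_induction with
    | mem g hg =>
      obtain ⟨i, rfl⟩ := hg
      exact ⟨LinearMap.proj i, fun x => by simp⟩
    | zero => exact ⟨0, fun x => by simp⟩
    | add g h _ _ ihg ihh =>
      obtain ⟨φ, hφ⟩ := ihg
      obtain ⟨ψ, hψ⟩ := ihh
      exact ⟨φ + ψ, fun x => by simp [hφ, hψ]⟩
    | smul a g _ ih =>
      obtain ⟨φ, hφ⟩ := ih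
      exact ⟨a • φ, fun x => by simp [hφ]⟩
  obtain ⟨φ, hφ⟩ := h1 _ (MvPolynomial.homogeneousComponent_isHomogeneous 1 f)
  refine ⟨MvPolynomial.coeff 0 f, φ, fun x => ?_⟩
  conv_lhs => rw [← MvPolynomial.sum_homogeneousComponent f, hf]
  simp [Finset.sum_range_succ, hφ, MvPolynomial.homogeneousComponent_zero]

/-- The factors are affine and need not be assumed homogeneous: Q(0) = 0 kills the product of the
constants, and polarization gives φ(v) ψ + ψ(v) φ, so the range is spanned by two functionals. -/
theorem quadRank_le_two_of_mul (e : Module.Basis ι ℂ E) {Q : QuadraticForm ℂ E}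
    {f g : MvPolynomial ι ℂ} (hfg : quadPoly e Q = f * g) (hf : f.totalDegree = 1)
    (hg : g.totalDegree = 1) : quadRank Q ≤ 2 := by
  obtain ⟨a, φ, hφ⟩ := exists_eval_of_totalDegree_one hf
  obtain ⟨b, ψ, hψ⟩ := exists_eval_of_totalDegree_one hg
  have h1 : ∀ v, Q v = (a + φ (e.equivFun v)) * (b + ψ (e.equivFun v)) := by
    intro v
    rw [← hφ, ← hψ, ← map_mul, ← hfg, eval_quadPoly]
    congr 1
    exact (e.sum_equivFun v).symm
  have h0 := h1 0
  have hd : ∀ v, Q.polarBilin v = φ (e.equivFun v) • (ψ ∘ₗ e.equivFun.toLinearMap) +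
      ψ (e.equivFun v) • (φ ∘ₗ e.equivFun.toLinearMap) := by
    intro v
    ext w
    rw [QuadraticMap.polarBilin_apply_apply, QuadraticMap.polar, h1, h1, h1]
    simp only [map_zero, add_zero] at h0
    simp
    linear_combination h0
  have hle : LinearMap.range Q.polarBilin ≤ Submodule.span ℂ (Set.range
      ![ψ ∘ₗ e.equivFun.toLinearMap, φ ∘ₗ e.equivFun.toLinearMap]) := by
    rintro _ ⟨v, rfl⟩
    rw [hd, Submodule.mem_span_range_iff_exists_fun]
    exact ⟨![φ (e.equivFun v), ψ (e.equivFun v)], by simp⟩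
  have : FiniteDimensional ℂ (Submodule.span ℂ (Set.range
      ![ψ ∘ₗ e.equivFun.toLinearMap, φ ∘ₗ e.equivFun.toLinearMap])) :=
    FiniteDimensional.span_of_finite ℂ (Set.finite_range _)
  exact (Submodule.finrank_mono hle).trans (finrank_range_le_card (R := ℂ) _)

theorem quadPoly_ne_zero (e : Module.Basis ι ℂ E) {Q : QuadraticForm ℂ E} (hQ : quadRank Q ≠ 0) :
    quadPoly e Q ≠ 0 := by
  intro h
  apply hQ
  have h1 : Q.polarBilin = 0 := by
    have h2 : ∀ v, Q v = 0 := fun v => by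
      have := eval_quadPoly e Q (e.equivFun v)
      rw [h, map_zero, e.sum_equivFun] at this
      exact this.symm
    ext v w
    simp [QuadraticMap.polar, h2]
  rw [quadRank, h1, LinearMap.range_zero, finrank_bot]

/-- Degrees add up to two in a factorization, so two non-units would both have degree one and force
rank at most two. -/
theorem irreducible_quadPoly (e : Module.Basis ι ℂ E) {Q : QuadraticForm ℂ E}
    (hQ : 3 ≤ quadRank Q) : Irreducible (quadPoly e Q) := by
  have h0 : quadPoly e Q ≠ 0 := quadPoly_ne_zero e (by omega)
  have hdeg := (quadPoly_isHomogeneous e Q).totalDegree h0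
  have unit : ∀ f : MvPolynomial ι ℂ, f ≠ 0 → f.totalDegree = 0 → IsUnit f := by
    intro f hf h
    rw [MvPolynomial.totalDegree_eq_zero_iff_eq_C] at h
    rw [h] at hf ⊢
    exact (IsUnit.mk0 _ fun h' => hf (by rw [h', map_zero])).map MvPolynomial.C
  refine ⟨fun h => ?_, fun f g hfg => ?_⟩
  · have := (MvPolynomial.isUnit_iff_totalDegree_of_isReduced.1 h).2
    omega
  · have hf : f ≠ 0 := by rintro rfl; simp [hfg] at h0
    have hg : g ≠ 0 := by rintro rfl; simp [hfg] at h0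
    rw [hfg, MvPolynomial.totalDegree_mul_of_isDomain hf hg] at hdeg
    rcases Nat.eq_zero_or_pos f.totalDegree with h | h
    · exact Or.inl (unit f hf h)
    rcases Nat.eq_zero_or_pos g.totalDegree with h' | h'
    · exact Or.inr (unit g hg h')
    have := quadRank_le_two_of_mul e hfg (by omega) (by omega)
    omega

theorem not_irreducible_quadPoly (e : Module.Basis ι ℂ E) {Q : QuadraticForm ℂ E}
    (f : E →ₗ[ℂ] ℂ) (c : ℂ) (hQ : ∀ v, Q v = c * (f v * f v)) : ¬ Irreducible (quadPoly e Q) := by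
  obtain ⟨H, hH⟩ : ∃ H : MvPolynomial ι ℂ, H = ∑ i, MvPolynomial.C (f (e i)) * MvPolynomial.X i :=
    ⟨_, rfl⟩
  have hhom : H.IsHomogeneous 1 := by
    rw [hH]
    exact MvPolynomial.IsHomogeneous.sum _ _ _ fun i _ => (MvPolynomial.isHomogeneous_X _ i).C_mul _
  have key : quadPoly e Q = (MvPolynomial.C c * H) * H := by
    apply MvPolynomial.funext
    intro x
    rw [eval_quadPoly, hQ, hH]
    simp [mul_comm]
    ring
  intro h
  have hnu : ∀ G : MvPolynomial ι ℂ, G.IsHomogeneous 1 → ¬ IsUnit G := by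
    intro G hG hu
    have h1 := (MvPolynomial.isUnit_iff_totalDegree_of_isReduced.1 hu).2
    have := hG.totalDegree hu.ne_zero
    omega
  rcases h.isUnit_or_isUnit key with h1 | h1
  · exact hnu _ (hhom.C_mul c) h1
  · exact hnu _ hhom h1

end Irreducible

/-! ### The cocharacteristic variety is a quadric -/

section Closure

variable {C : Type*} [AddCommGroup C] [Module ℂ C] {ω : SymplecticForm C} {l m : Fin 3 → C}

/-- The three-form `ω(v, ·) ∧ η(v, ·, ·)`, evaluated at `u`. -/
def wedgeInsert (ω : SymplecticForm C) (η : ThreeForm C) (v : C) (u : Fin 3 → C) : ℂ :=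
  ω.form v (u 0) * η ![v, u 1, u 2] - ω.form v (u 1) * η ![v, u 0, u 2]
    + ω.form v (u 2) * η ![v, u 0, u 1]

/-- The vectors ω(v, a) b - ω(v, b) a are orthogonal to v, so ω(v, a) times the wedge vanishes for
each argument a. If the wedge were nonzero, all three factors ω(v, u i) would vanish, and with them
the wedge. -/
theorem wedgeInsert_eq_zero {η : ThreeForm C} {v : C}
    (h : ∀ x y, ω.form v x = 0 → ω.form v y = 0 → η ![v, x, y] = 0) (u : Fin 3 → C) :
    wedgeInsert ω η v u = 0 := by
  have key : ∀ a b c : C, ω.form v a * (ω.form v a * η ![v, b, c] - ω.form v b * η ![v, a, c]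
      + ω.form v c * η ![v, a, b]) = 0 := by
    intro a b c
    have h1 := h (ω.form v a • b + (-ω.form v b) • a) (ω.form v a • c + (-ω.form v c) • a)
      (by simp; ring) (by simp; ring)
    simp only [threeForm_add_one, threeForm_add_two, threeForm_smul_one, threeForm_smul_two,
      threeForm_eq_zero_one_two, threeForm_swap_one_two η v a b] at h1
    linear_combination h1
  have k0 := key (u 0) (u 1) (u 2)
  have k1 := key (u 1) (u 0) (u 2)
  have k2 := key (u 2) (u 0) (u 1)
  rw [threeForm_swap_one_two η v (u 0) (u 1)] at k1
  rw [threeForm_swap_one_two η v (u 0) (u 2), threeForm_swap_one_two η v (u 1) (u 2)] at k2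
  by_contra hg
  have s0 : ω.form v (u 0) = 0 := (mul_eq_zero.1 k0).resolve_right hg
  have s1 : ω.form v (u 1) = 0 := (mul_eq_zero.1 k1).resolve_right fun h => hg (by
    rw [wedgeInsert]; linear_combination -h)
  have s2 : ω.form v (u 2) = 0 := (mul_eq_zero.1 k2).resolve_right fun h => hg (by
    rw [wedgeInsert]; linear_combination h)
  apply hg
  rw [wedgeInsert, s0, s1, s2]
  ring

theorem wedgeInsert_add_smul (η : ThreeForm C) (v w : C) (u : Fin 3 → C) :
    ∃ b : ℂ, ∀ t : ℂ, wedgeInsert ω η (v + t • w) u =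
      wedgeInsert ω η v u + t * b + t ^ 2 * wedgeInsert ω η w u := by
  refine ⟨ω.form v (u 0) * η ![w, u 1, u 2] - ω.form v (u 1) * η ![w, u 0, u 2]
    + ω.form v (u 2) * η ![w, u 0, u 1] + (ω.form w (u 0) * η ![v, u 1, u 2]
      - ω.form w (u 1) * η ![v, u 0, u 2] + ω.form w (u 2) * η ![v, u 0, u 1]), fun t => ?_⟩
  simp only [wedgeInsert, threeForm_add_zero, threeForm_smul_zero, map_add, map_smul,
    LinearMap.add_apply, LinearMap.smul_apply, smul_eq_mul]
  ring

theorem finite_wedgeInsert_eq_zero {η : ThreeForm C} {w : C} {u : Fin 3 → C}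
    (hw : wedgeInsert ω η w u ≠ 0) (v : C) :
    {t : ℂ | wedgeInsert ω η (v + t • w) u = 0}.Finite := by
  obtain ⟨b, hb⟩ := wedgeInsert_add_smul (ω := ω) η v w u
  obtain ⟨P, hP⟩ : ∃ P : Polynomial ℂ, P = Polynomial.C (wedgeInsert ω η w u) * Polynomial.X ^ 2 +
    Polynomial.C b * Polynomial.X + Polynomial.C (wedgeInsert ω η v u) := ⟨_, rfl⟩
  have hP0 : P ≠ 0 := by
    rintro rfl
    have h2 := congrArg (Polynomial.coeff · 2) hP
    simp at h2
    exact hw h2.symm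
  refine P.roots.toFinset.finite_toSet.subset fun t ht => ?_
  rw [Set.mem_ofPred_eq, hb] at ht
  rw [Finset.mem_coe, Multiset.mem_toFinset, Polynomial.mem_roots hP0, Polynomial.IsRoot, hP]
  simp
  linear_combination ht

theorem exists_sum_mul_ne_zero {B : Fin 3 → Fin 3 → ℂ} (hB : ∀ i j, B i j = B j i) (h : B ≠ 0) :
    ∃ c : Fin 3 → ℂ, ∑ i, ∑ j, c i * c j * B i j ≠ 0 := by
  by_contra! H
  apply h
  have d0 := H ![1, 0, 0]
  have d1 := H ![0, 1, 0]
  have d2 := H ![0, 0, 1]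
  have d01 := H ![1, 1, 0]
  have d02 := H ![1, 0, 1]
  have d12 := H ![0, 1, 1]
  simp [Fin.sum_univ_three, hB 1 0, hB 2 0, hB 2 1] at d0 d1 d2 d01 d02 d12
  rw [d0, d1] at d01
  rw [d0, d2] at d02
  rw [d1, d2] at d12
  have e01 : B 0 1 = 0 := by linear_combination d01 / 2
  have e02 : B 0 2 = 0 := by linear_combination d02 / 2
  have e12 : B 1 2 = 0 := by linear_combination d12 / 2
  ext i j
  fin_cases i <;> fin_cases j <;> simp [hB 1 0, hB 2 0, hB 2 1, d0, d1, d2, e01, e02, e12]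

theorem IsFrame.form_eq_sum (F : IsFrame ω l m) (h6 : Module.finrank ℂ C = 6) (u v : C) :
    ω.form u v = ∑ i, (ω.form (m i) u * ω.form (l i) v + ω.form u (l i) * ω.form (m i) v) := by
  conv_lhs => rw [F.expand' h6 u]
  simp only [map_add, map_smul, LinearMap.add_apply, LinearMap.smul_apply, smul_eq_mul,
    Fin.sum_univ_three]
  ring

variable [FiniteDimensional ℂ C]

/-- If the hyperplane `η` is tangent, then the radical of its moment form contains a vector `w` such
that `η(w, ·, ·)` does not vanish on the orthogonal of `w`. -/
theorem IsTangentHyperplane.exists_polar_eq_zero (h6 : Module.finrank ℂ C = 6)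
    (e : Module.Basis (Fin 3 ⊕ Fin 3) ℂ C) {η : ThreeForm C}
    (hη : η ∈ effectiveForms ω) (hη0 : η ≠ 0) {L : Submodule ℂ C}
    (hL : IsTangentHyperplane ω η L) :
    ∃ w u, (momentForm ω e η).polarBilin w = 0 ∧ wedgeInsert ω η w u ≠ 0 := by
  obtain ⟨v, hvL, hv⟩ := hL.1.1.exists_mem_ne_zero
  obtain ⟨l, m, F, -, rfl, e0⟩ := hL.exists_frame h6 hη hv hvL
  obtain ⟨ha, hA⟩ := F.of_isTangentHyperplane h6 hη hL
  have hA' : comp η l m = 0 := by ext i j; exact hA i j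
  have hB : ∀ i j, comp η m l i j = comp η m l j i := F.B_symm h6 hη
  obtain ⟨κ, -, h⟩ := F.momentForm_polar h6 e
  replace h := h η hη
  rw [ha, hA'] at h
  by_cases h0 : comp η m l = 0
  -- With B = 0 the moment form is zero and η = d y₀ ∧ y₁ ∧ y₂; the wedge takes the value d, nonzero
  -- because η is.
  · refine ⟨m 0, ![l 0, m 1, m 2], ?_, ?_⟩
    · ext y
      rw [h, h0]
      simp [momentLL, momentLM, cof, Fin.sum_univ_three]
    · rw [wedgeInsert, e0, h0]
      simp [ofCoords, tri_apply, F.ml, F.mm]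
      intro hd
      apply hη0
      rw [e0, h0, hd]
      simp [ofCoords]
  · obtain ⟨c, hc⟩ := exists_sum_mul_ne_zero hB h0
    -- All of L is in the radical when a = 0 and A = 0. The wedge at this vector, evaluated on `m`,
    -- is minus the value of the quadratic form B at c.
    refine ⟨∑ i, c i • l i, m, ?_, ?_⟩
    · ext y
      rw [h]
      simp [momentLL, momentLM, cof, F.ll, Fin.sum_univ_three]
    · rw [wedgeInsert, e0]
      simp [ofCoords, tri_apply, F.ml, F.mm, F.ll, F.lm, Fin.sum_univ_three]
      intro hd
      apply hc
      simp [Fin.sum_univ_three]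
      linear_combination -hd

/-- The cocharacteristic variety is cut out by the moment form. -/
theorem cocharacteristic_eq (h6 : Module.finrank ℂ C = 6) (e : Module.Basis (Fin 3 ⊕ Fin 3) ℂ C)
    {η : ThreeForm C} (hη : η ∈ effectiveForms ω) (hη0 : η ≠ 0) :
    cocharacteristic ω η = quadric (momentForm ω e η) := by
  obtain ⟨Q, hQ⟩ : ∃ Q, Q = momentForm ω e η := ⟨_, rfl⟩
  have mem : ∀ (q : ℙ ℂ C) (x y : C), Q q.rep = 0 → ω.form q.rep x = 0 → η ![q.rep, x, y] ≠ 0 →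
      q ∈ ⋃ L ∈ smoothPoints ω η, cocharacteristicAt ω η L := by
    intro q x y hq hx hy
    obtain ⟨l, m, F, h0, hl, hL⟩ := exists_frame_mem_smoothPoints h6 hη hx hy
    exact Set.mem_biUnion hL (F.mem_cocharacteristicAt h6 e hη hl h0.symm (hQ ▸ hq))
  refine Set.Subset.antisymm (fun p hp => ?_) fun p hp f hf hv => ?_
  · refine hp _ (isHomogPoly_quadraticForm _) fun q hq => ?_
    simp only [Set.mem_iUnion] at hq
    obtain ⟨L, hL, hq⟩ := hq
    exact cocharacteristicAt_subset h6 e hη hL.1 hq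
  · replace hp : Q p.rep = 0 := hQ ▸ hp
    by_cases hZ : ∃ x y, ω.form p.rep x = 0 ∧ η ![p.rep, x, y] ≠ 0
    · obtain ⟨x, y, hx, hy⟩ := hZ
      exact hv p (mem p x y hp hx hy)
    push Not at hZ
    obtain ⟨L, hL⟩ := exists_isTangentHyperplane_of_insert_eq_zero h6 hη p.rep_nonzero
      fun x y hx _ => hZ x y hx
    -- As w is in the radical, p + tw remains on the quadric; for all but finitely many t it lies on
    -- a smooth point of the equation. A polynomial that vanishes at these points vanishes at p.
    obtain ⟨w, u, hw, hu⟩ := hL.exists_polar_eq_zero h6 e hη hη0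
    rw [← hQ] at hw
    refine polyFun_eq_zero_of_ne hf.1 (w := w) (finite_wedgeInsert_eq_zero hu p.rep) fun t ht => ?_
    obtain ⟨x, y, hx, hy⟩ : ∃ x y, ω.form (p.rep + t • w) x = 0 ∧ η ![p.rep + t • w, x, y] ≠ 0 := by
      by_contra! H
      exact ht (wedgeInsert_eq_zero (fun x y hx _ => H x y hx) u)
    have hne : p.rep + t • w ≠ 0 := by
      intro h
      rw [h] at hy
      exact hy (η.map_coord_zero 0 rfl)
    have hQw : Q w = 0 := by
      have := congrArg (fun g => g w) hw
      simpa [QuadraticMap.polar_self] using this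
    have hQt : Q (p.rep + t • w) = 0 := by
      rw [QuadraticMap.map_add Q, QuadraticMap.map_smul, QuadraticMap.polar_comm,
        QuadraticMap.polar_smul_left, ← QuadraticMap.polarBilin_apply_apply, hw, hp, hQw]
      simp
    obtain ⟨a, ha, hr⟩ := exists_rep_eq_smul _ hne
    refine hv.eq_zero hf hne (mem _ x y ?_ ?_ ?_)
    · rw [hr, QuadraticMap.map_smul, hQt, smul_zero]
    · rw [hr, map_smul, LinearMap.smul_apply, hx, smul_zero]
    · rw [hr, threeForm_smul_zero]
      exact mul_ne_zero ha hy

end Closure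

/-! ### Singular loci of quadrics -/

section Quadrics

variable {E : Type*} [AddCommGroup E] [Module ℂ E]

theorem IsHomogPoly.map_zero {f : E → ℂ} (hf : IsHomogPoly f) {v : E} (hv : f v = 0) : f 0 = 0 := by
  obtain ⟨-, d, hd⟩ := hf
  simpa [hv] using hd 0 v

theorem exists_quadratic_root {a b c : ℂ} (h : b ≠ 0 ∨ c ≠ 0) :
    ∃ t : ℂ, a + t * b + t ^ 2 * c = 0 := by
  by_cases hc : c = 0
  · have hb := h.resolve_right (not_not.2 hc)
    refine ⟨-a / b, ?_⟩
    rw [hc]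
    field_simp
    ring
  · obtain ⟨s, hs⟩ : ∃ s : ℂ, s ^ 2 = b * b - 4 * a * c :=
      IsAlgClosed.exists_pow_nat_eq _ (by norm_num)
    refine ⟨(-b + s) / (2 * c), ?_⟩
    field_simp
    linear_combination hs

theorem quadraticForm_add_smul (Q : QuadraticForm ℂ E) (v w : E) (t : ℂ) :
    Q (v + t • w) = Q v + t * Q.polarBilin v w + t ^ 2 * Q w := by
  rw [QuadraticMap.map_add Q, QuadraticMap.map_smul, QuadraticMap.polarBilin_apply_apply,
    QuadraticMap.polar_smul_right]
  simp only [smul_eq_mul]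
  ring

theorem polarBilin_self (Q : QuadraticForm ℂ E) (v : E) : Q.polarBilin v v = 2 * Q v := by
  rw [QuadraticMap.polarBilin_apply_apply, QuadraticMap.polar_self, two_nsmul, two_mul]

/-- A linear functional that vanishes on all isotropic vectors of a quadratic form of rank at
least two is zero. -/
theorem eq_zero_of_isotropic {Q : QuadraticForm ℂ E} (hQ : 2 ≤ quadRank Q) {φ : E →ₗ[ℂ] ℂ}
    (h : ∀ w, Q w = 0 → φ w = 0) : φ = 0 := by
  by_contra hφ
  obtain ⟨a, ha⟩ : ∃ a, φ a ≠ 0 := by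
    by_contra! H
    exact hφ (LinearMap.ext H)
  -- If t ↦ Q(a + tb) were nonconstant, a root t would give an isotropic vector with φ(a + tb) =
  -- φ(a) ≠ 0. So the kernel of φ is in the radical, and the rank is at most one.
  have key : ∀ b, φ b = 0 → Q.polarBilin a b = 0 ∧ Q b = 0 := by
    intro b hb
    by_contra H
    rw [not_and_or] at H
    obtain ⟨t, ht⟩ := exists_quadratic_root (a := Q a) H
    rw [← quadraticForm_add_smul] at ht
    have := h _ ht
    rw [map_add, map_smul, hb, smul_zero, add_zero] at this
    exact ha this
  have hle : LinearMap.range Q.polarBilin ≤ Submodule.span ℂ {φ} := by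
    rintro _ ⟨v, rfl⟩
    rw [Submodule.mem_span_singleton]
    refine ⟨φ v / (φ a * φ a) * (2 * Q a), ?_⟩
    have dec : ∀ u : E, ∃ b, φ b = 0 ∧ u = (φ u / φ a) • a + b := fun u =>
      ⟨u - (φ u / φ a) • a, by simp [ha], by abel⟩
    ext w
    obtain ⟨b, hb, hv⟩ := dec v
    obtain ⟨c, hc, hw⟩ := dec w
    have hbc : Q.polarBilin b c = 0 := by
      rw [QuadraticMap.polarBilin_apply_apply, QuadraticMap.polar, (key _ hb).2, (key _ hc).2,
        (key (b + c) (by rw [map_add, hb, hc, add_zero])).2]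
      ring
    have hba : Q.polarBilin b a = 0 := by
      rw [QuadraticMap.polarBilin_apply_apply, QuadraticMap.polar_comm]
      exact (key b hb).1
    have e1 : Q.polarBilin v w = φ v / φ a * (φ w / φ a * (2 * Q a)) := by
      conv_lhs => rw [hv, hw]
      simp only [map_add, map_smul, LinearMap.add_apply, LinearMap.smul_apply, polarBilin_self,
        (key c hc).1, hba, hbc, smul_eq_mul]
      ring
    rw [e1, LinearMap.smul_apply, smul_eq_mul]
    field_simp
  have : FiniteDimensional ℂ (Submodule.span ℂ {φ}) := FiniteDimensional.span_singleton ℂ φ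
  have h1 := (Submodule.finrank_mono hle).trans (finrank_span_singleton hφ).le
  rw [quadRank] at hQ
  omega

variable [FiniteDimensional ℂ E]

theorem quadRank_add_finrank_radical (Q : QuadraticForm ℂ E) :
    quadRank Q + Module.finrank ℂ (radical Q) = Module.finrank ℂ E :=
  LinearMap.finrank_range_add_finrank_ker _

theorem singularLocus_quadric_subset (Q : QuadraticForm ℂ E) :
    singularLocus (quadric Q) ⊆ projSubspace (radical Q) := by
  rintro p ⟨-, h⟩
  have := h Q (isHomogPoly_quadraticForm Q) fun _ hq => hq
  simp only [deriv_quadraticForm] at this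
  exact LinearMap.mem_ker.2 (LinearMap.ext this)

/-- No generator of the vanishing ideal is needed. Through a point of the radical every isotropic
direction stays in the quadric, so the differential of any vanishing polynomial kills all isotropic
vectors, hence is zero. Rank one must be excluded: there the reduced variety is a hyperplane. -/
theorem singularLocus_quadric {Q : QuadraticForm ℂ E} (hQ : 2 ≤ quadRank Q) :
    singularLocus (quadric Q) = projSubspace (radical Q) := by
  refine (singularLocus_quadric_subset Q).antisymm fun p hp => ?_
  have hp' : Q.polarBilin p.rep = 0 := hp
  have hQp : Q p.rep = 0 := by
    have := polarBilin_self Q p.rep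
    rw [hp'] at this
    simpa using this
  refine ⟨hQp, fun f hf hv w => ?_⟩
  obtain ⟨D, hD, -⟩ := polyFun_hasDerivAt hf.1
  have hD0 : D p.rep = 0 := by
    refine eq_zero_of_isotropic hQ fun u hu => ?_
    have h0 : ∀ t : ℂ, f (p.rep + t • u) = 0 := by
      intro t
      by_cases hne : p.rep + t • u = 0
      · rw [hne]
        exact hf.map_zero (hv p hQp)
      · refine hv.eq_zero hf hne ?_
        obtain ⟨a, -, ha⟩ := exists_rep_eq_smul _ hne
        change Q _ = 0
        rw [ha, QuadraticMap.map_smul, quadraticForm_add_smul, hQp, hu, hp']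
        simp
    have h1 := (hD p.rep u).deriv
    simp only [h0, deriv_const] at h1
    exact h1.symm
  rw [(hD p.rep w).deriv, hD0, LinearMap.zero_apply]

omit [FiniteDimensional ℂ E] in
theorem singularLocus_eq_empty_of_linear {f : E →ₗ[ℂ] ℂ} (hf : f ≠ 0) :
    singularLocus {p : ℙ ℂ E | f p.rep = 0} = ∅ := by
  refine Set.eq_empty_of_forall_notMem fun p hp => hf (LinearMap.ext fun w => ?_)
  have h1 := hp.2 f (isHomogPoly_linear f) (fun _ hq => hq) w
  have h2 : HasDerivAt (fun t : ℂ => f (p.rep + t • w)) (f w) 0 := by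
    have h := ((hasDerivAt_id (0 : ℂ)).mul_const (f w)).const_add (f p.rep)
    simpa using h
  rw [← h2.deriv, h1, LinearMap.zero_apply]

omit [FiniteDimensional ℂ E] in
theorem quadRank_eq_one {Q : QuadraticForm ℂ E} {f : E →ₗ[ℂ] ℂ} {c : ℂ} (hf : f ≠ 0) (hc : c ≠ 0)
    (hQ : ∀ v, Q v = c * (f v * f v)) : quadRank Q = 1 := by
  have h : ∀ v, Q.polarBilin v = (2 * c * f v) • f := by
    intro v
    ext w
    rw [QuadraticMap.polarBilin_apply_apply, QuadraticMap.polar, hQ, hQ, hQ, map_add,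
      LinearMap.smul_apply, smul_eq_mul]
    ring
  suffices H : LinearMap.range Q.polarBilin = Submodule.span ℂ {f} by
    rw [quadRank, H, finrank_span_singleton hf]
  refine le_antisymm ?_ ?_
  · rintro _ ⟨v, rfl⟩
    rw [h]
    exact Submodule.smul_mem _ _ (Submodule.mem_span_singleton_self f)
  · obtain ⟨a, ha⟩ : ∃ a, f a ≠ 0 := by
      by_contra! H
      exact hf (LinearMap.ext H)
    rw [Submodule.span_singleton_le_iff_mem]
    refine ⟨(2 * c * f a)⁻¹ • a, ?_⟩
    rw [map_smul, h, inv_smul_smul₀]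
    simp [ha, hc]

end Quadrics

/-! ### The moment form on the strata -/

section Strata

variable {C : Type*} [AddCommGroup C] [Module ℂ C] {ω : SymplecticForm C} {l m : Fin 3 → C}

namespace IsFrame

variable (F : IsFrame ω l m) (a d : ℂ) (A B : Fin 3 → Fin 3 → ℂ)
include F

theorem ofCoords_left : ofCoords ω l m a A B d l = a := by
  simp [ofCoords, tri_apply, Fin.sum_univ_three, F.ll, F.ml]

theorem ofCoords_right : ofCoords ω l m a A B d m = d := by
  simp [ofCoords, tri_apply, Fin.sum_univ_three, F.mm, F.ml]

theorem comp_ofCoords_left : comp (ofCoords ω l m a A B d) l m = A := by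
  ext i j
  have hi : i = 0 ∨ i = 1 ∨ i = 2 := by omega
  have hj : j = 0 ∨ j = 1 ∨ j = 2 := by omega
  rcases hi with rfl | rfl | rfl <;> rcases hj with rfl | rfl | rfl <;>
  simp [comp, ofCoords, tri_apply, Fin.sum_univ_three, F.ll, F.mm, F.ml, update_zero, update_one,
    update_two]

theorem comp_ofCoords_right : comp (ofCoords ω l m a A B d) m l = B := by
  ext i j
  have hi : i = 0 ∨ i = 1 ∨ i = 2 := by omega
  have hj : j = 0 ∨ j = 1 ∨ j = 2 := by omega
  rcases hi with rfl | rfl | rfl <;> rcases hj with rfl | rfl | rfl <;>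
  simp [comp, ofCoords, tri_apply, Fin.sum_univ_three, F.ll, F.mm, F.ml, update_zero, update_one,
    update_two]

end IsFrame

theorem smul_goursatForm (b : ℂ) : b • goursatForm ω l m =
    ofCoords ω l m 0 0 ![![0, b, 0], ![b, 0, 0], ![0, 0, 0]] 0 := by
  simp [ofCoords, goursatForm, Fin.sum_univ_three, add_comm]

theorem IsFrame.goursatForm_ne_zero (F : IsFrame ω l m) : goursatForm ω l m ≠ 0 := by
  intro h
  have := congrArg (fun η : ThreeForm C => η ![m 0, l 0, m 2]) h
  simp [goursatForm, tri_apply, F.ll, F.mm, F.ml] at this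

variable [FiniteDimensional ℂ C]

theorem momentForm_radical_eq_bot (h6 : Module.finrank ℂ C = 6)
    (e : Module.Basis (Fin 3 ⊕ Fin 3) ℂ C) {η : ThreeForm C} (hη : η ∈ effectiveForms ω)
    (h : ¬ ∃ L, IsTangentHyperplane ω η L) : radical (momentForm ω e η) = ⊥ := by
  rw [eq_bot_iff]
  intro v hv
  rw [Submodule.mem_bot]
  by_contra hv0
  exact h (exists_isTangentHyperplane_of_polar_eq_zero h6 e hη hv0 fun w => by
    have hv' : (momentForm ω e η).polarBilin v = 0 := hv
    rw [hv', LinearMap.zero_apply])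

theorem IsFrame.momentForm_polar_ofCoords (F : IsFrame ω l m) (h6 : Module.finrank ℂ C = 6)
    (e : Module.Basis (Fin 3 ⊕ Fin 3) ℂ C) : ∃ κ : ℂ, κ ≠ 0 ∧ ∀ (B : Fin 3 → Fin 3 → ℂ) (d : ℂ),
      (∀ i j, B i j = B j i) → ∀ v w, (momentForm ω e (ofCoords ω l m 0 0 B d)).polarBilin v w =
        κ * ∑ i, ∑ j, ω.form v (l i) * ω.form w (l j) * cof B i j := by
  obtain ⟨κ, hκ, h⟩ := F.momentForm_polar h6 e
  refine ⟨κ, hκ, fun B d hB v w => ?_⟩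
  rw [h _ (F.ofCoords_mem h6 0 d (A := 0) (fun _ _ => rfl) hB), F.ofCoords_left, F.ofCoords_right,
    F.comp_ofCoords_left, F.comp_ofCoords_right]
  congr 1
  refine Finset.sum_congr rfl fun i _ => Finset.sum_congr rfl fun j _ => ?_
  have : cof 0 i j = 0 := by fin_cases i <;> fin_cases j <;> simp [cof]
  simp [momentLL, momentLM, this]

/-- Only the block cof B in the coordinates along `m` is present. If det B ≠ 0 the cofactor matrix
is invertible, so these coordinates must vanish. -/
theorem IsFrame.radical_eq_span (F : IsFrame ω l m) (h6 : Module.finrank ℂ C = 6)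
    (e : Module.Basis (Fin 3 ⊕ Fin 3) ℂ C) {B : Fin 3 → Fin 3 → ℂ} {d : ℂ}
    (hB : ∀ i j, B i j = B j i) (hdet : (Matrix.of B).det ≠ 0) :
    radical (momentForm ω e (ofCoords ω l m 0 0 B d)) = Submodule.span ℂ (Set.range l) := by
  obtain ⟨κ, hκ, h⟩ := F.momentForm_polar_ofCoords h6 e
  have h' := h B d hB
  ext v
  rw [radical, LinearMap.mem_ker]
  constructor
  · intro hv
    have h1 : Matrix.vecMul (fun i => ω.form v (l i)) (Matrix.of B).adjugate = 0 := by
      rw [← cof_eq_adjugate hB]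
      ext j
      have := h' v (m j)
      rw [hv, LinearMap.zero_apply, zero_eq_mul] at this
      have := this.resolve_left hκ
      simpa [F.ml, Matrix.vecMul, dotProduct] using this
    have h2 := Matrix.eq_zero_of_vecMul_eq_zero
      (by rw [Matrix.det_adjugate]; exact pow_ne_zero _ hdet) h1
    rw [F.expand' h6 v]
    have h3 : ∀ i, ω.form v (l i) = 0 := fun i => congrFun h2 i
    simp only [h3, zero_smul, add_zero]
    have mem : ∀ i, l i ∈ Submodule.span ℂ (Set.range l) := fun i => Submodule.subset_span ⟨i, rfl⟩
    exact Submodule.add_mem _ (Submodule.add_mem _ (Submodule.smul_mem _ _ (mem 0))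
      (Submodule.smul_mem _ _ (mem 1))) (Submodule.smul_mem _ _ (mem 2))
  · intro hv
    have h3 : ∀ i, ω.form v (l i) = 0 := fun i =>
      F.isLagrangian.2 _ hv _ (Submodule.subset_span ⟨i, rfl⟩)
    ext w
    simp [h', h3]

/-- For B with the single antidiagonal pair b, the only nonzero cofactor is -b² at (2, 2). -/
theorem IsFrame.momentForm_goursatForm (F : IsFrame ω l m) (h6 : Module.finrank ℂ C = 6)
    (e : Module.Basis (Fin 3 ⊕ Fin 3) ℂ C) {b : ℂ} (hb : b ≠ 0) : ∃ c : ℂ, c ≠ 0 ∧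
      ∀ v, momentForm ω e (b • goursatForm ω l m) v =
        c * (ω.form.flip (l 2) v * ω.form.flip (l 2) v) := by
  obtain ⟨κ, hκ, h⟩ := F.momentForm_eq h6 e
  have hB : ∀ i j : Fin 3, (![![0, b, 0], ![b, 0, 0], ![0, 0, 0]] : Fin 3 → Fin 3 → ℂ) i j =
      (![![0, b, 0], ![b, 0, 0], ![0, 0, 0]] : Fin 3 → Fin 3 → ℂ) j i := by
    intro i j
    fin_cases i <;> fin_cases j <;> rfl
  replace h := h _ (F.ofCoords_mem h6 0 0 (A := 0) (fun _ _ => rfl) hB)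
  rw [F.ofCoords_left, F.ofCoords_right, F.comp_ofCoords_left, F.comp_ofCoords_right,
    ← smul_goursatForm] at h
  refine ⟨-κ * (b * b), by simp [hκ, hb], fun v => ?_⟩
  rw [h]
  simp [Fin.sum_univ_three, momentLL, momentLM, cof]
  ring

theorem IsLagrangianForm.exists_frame (h6 : Module.finrank ℂ C = 6) {η : ThreeForm C}
    (h : IsLagrangianForm ω η) : ∃ l m d, IsFrame ω l m ∧ η = ofCoords ω l m 0 0 0 d := by
  obtain ⟨L, l, hL, hl, rfl, hdet⟩ := h
  have hll : ∀ i j, ω.form (l i) (l j) = 0 := fun i j =>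
    hL.2 _ (Submodule.subset_span ⟨i, rfl⟩) _ (Submodule.subset_span ⟨j, rfl⟩)
  obtain ⟨m, F⟩ := exists_isFrame ω hl hll
  have hdet' : ∀ u : Fin 3 → C, η u = Matrix.det (Matrix.of fun i j => ω.form (l i) (u j)) := hdet
  simp only [Matrix.det_fin_three, Matrix.of_apply] at hdet'
  refine ⟨l, m, η m, F, (F.eq_ofCoords h6 η).trans ?_⟩
  have h0 : η l = 0 := by simp [hdet', F.ll]
  have hA : comp η l m = 0 := by
    ext i j
    have hi : i = 0 ∨ i = 1 ∨ i = 2 := by omega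
    rcases hi with rfl | rfl | rfl <;>
    simp [comp, update_zero, update_one, update_two, hdet', F.ll]
  have hB : comp η m l = 0 := by
    ext i j
    have hi : i = 0 ∨ i = 1 ∨ i = 2 := by omega
    rcases hi with rfl | rfl | rfl <;>
    simp [comp, update_zero, update_one, update_two, hdet', F.ll, F.lm]
  change ofCoords ω l m (η l) (comp η l m) (comp η m l) (η m) = _
  rw [h0, hA, hB]

theorem IsLagrangianForm.momentForm_eq_zero (h6 : Module.finrank ℂ C = 6)
    (e : Module.Basis (Fin 3 ⊕ Fin 3) ℂ C) {η : ThreeForm C} (h : IsLagrangianForm ω η) :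
    momentForm ω e η = 0 := by
  obtain ⟨l, m, d, F, rfl⟩ := h.exists_frame h6
  obtain ⟨κ, -, h⟩ := F.momentForm_eq h6 e
  ext v
  rw [h _ (F.ofCoords_mem h6 0 d (A := 0) (B := 0) (fun _ _ => rfl) fun _ _ => rfl),
    F.ofCoords_left, F.ofCoords_right, F.comp_ofCoords_left, F.comp_ofCoords_right]
  simp [Fin.sum_univ_three, momentLL, momentLM, cof]

end Strata

/-! ### The singular locus of the dual variety -/

section DualVariety

variable {C : Type*} [AddCommGroup C] [Module ℂ C] {ω : SymplecticForm C} {l m : Fin 3 → C}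

theorem IsTangentHyperplane.smul {η : ThreeForm C} {L : Submodule ℂ C}
    (h : IsTangentHyperplane ω η L) (c : ℂ) : IsTangentHyperplane ω (c • η) L := by
  refine ⟨⟨h.1.1, fun u hu => ?_⟩, fun t ht u => ?_⟩
  · rw [AlternatingMap.smul_apply, h.1.2 u hu, smul_zero]
  · have := h.2 t ht u
    simp only [symbol, AlternatingMap.smul_apply, ← Finset.smul_sum] at this ⊢
    rw [this, smul_zero]

theorem IsLagrangianForm.smul {η : ThreeForm C} (h : IsLagrangianForm ω η) {c : ℂ} (hc : c ≠ 0) :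
    IsLagrangianForm ω (c • η) := by
  obtain ⟨L, l, hL, hl, rfl, hdet⟩ := h
  have hll : ∀ i j, ω.form (l i) (l j) = 0 := fun i j =>
    hL.2 _ (Submodule.subset_span ⟨i, rfl⟩) _ (Submodule.subset_span ⟨j, rfl⟩)
  obtain ⟨w, hw⟩ : ∃ w : Fin 3 → ℂˣ, w = ![Units.mk0 c hc, 1, 1] := ⟨_, rfl⟩
  have hl' := hl.units_smul w
  refine ⟨_, _, isLagrangian_span hl' fun i j => ?_, hl', rfl, fun u => ?_⟩
  · simp [Units.smul_def, hll]
  · change _ = Matrix.det (Matrix.of fun i j => _)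
    have hdet' : ∀ u : Fin 3 → C, η u = Matrix.det (Matrix.of fun i j => ω.form (l i) (u j)) := hdet
    rw [AlternatingMap.smul_apply, hdet', Matrix.det_fin_three, Matrix.det_fin_three, hw]
    simp [Units.smul_def]
    ring

theorem ofCoords_add (a a' : ℂ) (A A' B B' : Fin 3 → Fin 3 → ℂ) (d d' : ℂ) :
    ofCoords ω l m a A B d + ofCoords ω l m a' A' B' d' =
      ofCoords ω l m (a + a') (A + A') (B + B') (d + d') := by
  ext u
  simp [ofCoords, Fin.sum_univ_three]
  ring

theorem smul_ofCoords (t a : ℂ) (A B : Fin 3 → Fin 3 → ℂ) (d : ℂ) :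
    t • ofCoords ω l m a A B d = ofCoords ω l m (t * a) (t • A) (t • B) (t * d) := by
  ext u
  simp [ofCoords, Fin.sum_univ_three]
  ring

/-- A change of the second half of a frame. -/
theorem IsFrame.shear (F : IsFrame ω l m) (s : ℂ) :
    IsFrame ω l ![m 0 + s • l 1, m 1 + s • l 0, m 2] := by
  refine ⟨F.ll, fun i j => ?_, fun i j => ?_⟩ <;>
  · fin_cases i <;> fin_cases j <;> simp [F.ll, F.mm, F.ml, F.lm]

variable [FiniteDimensional ℂ C]

theorem mk_mem_dualVariety {η : effectiveForms ω} (hη : η ≠ 0) :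
    Projectivization.mk ℂ η hη ∈ dualVariety ω ↔
      ∃ L, IsTangentHyperplane ω (η : ThreeForm C) L := by
  obtain ⟨a, ha, h⟩ := exists_rep_eq_smul η hη
  refine exists_congr fun L => ?_
  rw [h, Submodule.coe_smul]
  refine ⟨fun hL => ?_, fun hL => hL.smul a⟩
  have := hL.smul a⁻¹
  rwa [inv_smul_smul₀ ha] at this

theorem mk_mem_lagrangianForms {η : effectiveForms ω} (hη : η ≠ 0) :
    Projectivization.mk ℂ η hη ∈ lagrangianForms ω ↔ IsLagrangianForm ω (η : ThreeForm C) := by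
  obtain ⟨a, ha, h⟩ := exists_rep_eq_smul η hη
  change IsLagrangianForm ω ((Projectivization.mk ℂ η hη).rep : ThreeForm C) ↔ _
  rw [h, Submodule.coe_smul]
  refine ⟨fun hL => ?_, fun hL => hL.smul ha⟩
  have := hL.smul (inv_ne_zero ha)
  rwa [inv_smul_smul₀ ha] at this

theorem VanishesOn.eq_zero_of_isTangentHyperplane {f : effectiveForms ω → ℂ}
    (hv : VanishesOn f (dualVariety ω)) (hf : IsHomogPoly f) {η₀ : effectiveForms ω} (h₀ : η₀ ≠ 0)
    (hL₀ : ∃ L, IsTangentHyperplane ω (η₀ : ThreeForm C) L) {η : effectiveForms ω}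
    (hL : ∃ L, IsTangentHyperplane ω (η : ThreeForm C) L) : f η = 0 := by
  by_cases h : η = 0
  · rw [h]
    exact hf.map_zero (hv.eq_zero hf h₀ ((mk_mem_dualVariety h₀).2 hL₀))
  · exact hv.eq_zero hf h ((mk_mem_dualVariety h).2 hL)

/-- If `η + t w` is a tangent hyperplane for all `t`, then the differentials at `η` of the
polynomials that vanish on the dual variety are zero in the direction `w`. -/
theorem deriv_eq_zero_of_isTangentHyperplane {f : effectiveForms ω → ℂ}
    (hv : VanishesOn f (dualVariety ω)) (hf : IsHomogPoly f)
    {η : effectiveForms ω} (h : η ≠ 0) {w : effectiveForms ω}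
    (hL : ∀ t : ℂ, ∃ L, IsTangentHyperplane ω ((η : ThreeForm C) + t • (w : ThreeForm C)) L)
    {D : ℂ} (hD : HasDerivAt (fun t : ℂ => f (η + t • w)) D 0) : D = 0 := by
  have h0 : (fun t : ℂ => f (η + t • w)) = fun _ => 0 := by
    funext t
    refine hv.eq_zero_of_isTangentHyperplane hf h ?_ (hL t)
    simpa using hL 0
  rw [← hD.deriv, h0, deriv_const]

/-- The differentials at `b • goursatForm` of the polynomials that vanish on the dual variety are
zero. -/
theorem IsFrame.goursatForm_deriv_eq_zero (F : IsFrame ω l m) (h6 : Module.finrank ℂ C = 6) {b : ℂ}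
    (hb : b ≠ 0) {η : effectiveForms ω} (hη : (η : ThreeForm C) = b • goursatForm ω l m)
    {f : effectiveForms ω → ℂ} (hv : VanishesOn f (dualVariety ω)) (hf : IsHomogPoly f)
    {D : effectiveForms ω →ₗ[ℂ] ℂ}
    (hD : ∀ w, HasDerivAt (fun t : ℂ => f (η + t • w)) (D w) 0) : D = 0 := by
  have hη0 : η ≠ 0 := by
    rintro rfl
    exact smul_ne_zero hb F.goursatForm_ne_zero hη.symm
  have dir : ∀ w : effectiveForms ω,
      (∀ t : ℂ, ∃ L, IsTangentHyperplane ω (b • goursatForm ω l m + t • (w : ThreeForm C)) L) →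
      D w = 0 := fun w hw =>
    deriv_eq_zero_of_isTangentHyperplane hv hf hη0 (by rwa [hη]) (hD w)
  rw [smul_goursatForm] at dir
  obtain ⟨w, hw⟩ : ∃ w : ℂ → (Fin 3 → Fin 3 → ℂ) → (Fin 3 → Fin 3 → ℂ) → ℂ → ThreeForm C,
    w = ofCoords ω l m := ⟨_, rfl⟩
  have F' := F.symm
  have lin1 : LinearIndependent ℂ ![m 0, m 1, l 2] := by
    have := F.linearIndependent.comp ![Sum.inr 0, Sum.inr 1, Sum.inl 2] (by decide)
    convert this using 1
    ext i; fin_cases i <;> rfl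
  have lin2 : LinearIndependent ℂ ![l 0, m 1, l 2] := by
    have := F.linearIndependent.comp ![Sum.inl 0, Sum.inr 1, Sum.inl 2] (by decide)
    convert this using 1
    ext i; fin_cases i <;> rfl
  have lin3 : LinearIndependent ℂ ![m 0, l 1, l 2] := by
    have := F.linearIndependent.comp ![Sum.inr 0, Sum.inl 1, Sum.inl 2] (by decide)
    convert this using 1
    ext i; fin_cases i <;> rfl
  ext ⟨u, hu⟩
  have hA : ∀ i j, comp u l m i j = comp u l m j i := F.A_symm h6 hu
  have hB : ∀ i j, comp u m l i j = comp u m l j i := F.B_symm h6 hu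
  have eu : u = ofCoords ω l m (u l) (comp u l m) (comp u m l) (u m) := F.eq_ofCoords h6 u
  generalize comp u l m = A at *
  generalize comp u m l = B at *
  generalize u l = a at *
  generalize u m = d at *
  subst eu
  -- The direction is cut into five effective pieces. Adding any multiple t of one piece keeps the
  -- form tangent, respectively at ⟨l 0, l 1, l 2⟩, ⟨m 0, m 1, l 2⟩, ⟨l 0, m 1, l 2⟩, ⟨m 0, l 1, l
  -- 2⟩ and a plane that moves with t.
  have m1 := F.ofCoords_mem h6 0 d (A := 0) (fun _ _ => rfl) hB
  have m2 := F.ofCoords_mem h6 a 0 (A := ![![0, 0, A 0 2], ![0, 0, A 1 2], ![A 0 2, A 1 2, A 2 2]])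
    (B := 0) (by intro i j; fin_cases i <;> fin_cases j <;> rfl) (fun _ _ => rfl)
  have m3 := F.ofCoords_mem h6 0 0 (A := ![![A 0 0, 0, 0], ![0, 0, 0], ![0, 0, 0]])
    (B := 0) (by intro i j; fin_cases i <;> fin_cases j <;> rfl) (fun _ _ => rfl)
  have m4 := F.ofCoords_mem h6 0 0 (A := ![![0, 0, 0], ![0, A 1 1, 0], ![0, 0, 0]])
    (B := 0) (by intro i j; fin_cases i <;> fin_cases j <;> rfl) (fun _ _ => rfl)
  have m5 := F.ofCoords_mem h6 0 0 (A := ![![0, A 0 1, 0], ![A 0 1, 0, 0], ![0, 0, 0]])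
    (B := 0) (by intro i j; fin_cases i <;> fin_cases j <;> rfl) (fun _ _ => rfl)
  have d1 := dir ⟨_, m1⟩ fun t => ⟨_, by
    rw [smul_ofCoords, ofCoords_add]
    refine F.isTangentHyperplane h6 ?_ fun i j => ?_
    · rw [F.ofCoords_left]; simp
    · rw [← comp, F.comp_ofCoords_left]; simp⟩
  have d2 := dir ⟨_, m2⟩ fun t => ⟨_, by
    refine isTangentHyperplane_triple lin1 (F.mm _ _) (by simp [F.ml]) (by simp [F.ml]) ?_ ?_ ?_ <;>
    · intro z
      simp [ofCoords, tri_apply, Fin.sum_univ_three, F.ll, F.mm, F.ml]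
      try ring⟩
  have d3 := dir ⟨_, m3⟩ fun t => ⟨_, by
    refine isTangentHyperplane_triple lin2 (by simp [F.lm]) (F.ll _ _) (by simp [F.ml]) ?_ ?_ ?_ <;>
    · intro z
      simp [ofCoords, tri_apply, Fin.sum_univ_three, F.ll, F.mm, F.ml]
      try ring⟩
  have d4 := dir ⟨_, m4⟩ fun t => ⟨_, by
    refine isTangentHyperplane_triple lin3 (by simp [F.ml]) (by simp [F.ml]) (F.ll _ _) ?_ ?_ ?_ <;>
    · intro z
      simp [ofCoords, tri_apply, Fin.sum_univ_three, F.ll, F.mm, F.ml]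
      try ring⟩
  have d5 := dir ⟨_, m5⟩ fun t => by
    by_cases ht : t * A 0 1 = 0
    · refine ⟨_, F.isTangentHyperplane h6 ?_ fun i j => ?_⟩
      · rw [smul_ofCoords, ofCoords_add, F.ofCoords_left]; simp
      · rw [← comp, smul_ofCoords, ofCoords_add, F.comp_ofCoords_left]
        fin_cases i <;> fin_cases j <;> simp [mul_eq_zero.1 ht]
    -- The moving plane is ⟨l 0, l 1, (t A₀₁) m 2 + b l 2⟩.
    · refine ⟨_, isTangentHyperplane_triple (linearIndependent_shear F (t * A 0 1) b ht)
        (F.ll _ _) (by simp [F.ll, F.lm]) (by simp [F.ll, F.lm]) ?_ ?_ ?_⟩ <;>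
      · intro z
        simp [ofCoords, tri_apply, Fin.sum_univ_three, F.ll, F.mm, F.ml]
        try ring
  have sum : (⟨_, hu⟩ : effectiveForms ω) = ⟨_, m1⟩ + ⟨_, m2⟩ + ⟨_, m3⟩ + ⟨_, m4⟩ + ⟨_, m5⟩ := by
    ext1
    simp only [Submodule.coe_add, ofCoords_add]
    congr 1
    · simp
    · ext i j
      fin_cases i <;> fin_cases j <;> simp [hA 1 0, hA 2 0, hA 2 1]
    · simp
    · simp
  rw [sum, map_add, map_add, map_add, map_add, d1, d2, d3, d4, d5]
  simp

theorem goursatForm_mem_singularLocus (F : IsFrame ω l m) (h6 : Module.finrank ℂ C = 6) {b : ℂ}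
    (hb : b ≠ 0) {η : effectiveForms ω} (h0 : η ≠ 0)
    (hη : (η : ThreeForm C) = b • goursatForm ω l m) :
    Projectivization.mk ℂ η h0 ∈ singularLocus (dualVariety ω) := by
  refine (mk_mem_singularLocus h0).2 ⟨(mk_mem_dualVariety h0).2 ⟨_, F.isTangentHyperplane h6 ?_ ?_⟩,
    fun f hf hv w => ?_⟩
  · rw [hη, smul_goursatForm, F.ofCoords_left]
  · intro i j
    rw [hη, smul_goursatForm, ← comp, F.comp_ofCoords_left]
    rfl
  · obtain ⟨D, hD, -⟩ := polyFun_hasDerivAt hf.1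
    have := F.goursatForm_deriv_eq_zero h6 hb hη hv hf (hD η)
    rw [(hD η w).deriv, this, LinearMap.zero_apply]

/-- A form in the cone over X* is a limit of Goursat forms, where the differentials vanish by the
previous case. -/
theorem IsLagrangianForm.mem_singularLocus (h6 : Module.finrank ℂ C = 6) {η : effectiveForms ω}
    (h0 : η ≠ 0) (hη : IsLagrangianForm ω (η : ThreeForm C)) :
    Projectivization.mk ℂ η h0 ∈ singularLocus (dualVariety ω) := by
  obtain ⟨l, m, d, F, e⟩ := hη.exists_frame h6
  refine (mk_mem_singularLocus h0).2 ⟨(mk_mem_dualVariety h0).2 ⟨_, F.isTangentHyperplane h6 ?_ ?_⟩,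
    fun f hf hv w => ?_⟩
  · rw [e, F.ofCoords_left]
  · intro i j
    rw [e, ← comp, F.comp_ofCoords_left]
    rfl
  · obtain ⟨D, hD, hpoly⟩ := polyFun_hasDerivAt hf.1
    have hm := F.ofCoords_mem h6 0 0 (A := 0) (B := ![![0, 1, 0], ![1, 0, 0], ![0, 0, 0]])
      (fun _ _ => rfl) (by intro i j; fin_cases i <;> fin_cases j <;> rfl)
    rw [(hD η w).deriv]
    refine polyFun_eq_zero_of_ne (hpoly w) (w := ⟨_, hm⟩) (Set.finite_singleton (0 : ℂ))
      fun t ht => ?_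
    -- For t ≠ 0 the perturbed form is t times the Goursat form of the frame sheared by -d / (2t);
    -- the shear absorbs d.
    have := (F.shear (-d / (2 * t))).goursatForm_deriv_eq_zero h6 ht (η := η + t • ⟨_, hm⟩) (by
      have ht0 : t ≠ 0 := ht
      rw [Submodule.coe_add, Submodule.coe_smul, e]
      ext u
      simp [ofCoords, goursatForm, tri_apply, Fin.sum_univ_three, ω.neg_swap (l _)]
      field_simp
      ring) hv hf (hD _)
    simp only [this, LinearMap.zero_apply]

end DualVariety

/-! ### Smooth points of the dual variety -/

section SmoothDual

variable {C : Type*} [AddCommGroup C] [Module ℂ C] [FiniteDimensional ℂ C]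
  {ω : SymplecticForm C} {l m : Fin 3 → C}

/-- Evaluation of effective three-forms. -/
def evalForm (ω : SymplecticForm C) (u : Fin 3 → C) : effectiveForms ω →ₗ[ℂ] ℂ where
  toFun η := (η : ThreeForm C) u
  map_add' _ _ := rfl
  map_smul' _ _ := rfl

theorem cof_mem {E : Type*} (S : Subalgebra ℂ (E → ℂ)) {A : E → Fin 3 → Fin 3 → ℂ}
    (hA : ∀ i j, (fun x => A x i j) ∈ S) (i j : Fin 3) : (fun x => cof (A x) i j) ∈ S := by
  fin_cases i <;> fin_cases j <;>
  exact S.sub_mem (S.mul_mem (hA _ _) (hA _ _)) (S.mul_mem (hA _ _) (hA _ _))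

theorem momentLL_mem {E : Type*} (S : Subalgebra ℂ (E → ℂ)) {a : E → ℂ}
    {A B : E → Fin 3 → Fin 3 → ℂ} (ha : a ∈ S) (hA : ∀ i j, (fun x => A x i j) ∈ S)
    (hB : ∀ i j, (fun x => B x i j) ∈ S) (i j : Fin 3) :
    (fun x => momentLL (a x) (A x) (B x) i j) ∈ S :=
  S.sub_mem (cof_mem S hA i j) (S.mul_mem ha (hB i j))

theorem momentLM_mem {E : Type*} (S : Subalgebra ℂ (E → ℂ)) {a d : E → ℂ}
    {A B : E → Fin 3 → Fin 3 → ℂ} (ha : a ∈ S) (hd : d ∈ S) (hA : ∀ i j, (fun x => A x i j) ∈ S)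
    (hB : ∀ i j, (fun x => B x i j) ∈ S) (i j : Fin 3) :
    (fun x => momentLM (a x) (A x) (B x) (d x) i j) ∈ S := by
  have e : (fun x => momentLM (a x) (A x) (B x) (d x) i j) =
      algebraMap ℂ (E → ℂ) (if i = j then 2⁻¹ else 0) * ((∑ p, ∑ q, (fun x => A x p q) *
        fun x => B x p q) - a * d) - ∑ k, (fun x => A x j k) * fun x => B x k i := by
    ext x
    by_cases h : i = j <;> simp [momentLM, h]
    ring
  rw [e]
  exact S.sub_mem (S.mul_mem (S.algebraMap_mem _) (S.sub_mem (S.sum_mem fun p _ => S.sum_mem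
    fun q _ => S.mul_mem (hA p q) (hB p q)) (S.mul_mem ha hd)))
    (S.sum_mem fun k _ => S.mul_mem (hA j k) (hB k i))

theorem IsFrame.polar_mem_polyFun (F : IsFrame ω l m) (h6 : Module.finrank ℂ C = 6)
    (e : Module.Basis (Fin 3 ⊕ Fin 3) ℂ C) (v w : C) :
    (fun η : effectiveForms ω => (momentForm ω e (η : ThreeForm C)).polarBilin v w) ∈
      polyFun (effectiveForms ω) := by
  obtain ⟨κ, -, h⟩ := F.momentForm_polar h6 e
  have hev : ∀ u, (fun η : effectiveForms ω => (η : ThreeForm C) u) ∈ polyFun (effectiveForms ω) :=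
    fun u => linear_mem_polyFun (evalForm ω u)
  have hc : ∀ (k n : Fin 3 → C) (i j : Fin 3),
      (fun η : effectiveForms ω => comp (η : ThreeForm C) k n i j) ∈ polyFun (effectiveForms ω) :=
    fun k n i j => hev _
  obtain ⟨S, hS⟩ : ∃ S, S = polyFun (effectiveForms ω) := ⟨_, rfl⟩
  rw [← hS] at hev hc ⊢
  have e' : (fun η : effectiveForms ω => (momentForm ω e (η : ThreeForm C)).polarBilin v w) =
      algebraMap ℂ _ κ * ∑ i, ∑ j,
        (algebraMap ℂ _ (ω.form (m i) v * ω.form (m j) w) * (fun η : effectiveForms ω =>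
          momentLL ((η : ThreeForm C) l) (comp (η : ThreeForm C) l m) (comp (η : ThreeForm C) m l) i j)
        + algebraMap ℂ _ (ω.form (m i) v * ω.form w (l j) + ω.form (m i) w * ω.form v (l j)) *
          (fun η : effectiveForms ω => momentLM ((η : ThreeForm C) l) (comp (η : ThreeForm C) l m)
            (comp (η : ThreeForm C) m l) ((η : ThreeForm C) m) i j)
        + algebraMap ℂ _ (ω.form v (l i) * ω.form w (l j)) * (fun η : effectiveForms ω =>
          momentLL ((η : ThreeForm C) m) (comp (η : ThreeForm C) m l) (comp (η : ThreeForm C) l m)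
            i j)) := by
    ext η
    rw [h η η.2]
    simp only [Pi.mul_apply, Pi.add_apply, Finset.sum_apply, Pi.algebraMap_apply,
      Algebra.algebraMap_self, RingHom.id_apply]
  rw [e']
  exact S.mul_mem (S.algebraMap_mem _) (S.sum_mem fun i _ => S.sum_mem fun j _ =>
    S.add_mem (S.add_mem (S.mul_mem (S.algebraMap_mem _) (momentLL_mem S (hev l) (hc _ _) (hc _ _) i j))
      (S.mul_mem (S.algebraMap_mem _) (momentLM_mem S (hev l) (hev m) (hc _ _) (hc _ _) i j)))
      (S.mul_mem (S.algebraMap_mem _) (momentLL_mem S (hev m) (hc _ _) (hc _ _) i j)))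

theorem momentLL_smul (t a : ℂ) (A B : Fin 3 → Fin 3 → ℂ) (i j : Fin 3) :
    momentLL (t * a) (t • A) (t • B) i j = t ^ 2 * momentLL a A B i j := by
  fin_cases i <;> fin_cases j <;> simp [momentLL, cof] <;> ring

theorem momentLM_smul (t a d : ℂ) (A B : Fin 3 → Fin 3 → ℂ) (i j : Fin 3) :
    momentLM (t * a) (t • A) (t • B) (t * d) i j = t ^ 2 * momentLM a A B d i j := by
  by_cases h : i = j <;> simp [momentLM, Fin.sum_univ_three, h] <;> ring

theorem IsFrame.polar_smul (F : IsFrame ω l m) (h6 : Module.finrank ℂ C = 6)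
    (e : Module.Basis (Fin 3 ⊕ Fin 3) ℂ C) {η : ThreeForm C} (hη : η ∈ effectiveForms ω) (t : ℂ)
    (v w : C) : (momentForm ω e (t • η)).polarBilin v w =
      t ^ 2 * (momentForm ω e η).polarBilin v w := by
  obtain ⟨κ, -, h⟩ := F.momentForm_polar h6 e
  have hc : ∀ k n, comp (t • η) k n = t • comp η k n := fun k n => rfl
  rw [h _ ((effectiveForms ω).smul_mem t hη), h _ hη]
  simp only [hc, AlternatingMap.smul_apply, smul_eq_mul, momentLL_smul, momentLM_smul,
    Finset.mul_sum]
  refine Finset.sum_congr rfl fun i _ => Finset.sum_congr rfl fun j _ => ?_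
  ring

/-- At a point of tangency the moment form involves only the coordinates ω(·, l i), so the
endomorphism K attached to it by ω has its image in L. -/
theorem IsTangentHyperplane.exists_polar_eq_form (h6 : Module.finrank ℂ C = 6)
    (e : Module.Basis (Fin 3 ⊕ Fin 3) ℂ C) {η : ThreeForm C} (hη : η ∈ effectiveForms ω)
    {L : Submodule ℂ C} (hL : IsTangentHyperplane ω η L) (u : C) :
    ∃ k ∈ L, ∀ v, (momentForm ω e η).polarBilin u v = ω.form k v := by
  obtain ⟨v, hvL, hv⟩ := hL.1.1.exists_mem_ne_zero
  obtain ⟨l, m, F, -, rfl, e0⟩ := hL.exists_frame h6 hη hv hvL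
  obtain ⟨κ, -, h⟩ := F.momentForm_polar_ofCoords h6 e
  replace h := h (comp η m l) (η m) (F.B_symm h6 hη)
  rw [← e0] at h
  refine ⟨∑ j, (-κ * ∑ i, ω.form u (l i) * cof (comp η m l) i j) • l j,
    Submodule.sum_mem _ fun j _ => Submodule.smul_mem _ _ (Submodule.subset_span ⟨j, rfl⟩),
    fun v => ?_⟩
  rw [h]
  simp only [Fin.sum_univ_three, map_add, map_smul, LinearMap.add_apply, LinearMap.smul_apply,
    smul_eq_mul, ω.neg_swap v (l _)]
  ring

/-- In a frame, `η ↦ ω(K l₀, K m₀)`, where `K` is the endomorphism that corresponds to the moment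
form of `η`. -/
def dualQuartic (e : Module.Basis (Fin 3 ⊕ Fin 3) ℂ C) (l m : Fin 3 → C)
    (η : effectiveForms ω) : ℂ :=
  ∑ i, ((momentForm ω e (η : ThreeForm C)).polarBilin (l 0) (l i) *
      (momentForm ω e (η : ThreeForm C)).polarBilin (m 0) (m i) -
    (momentForm ω e (η : ThreeForm C)).polarBilin (l 0) (m i) *
      (momentForm ω e (η : ThreeForm C)).polarBilin (m 0) (l i))

theorem IsFrame.isHomogPoly_dualQuartic (F : IsFrame ω l m) (h6 : Module.finrank ℂ C = 6)
    (e : Module.Basis (Fin 3 ⊕ Fin 3) ℂ C) : IsHomogPoly (dualQuartic (ω := ω) e l m) := by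
  refine ⟨?_, 4, fun t η => ?_⟩
  · have e' : dualQuartic (ω := ω) e l m = ∑ i, (
      (fun η : effectiveForms ω => (momentForm ω e (η : ThreeForm C)).polarBilin (l 0) (l i)) *
      (fun η : effectiveForms ω => (momentForm ω e (η : ThreeForm C)).polarBilin (m 0) (m i)) -
      (fun η : effectiveForms ω => (momentForm ω e (η : ThreeForm C)).polarBilin (l 0) (m i)) *
      (fun η : effectiveForms ω => (momentForm ω e (η : ThreeForm C)).polarBilin (m 0) (l i))) := by
      ext η
      simp only [dualQuartic, Finset.sum_apply, Pi.sub_apply, Pi.mul_apply]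
    rw [e']
    exact (polyFun _).sum_mem fun i _ => (polyFun _).sub_mem
      ((polyFun _).mul_mem (F.polar_mem_polyFun h6 e _ _) (F.polar_mem_polyFun h6 e _ _))
      ((polyFun _).mul_mem (F.polar_mem_polyFun h6 e _ _) (F.polar_mem_polyFun h6 e _ _))
  · simp only [dualQuartic, Submodule.coe_smul, F.polar_smul h6 e η.2, Finset.mul_sum]
    refine Finset.sum_congr rfl fun i _ => ?_
    ring

/-- The images of `l 0` and `m 0` under K both lie in the Lagrangian plane of tangency, so ω
vanishes on them. -/
theorem IsFrame.vanishesOn_dualQuartic (F : IsFrame ω l m) (h6 : Module.finrank ℂ C = 6)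
    (e : Module.Basis (Fin 3 ⊕ Fin 3) ℂ C) :
    VanishesOn (dualQuartic (ω := ω) e l m) (dualVariety ω) := by
  rintro p ⟨L, hL⟩
  obtain ⟨k, hk, h⟩ := hL.exists_polar_eq_form h6 e p.rep.2 (l 0)
  obtain ⟨k', hk', h'⟩ := hL.exists_polar_eq_form h6 e p.rep.2 (m 0)
  have h0 := F.form_eq_sum h6 k k'
  rw [hL.1.1.2 k hk k' hk'] at h0
  simp only [dualQuartic, h, h', Fin.sum_univ_three] at h0 ⊢
  rw [ω.neg_swap k (m 0), ω.neg_swap k (m 1), ω.neg_swap k (m 2), ω.neg_swap k' (m 0),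
    ω.neg_swap k' (m 1), ω.neg_swap k' (m 2), ω.neg_swap k' (l 0),
    ω.neg_swap k' (l 1), ω.neg_swap k' (l 2)]
  linear_combination h0

/-- It is enough to differentiate one vanishing polynomial in one direction: the quartic, as the
component a of η varies from zero. -/
theorem IsFrame.notMem_singularLocus (F : IsFrame ω l m) (h6 : Module.finrank ℂ C = 6)
    (e : Module.Basis (Fin 3 ⊕ Fin 3) ℂ C) {B : Fin 3 → Fin 3 → ℂ} {d : ℂ}
    (hB : ∀ i j, B i j = B j i) (hdet : (Matrix.of B).det ≠ 0) {η : effectiveForms ω} (h0 : η ≠ 0)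
    (hη : (η : ThreeForm C) = ofCoords ω l m 0 0 B d) :
    Projectivization.mk ℂ η h0 ∉ singularLocus (dualVariety ω) := by
  intro hs
  have hm := F.ofCoords_mem h6 1 0 (A := 0) (B := 0) (fun _ _ => rfl) (fun _ _ => rfl)
  have h1 := ((mk_mem_singularLocus h0).1 hs).2 _ (F.isHomogPoly_dualQuartic h6 e)
    (F.vanishesOn_dualQuartic h6 e) ⟨_, hm⟩
  obtain ⟨κ, hκ, h⟩ := F.momentForm_polar h6 e
  -- The coefficient of t is -κ² det B, which is the derivative at zero.
  have h2 : (fun t : ℂ => dualQuartic e l m (η + t • ⟨_, hm⟩)) =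
      fun t => t * (-κ ^ 2 * (Matrix.of B).det) + t ^ 2 * (-κ ^ 2 * d ^ 2 / 4) := by
    ext t
    have e1 : ((η + t • ⟨_, hm⟩ : effectiveForms ω) : ThreeForm C) = ofCoords ω l m t 0 B d := by
      rw [Submodule.coe_add, Submodule.coe_smul, hη, smul_ofCoords, ofCoords_add]
      simp
    have h3 := h _ (F.ofCoords_mem h6 t d (A := 0) (fun _ _ => rfl) hB)
    rw [F.ofCoords_left, F.ofCoords_right, F.comp_ofCoords_left, F.comp_ofCoords_right] at h3
    rw [dualQuartic, e1, Matrix.det_fin_three]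
    simp [h3, Fin.sum_univ_three, F.ll, F.ml, F.mm, momentLL, momentLM, cof, hB 1 0, hB 2 0, hB 2 1]
    ring
  rw [h2] at h1
  have h4 := ((hasDerivAt_id' (0 : ℂ)).mul_const (-κ ^ 2 * (Matrix.of B).det)).add
    ((hasDerivAt_pow 2 (0 : ℂ)).mul_const (-κ ^ 2 * d ^ 2 / 4))
  have h5 := h4.deriv.symm.trans h1
  simp [hκ, hdet] at h5

end SmoothDual

/-! ### Goursat equations -/

section Goursat

variable {C : Type*} [AddCommGroup C] [Module ℂ C] {ω : SymplecticForm C} {l m : Fin 3 → C}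

/-- The plane `x₀ = y₀ = y₂ = 0` in the coordinates of a frame. -/
def goursatPlane (l m : Fin 3 → C) : Submodule ℂ C := Submodule.span ℂ (Set.range ![l 1, l 2, m 1])

theorem IsFrame.mem_goursatPlane (F : IsFrame ω l m) (h6 : Module.finrank ℂ C = 6) {v : C} :
    v ∈ goursatPlane l m ↔ ω.form (m 0) v = 0 ∧ ω.form v (l 0) = 0 ∧ ω.form v (l 2) = 0 := by
  rw [goursatPlane, Submodule.mem_span_range_iff_exists_fun]
  constructor
  · rintro ⟨c, rfl⟩
    simp [Fin.sum_univ_three, F.ll, F.ml, F.mm]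
  · rintro ⟨h0, h1, h2⟩
    refine ⟨![ω.form (m 1) v, ω.form (m 2) v, ω.form v (l 1)], ?_⟩
    conv_rhs => rw [F.expand' h6 v, h0, h1, h2]
    simp [Fin.sum_univ_three]

theorem IsFrame.finrank_goursatPlane (F : IsFrame ω l m) :
    Module.finrank ℂ (goursatPlane l m) = 3 := by
  have : LinearIndependent ℂ ![l 1, l 2, m 1] := by
    have := F.linearIndependent.comp ![Sum.inl 1, Sum.inl 2, Sum.inr 1] (by decide)
    convert this using 1
    ext i; fin_cases i <;> rfl
  rw [goursatPlane, finrank_span_eq_card this, Fintype.card_fin]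

/-- The difference of the two sides is (x₀ ∧ y₀ + x₁ ∧ y₁) ∧ y₂, a multiple of ω ∧ y₂, which
vanishes on isotropic triples. Thus on Lagrangian planes the form is equivalent to a decomposable
one. -/
theorem IsFrame.goursatForm_apply (F : IsFrame ω l m) (h6 : Module.finrank ℂ C = 6) {u : Fin 3 → C}
    (h01 : ω.form (u 0) (u 1) = 0) (h02 : ω.form (u 0) (u 2) = 0) (h12 : ω.form (u 1) (u 2) = 0) :
    goursatForm ω l m u =
      2 * tri (ω.form.flip (l 0)) (ω.form (m 0)) (ω.form.flip (l 2)) u := by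
  rw [F.form_eq_sum h6] at h01 h02 h12
  simp only [Fin.sum_univ_three, ω.neg_swap (l _)] at h01 h02 h12
  simp [goursatForm, tri_apply]
  linear_combination -ω.form (u 2) (l 2) * h01 + ω.form (u 1) (l 2) * h02
    - ω.form (u 0) (l 2) * h12

/-- Once y₂(v) = 0, the wedge ω(v, ·) ∧ η(v, ·, ·) equals -2 P ∧ R ∧ y₂, where P involves only x₀,
y₀ and R only x₁, y₁. So P = 0 or R = 0, which are the two planes. -/
theorem IsFrame.mem_or_mem_goursatPlane (F : IsFrame ω l m) (h6 : Module.finrank ℂ C = 6) {v : C}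
    (h : ∀ u, wedgeInsert ω (goursatForm ω l m) v u = 0) :
    v ∈ goursatPlane l m ∨ v ∈ goursatPlane (l ∘ Equiv.swap 0 1) (m ∘ Equiv.swap 0 1) := by
  rw [F.mem_goursatPlane h6, (F.perm (Equiv.swap 0 1)).mem_goursatPlane h6]
  have e2 : (Equiv.swap (0 : Fin 3) 1) 2 = 2 := by decide
  simp only [Function.comp_apply, Equiv.swap_apply_left, e2]
  have y2 := h ![l 2, l 1, m 1]
  simp [wedgeInsert, goursatForm, tri_apply, F.ll, F.ml, F.mm] at y2
  have g1 := h ![l 0, m 1, m 2]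
  have g2 := h ![l 0, l 1, m 2]
  have g3 := h ![m 0, m 1, m 2]
  have g4 := h ![l 1, m 0, m 2]
  simp [wedgeInsert, goursatForm, tri_apply, F.ll, F.ml, F.mm, y2, ω.neg_swap v (m _)] at g1 g2 g3 g4
  grind

theorem IsFrame.goursatPlane_inf_orthogonal (F : IsFrame ω l m) (h6 : Module.finrank ℂ C = 6) :
    goursatPlane l m ⊓ ω.form.orthogonal (goursatPlane l m) = Submodule.span ℂ {l 2} := by
  have mem : ∀ i, ![l 1, l 2, m 1] i ∈ goursatPlane l m := fun i => Submodule.subset_span ⟨i, rfl⟩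
  refine le_antisymm (fun v hv => ?_) ?_
  · obtain ⟨h0, h1, h2⟩ := (F.mem_goursatPlane h6).1 hv.1
    have k1 : ω.form (l 1) v = 0 := hv.2 _ (mem 0)
    have k2 : ω.form (m 1) v = 0 := hv.2 _ (mem 2)
    rw [ω.neg_swap, neg_eq_zero] at k1
    rw [Submodule.mem_span_singleton]
    refine ⟨ω.form (m 2) v, ?_⟩
    conv_rhs => rw [F.expand' h6 v, h0, h1, h2, k1, k2]
    simp
  · rw [Submodule.span_singleton_le_iff_mem]
    refine ⟨mem 1, fun v hv => ?_⟩
    exact ((F.mem_goursatPlane h6).1 hv).2.2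

variable [FiniteDimensional ℂ C]

theorem IsFrame.goursat_goursatPlane (F : IsFrame ω l m) (h6 : Module.finrank ℂ C = 6) {b : ℂ}
    (hb : b ≠ 0) : goursat ω (goursatPlane l m) = mongeAmpere ω (b • goursatForm ω l m) := by
  ext L
  refine and_congr_right fun hL => ?_
  have tri_eq : ∀ u : Fin 3 → C, (∀ i, u i ∈ L) → (b • goursatForm ω l m) u =
      b * (2 * tri (ω.form.flip (l 0)) (ω.form (m 0)) (ω.form.flip (l 2)) u) := by
    intro u hu
    rw [AlternatingMap.smul_apply, F.goursatForm_apply h6 (hL.2 _ (hu 0) _ (hu 1))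
      (hL.2 _ (hu 0) _ (hu 2)) (hL.2 _ (hu 1) _ (hu 2)), smul_eq_mul]
  constructor
  · intro h
    obtain ⟨v, hv, hv0⟩ := Submodule.exists_mem_ne_zero_of_ne_bot h
    obtain ⟨h0, h1, h2⟩ := (F.mem_goursatPlane h6).1 hv.2
    obtain ⟨k, n, G, rfl, rfl⟩ := exists_isFrame_of_isLagrangian hL hv0 hv.1
    refine (G.mem_mongeAmpere h6 ?_).2
    rw [tri_eq _ fun i => Submodule.subset_span ⟨i, rfl⟩]
    simp [tri_apply, h0, h1, h2]
  · intro h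
    obtain ⟨v, hv, hv0⟩ := hL.exists_mem_ne_zero
    obtain ⟨k, n, G, -, rfl⟩ := exists_isFrame_of_isLagrangian hL hv0 hv
    have mem : ∀ i, k i ∈ Submodule.span ℂ (Set.range k) := fun i => Submodule.subset_span ⟨i, rfl⟩
    have h1 := h k mem
    rw [tri_eq k mem] at h1
    have h2 : (Matrix.of ![fun j => ω.form (k j) (l 0), fun j => ω.form (m 0) (k j),
        fun j => ω.form (k j) (l 2)]).det = 0 := by
      have := ((mul_eq_zero.1 h1).resolve_left hb)
      rw [tri_apply] at this
      rw [Matrix.det_fin_three]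
      simp at this ⊢
      linear_combination this
    -- The three equations of the Goursat plane restrict to dependent functionals on L, so they have
    -- a common nonzero solution.
    obtain ⟨c, hc, hc'⟩ := Matrix.exists_mulVec_eq_zero_iff.2 h2
    rw [Submodule.ne_bot_iff]
    refine ⟨∑ j, c j • k j, ⟨Submodule.sum_mem _ fun j _ => Submodule.smul_mem _ _ (mem j),
      (F.mem_goursatPlane h6).2 ⟨?_, ?_, ?_⟩⟩, fun h0 => hc ?_⟩
    · have := congrFun hc' 1
      simpa [Matrix.mulVec, dotProduct, mul_comm] using this
    · have := congrFun hc' 0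
      simpa [Matrix.mulVec, dotProduct, mul_comm] using this
    · have := congrFun hc' 2
      simpa [Matrix.mulVec, dotProduct, mul_comm] using this
    · exact funext (Fintype.linearIndependent_iff.1 G.linearIndependent_left c h0)

/-- If all Lagrangian planes through `v` belong to the equation, then `η(v, ·, ·)` vanishes on the
orthogonal of `v`. -/
theorem insert_eq_zero_of_forall_mem (h6 : Module.finrank ℂ C = 6) {η : ThreeForm C}
    (hη : η ∈ effectiveForms ω) {v : C} (hv : v ≠ 0)
    (h : ∀ L, IsLagrangian ω L → v ∈ L → L ∈ mongeAmpere ω η) {x y : C} (hx : ω.form v x = 0)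
    (hy : ω.form v y = 0) : η ![v, x, y] = 0 := by
  have iso : ∀ x y, ω.form v x = 0 → ω.form v y = 0 → ω.form x y = 0 → η ![v, x, y] = 0 := by
    intro x y hx hy hxy
    by_cases hl : LinearIndependent ℂ ![v, x, y]
    · have hL := isLagrangian_span (ω := ω) hl fun i j => by
        fin_cases i <;> fin_cases j <;>
        simp [ω.self, hx, hy, hxy, ω.neg_swap x v, ω.neg_swap y v, ω.neg_swap y x]
      exact (h _ hL (Submodule.subset_span ⟨0, rfl⟩)).2 _ fun i => Submodule.subset_span ⟨i, rfl⟩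
    · exact η.map_linearDependent _ hl
  obtain ⟨l, m, F, rfl⟩ := exists_isFrame_of_ne_zero ω h6 hv
  have tr := (F.mem_effectiveForms h6 η).1 hη (l 0)
  -- On isotropic pairs η(v, ·, ·) vanishes, so modulo v it is a multiple of ω: this pair equates
  -- the values on (l 1, m 1) and (l 2, m 2). Effectiveness says that their sum is zero.
  have k := iso (l 1 + l 2) (m 1 + (-1 : ℂ) • m 2) (by simp [F.ll]) (by simp [F.lm])
    (by simp [F.lm])
  simp only [threeForm_add_one, threeForm_add_two, threeForm_smul_two,
    iso (l 1) (m 2) (F.ll _ _) (by simp [F.lm]) (by simp [F.lm]),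
    iso (l 2) (m 1) (F.ll _ _) (by simp [F.lm]) (by simp [F.lm])] at k
  rw [Fin.sum_univ_three, threeForm_eq_zero_zero_one] at tr
  have k1 : η ![l 0, l 1, m 1] = 0 := by linear_combination (tr + k) / 2
  have k2 : η ![l 0, l 2, m 2] = 0 := by linear_combination (tr - k) / 2
  -- both arguments are reduced to the vectors of the frame one after the other
  have red : ∀ f : C →ₗ[ℂ] ℂ, (∀ i, f (l i) = 0) → f (m 1) = 0 → f (m 2) = 0 →
      ∀ z, ω.form (l 0) z = 0 → f z = 0 := by
    intro f hl h1 h2 z hz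
    have hz' : ω.form z (l 0) = 0 := by rw [ω.neg_swap, hz, neg_zero]
    rw [F.expand' h6 z]
    simp [hl, h1, h2, hz']
  have bas : ∀ k, ω.form (l 0) k = 0 → (η ![l 0, k, l 1] = 0) → (η ![l 0, k, l 2] = 0) →
      (η ![l 0, k, m 1] = 0) → (η ![l 0, k, m 2] = 0) → η ![l 0, k, y] = 0 := by
    intro k hk e1 e2 e3 e4
    refine red (insertTwo η (l 0) k) (fun i => ?_) e3 e4 y hy
    fin_cases i
    · exact threeForm_eq_zero_zero_two η (l 0) k
    · exact e1
    · exact e2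
  have z : ∀ a b, η ![l 0, a, b] = 0 → η ![l 0, b, a] = 0 := fun a b hab => by
    rw [threeForm_swap_one_two, hab, neg_zero]
  have i12 := iso (l 1) (l 2) (F.ll _ _) (F.ll _ _) (F.ll _ _)
  have j12 := iso (l 1) (m 2) (F.ll _ _) (by simp [F.lm]) (by simp [F.lm])
  have j21 := iso (l 2) (m 1) (F.ll _ _) (by simp [F.lm]) (by simp [F.lm])
  have m12 := iso (m 1) (m 2) (by simp [F.lm]) (by simp [F.lm]) (F.mm _ _)
  apply z
  refine red (insertTwo η (l 0) y) (fun i => ?_) ?_ ?_ x hx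
  · fin_cases i
    · exact threeForm_eq_zero_zero_two η (l 0) y
    · exact z _ _ (bas _ (F.ll _ _) (threeForm_eq_zero_one_two η _ _) i12 k1 j12)
    · exact z _ _ (bas _ (F.ll _ _) (z _ _ i12) (threeForm_eq_zero_one_two η _ _) j21 k2)
  · exact z _ _ (bas _ (by simp [F.lm]) (z _ _ k1) (z _ _ j21) (threeForm_eq_zero_one_two η _ _) m12)
  · exact z _ _ (bas _ (by simp [F.lm]) (z _ _ j12) (z _ _ k2) (z _ _ m12)
      (threeForm_eq_zero_one_two η _ _))

/-- Every Lagrangian plane through a nonzero v in D meets D, so v is exceptional for η and lies in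
one of the two planes. A linear space contained in a union of two subspaces lies in one of them. -/
theorem IsFrame.eq_goursatPlane (F : IsFrame ω l m) (h6 : Module.finrank ℂ C = 6) {b : ℂ}
    (hb : b ≠ 0) (hη : b • goursatForm ω l m ∈ effectiveForms ω) {D : Submodule ℂ C}
    (hD : Module.finrank ℂ D = 3) (h : goursat ω D = mongeAmpere ω (b • goursatForm ω l m)) :
    D = goursatPlane l m ∨ D = goursatPlane (l ∘ Equiv.swap 0 1) (m ∘ Equiv.swap 0 1) := by
  have hmem : ∀ v ∈ D,
      v ∈ goursatPlane l m ∨ v ∈ goursatPlane (l ∘ Equiv.swap 0 1) (m ∘ Equiv.swap 0 1) := by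
    intro v hv
    by_cases hv0 : v = 0
    · exact Or.inl (hv0 ▸ Submodule.zero_mem _)
    refine F.mem_or_mem_goursatPlane h6 (wedgeInsert_eq_zero fun x y hx hy => ?_)
    have := insert_eq_zero_of_forall_mem h6 hη hv0 (fun L hL hvL => by
      rw [← h]
      exact ⟨hL, (Submodule.ne_bot_iff _).2 ⟨v, ⟨hvL, hv⟩, hv0⟩⟩) hx hy
    rw [AlternatingMap.smul_apply, smul_eq_mul] at this
    exact (mul_eq_zero.1 this).resolve_left hb
  have hle : D ≤ goursatPlane l m ∨ D ≤ goursatPlane (l ∘ Equiv.swap 0 1) (m ∘ Equiv.swap 0 1) := by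
    by_contra! H
    obtain ⟨v, hv, hv'⟩ := SetLike.not_le_iff_exists.1 H.1
    obtain ⟨w, hw, hw'⟩ := SetLike.not_le_iff_exists.1 H.2
    have v1 := (hmem v hv).resolve_left hv'
    have w1 := (hmem w hw).resolve_right hw'
    rcases hmem (v + w) (D.add_mem hv hw) with k | k
    · exact hv' ((Submodule.add_mem_iff_left _ w1).1 k)
    · exact hw' ((Submodule.add_mem_iff_right _ v1).1 k)
  refine hle.imp (fun k => ?_) fun k => ?_
  · exact Submodule.eq_of_le_of_finrank_eq k (by rw [hD, F.finrank_goursatPlane])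
  · exact Submodule.eq_of_le_of_finrank_eq k (by rw [hD, (F.perm _).finrank_goursatPlane])

theorem IsFrame.inf_orthogonal_of_goursat (F : IsFrame ω l m) (h6 : Module.finrank ℂ C = 6) {b : ℂ}
    (hb : b ≠ 0) (hη : b • goursatForm ω l m ∈ effectiveForms ω) {D : Submodule ℂ C}
    (hD : Module.finrank ℂ D = 3) (h : goursat ω D = mongeAmpere ω (b • goursatForm ω l m)) :
    D ⊓ ω.form.orthogonal D = Submodule.span ℂ {l 2} := by
  rcases F.eq_goursatPlane h6 hb hη hD h with rfl | rfl
  · exact F.goursatPlane_inf_orthogonal h6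
  · rw [(F.perm (Equiv.swap 0 1)).goursatPlane_inf_orthogonal h6]
    rfl

end Goursat

end MongeAmpere

end

/-! ### The theorem, assembled from the normal forms -/

theorem mainTheorem1 {C : Type*} [AddCommGroup C] [Module ℂ C] [FiniteDimensional ℂ C]
    (ω : MongeAmpere.SymplecticForm C) (e : Module.Basis (Fin 3 ⊕ Fin 3) ℂ C)
    (η : MongeAmpere.effectiveForms ω) (hη : η ≠ 0) :
    -- the cocharacteristic variety is cut out by the moment map
    MongeAmpere.cocharacteristic ω η = MongeAmpere.quadric (MongeAmpere.momentForm ω e η) ∧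
    -- (O)
    (Projectivization.mk ℂ η hη ∉ MongeAmpere.dualVariety ω →
      MongeAmpere.quadRank (MongeAmpere.momentForm ω e η) = 6 ∧
      Irreducible (MongeAmpere.quadPoly e (MongeAmpere.momentForm ω e η)) ∧
      MongeAmpere.singularLocus (MongeAmpere.cocharacteristic ω η) = ∅) ∧
    -- (L)
    (Projectivization.mk ℂ η hη ∈ MongeAmpere.dualVariety ω →
      Projectivization.mk ℂ η hη ∉ MongeAmpere.singularLocus (MongeAmpere.dualVariety ω) →
      MongeAmpere.quadRank (MongeAmpere.momentForm ω e η) = 3 ∧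
      Irreducible (MongeAmpere.quadPoly e (MongeAmpere.momentForm ω e η)) ∧
      MongeAmpere.singularLocus (MongeAmpere.cocharacteristic ω η) =
        MongeAmpere.projSubspace (MongeAmpere.radical (MongeAmpere.momentForm ω e η))) ∧
    -- (G)
    (Projectivization.mk ℂ η hη ∈ MongeAmpere.singularLocus (MongeAmpere.dualVariety ω) →
      Projectivization.mk ℂ η hη ∉ MongeAmpere.lagrangianForms ω →
      MongeAmpere.quadRank (MongeAmpere.momentForm ω e η) = 1 ∧
      ¬ Irreducible (MongeAmpere.quadPoly e (MongeAmpere.momentForm ω e η)) ∧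
      MongeAmpere.singularLocus (MongeAmpere.cocharacteristic ω η) = ∅ ∧
      (∃ D : Submodule ℂ C, Module.finrank ℂ D = 3 ∧
        MongeAmpere.goursat ω D = MongeAmpere.mongeAmpere ω η) ∧
      ∀ D : Submodule ℂ C, Module.finrank ℂ D = 3 →
        MongeAmpere.goursat ω D = MongeAmpere.mongeAmpere ω η →
        Module.finrank ℂ (D ⊓ ω.form.orthogonal D : Submodule ℂ C) = 1 ∧
        MongeAmpere.cocharacteristic ω η =
          MongeAmpere.projSubspace (ω.form.orthogonal (D ⊓ ω.form.orthogonal D))) ∧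
    -- (P)
    (Projectivization.mk ℂ η hη ∈ MongeAmpere.lagrangianForms ω →
      MongeAmpere.quadRank (MongeAmpere.momentForm ω e η) = 0 ∧
      MongeAmpere.cocharacteristic ω η = Set.univ) := by
  have h6 : Module.finrank ℂ C = 6 := by
    rw [Module.finrank_eq_card_basis e]
    rfl
  have hη' : (η : MongeAmpere.ThreeForm C) ≠ 0 := fun h => hη (Subtype.ext h)
  have hσ := MongeAmpere.cocharacteristic_eq h6 e η.2 hη'
  refine ⟨hσ, fun hO => ?_, fun hL hs => ?_, fun hG hP => ?_, fun hP => ?_⟩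
  · rw [MongeAmpere.mk_mem_dualVariety] at hO
    have hr := MongeAmpere.momentForm_radical_eq_bot h6 e η.2 hO
    have hrank : MongeAmpere.quadRank (MongeAmpere.momentForm ω e η) = 6 := by
      have := MongeAmpere.quadRank_add_finrank_radical (MongeAmpere.momentForm ω e η)
      rwa [hr, finrank_bot, add_zero, h6] at this
    refine ⟨hrank, MongeAmpere.irreducible_quadPoly e (by omega), ?_⟩
    rw [hσ, MongeAmpere.singularLocus_quadric (by omega), hr]
    exact Set.eq_empty_of_forall_notMem fun p hp => p.rep_nonzero hp
  · obtain ⟨L, hL⟩ := (MongeAmpere.mk_mem_dualVariety hη).1 hL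
    -- The Goursat and Lagrangian normal forms are singular points of the dual variety, so only det
    -- B ≠ 0 remains.
    rcases hL.cases h6 η.2 hη' with ⟨l, m, B, d, F, hB, hdet, h⟩ | ⟨l, m, b, F, hb, h⟩ | h
    · have hrank : MongeAmpere.quadRank (MongeAmpere.momentForm ω e η) = 3 := by
        have := MongeAmpere.quadRank_add_finrank_radical (MongeAmpere.momentForm ω e η)
        rw [h, F.radical_eq_span h6 e hB hdet, F.isLagrangian.1, h6, ← h] at this
        omega
      refine ⟨hrank, MongeAmpere.irreducible_quadPoly e (by omega), ?_⟩
      rw [hσ, MongeAmpere.singularLocus_quadric (by omega)]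
    · exact absurd (MongeAmpere.goursatForm_mem_singularLocus F h6 hb hη h) hs
    · exact absurd (h.mem_singularLocus h6 hη) hs
  · rw [MongeAmpere.mk_mem_lagrangianForms] at hP
    obtain ⟨L, hL⟩ := (MongeAmpere.mk_mem_dualVariety hη).1 hG.1
    rcases hL.cases h6 η.2 hη' with ⟨l, m, B, d, F, hB, hdet, h⟩ | ⟨l, m, b, F, hb, h⟩ | h
    -- Here the quartic excludes the normal form with det B ≠ 0, and X* is excluded by hypothesis.
    · exact absurd hG (F.notMem_singularLocus h6 e hB hdet hη h)
    · obtain ⟨c, hc, hQ⟩ := F.momentForm_goursatForm h6 e hb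
      rw [← h] at hQ
      have hl : ω.form.flip (l 2) ≠ 0 := by
        intro h0
        have := congrArg (fun f => f (m 2)) h0
        simp [F.ml] at this
      have hset : MongeAmpere.cocharacteristic ω (η : MongeAmpere.ThreeForm C) =
          {p | ω.form.flip (l 2) p.rep = 0} := by
        rw [hσ]
        ext p
        change MongeAmpere.momentForm ω e η p.rep = 0 ↔ ω.form.flip (l 2) p.rep = 0
        rw [hQ, mul_eq_zero, mul_self_eq_zero]
        exact or_iff_right hc
      refine ⟨MongeAmpere.quadRank_eq_one hl hc hQ, MongeAmpere.not_irreducible_quadPoly e _ c hQ,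
        ?_, ⟨_, F.finrank_goursatPlane, ?_⟩, fun D hD hDη => ?_⟩
      · rw [hset, MongeAmpere.singularLocus_eq_empty_of_linear hl]
      · rw [h, F.goursat_goursatPlane h6 hb]
      · have hη2 := η.2
        rw [h] at hDη hη2
        rw [hset, F.inf_orthogonal_of_goursat h6 hb hη2 hD hDη]
        refine ⟨finrank_span_singleton (F.linearIndependent_left.ne_zero 2), ?_⟩
        ext p
        change ω.form p.rep (l 2) = 0 ↔ p.rep ∈ ω.form.orthogonal (Submodule.span ℂ {l 2})
        rw [LinearMap.BilinForm.mem_orthogonal_iff]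
        constructor
        · intro hp v hv
          obtain ⟨a, rfl⟩ := Submodule.mem_span_singleton.1 hv
          change ω.form (a • l 2) p.rep = 0
          rw [map_smul, LinearMap.smul_apply, ω.neg_swap, hp, neg_zero, smul_zero]
        · intro hp
          rw [ω.neg_swap, show ω.form (l 2) p.rep = 0 from
            hp _ (Submodule.mem_span_singleton_self _), neg_zero]
    · exact absurd h hP
  · rw [MongeAmpere.mk_mem_lagrangianForms] at hP
    have h0 := hP.momentForm_eq_zero h6 e
    refine ⟨?_, ?_⟩
    · have hpolar : (0 : QuadraticForm ℂ C).polarBilin = 0 := by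
        ext v w
        simp [QuadraticMap.polar]
      rw [h0, MongeAmpere.quadRank, hpolar, LinearMap.range_zero, finrank_bot]
    · rw [hσ, h0]
      exact Set.eq_univ_of_forall fun p => rfl
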